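/- **Setting.** Let $m,n\ge 1$, $A\in\mathbb R^{m\times m}$, $B\in\mathbb R^{m\times n}$, let $Q\in\mathbb R^{m\times m}$, $R\in\mathbb R^{n\times n}$ be symmetric positive definite, and $0<\gamma<1$. Let $\mathcal D$ be a probability distribution on $\mathbb R^m$ such that $v\sim\mathcal D$ satisfies $\mathbb E[v]=0$, $\mathbb E[vv^\top]=I$ and $\|v\|_2^2\le C_m$ almost surely. For a policy $K\in\mathbb R^{n\times m}$ and a noise sequence $\mathcal Z=(z_t)_{t\ge 0}$ put $s_0=0$, $u_t=-Ks_t$, $s_{t+1}=As_t+Bu_t+z_t$, $$\mathcal C_{\rm dyn}(K;\mathcal Z)=\sum_{t\ge 0}\gamma^t\left(s_t^\top Qs_t+u_t^\top Ru_t\right),\qquad \mathcal C_{\rm dyn}(K)=\mathbb E_{\mathcal Z\sim\mathcal D^{\mathbb N}}[\mathcal C_{\rm dyn}(K;\mathcal Z)]\in[0,\infty].$$ Let $D=mn$, let $K_0$ be a policy with $\mathcal C_{\rm dyn}(K_0)<\infty$, let $K^*$ be a minimizer of $\mathcal C_{\rm dyn}$ over all policies, put $\Delta_0=\mathcal C_{\rm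 dyn}(K_0)-\mathcal C_{\rm dyn}(K^*)$ and $\mathcal G=\{K:\mathcal C_{\rm dyn}(K)-\mathcal C_{\rm dyn}(K^*)\le 10\Delta_0\}$. Policies carry the Frobenius norm and inner product. Call positive reals $\phi,\lambda,\rho,\mu$ *curvature parameters* if, on the set $\mathcal X$ of policies of finite cost, $\mathcal C_{\rm dyn}$ is continuously differentiable and attains its minimum, and * $\|\nabla\mathcal C_{\rm dyn}(K')-\nabla\mathcal C_{\rm dyn}(K)\|\le\phi\|K'-K\|$ and $|\mathcal C_{\rm dyn}(K')-\mathcal C_{\rm dyn}(K)|\le\lambda\|K'-K\|$ for all $K\in\mathcal G$ and $K'\in\mathcal X$ with $\|K'-K\|\le\rho$; * $\|\nabla\mathcal C_{\rm dyn}(K)\|^2\ge\mu\,(\mathcal C_{\rm dyn}(K)-\mathcal C_{\rm dyn}(K^*))$ for all $K\in\mathcal X$. *Algorithm* (one-point feedback), with step size $\eta>0$ and smoothing radius $r>0$: at each iteration $t$ draw, independently, $\mathcal Z_t\sim\mathcal D^{\mathbb N}$ and $U_t$ uniform on the unit sphere of $\mathbb R^{n\times m}$, and set $$K_{t+1}=K_t-\eta\,\mathcal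 C_{\rm dyn}(K_t+rU_t;\mathcal Z_t)\,\tfrac Dr\,U_t .$$ **Corollary.** A minimizer $K^*$ and curvature parameters exist. Moreover, let $\phi,\lambda,\rho,\mu$ be any curvature parameters, put $\theta=\min\{\tfrac1{2\phi},\tfrac\rho\lambda\}$ and $$G_2=\left(\frac Dr\cdot\frac{2(\|Q\|+\|R\|\lambda^2)C_m}{1-\sqrt\gamma}\right)^2\left(\frac{20\,\mathcal C_{\rm dyn}(K_0)}{\sigma_{\min}(Q)}\cdot\frac{1-\gamma}{\gamma}\right)^{3},\qquad G_\infty=\frac Dr\cdot\frac{2(\|Q\|+\|R\|\lambda^2)C_m}{1-\sqrt\gamma}\left(\frac{20\,\mathcal C_{\rm dyn}(K_0)}{\sigma_{\min}(Q)}\cdot\frac{1-\gamma}{\gamma}\right)^{3/2}$$ (spectral norms, smallest singular value). Let $\epsilon>0$ satisfy $\epsilon\log(120\Delta_0/\epsilon)<\tfrac{10}3\Delta_0$ (where $\Delta_0>0$), and let $\eta,r>0$ satisfy $$\eta\le\min\left\{\frac{\epsilon\mu}{240\,\phi\,G_2},\ \frac1{2\phi},\ \frac{\rho}{G_\infty}\right\},\qquad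 r\le\min\left\{\frac{\theta\mu}{8\phi}\sqrt{\frac\epsilon{15}},\ \frac1{2\phi}\sqrt{\frac{\epsilon\mu}{30}},\ \rho\right\}.$$ Then, with probability greater than $3/4$, all observed costs in the first $T=\left\lceil\frac4{\eta\mu}\log\frac{120\Delta_0}\epsilon\right\rceil$ iterations ($T=0$ if this is negative) are finite and $$\mathcal C_{\rm dyn}(K_T)-\mathcal C_{\rm dyn}(K^*)\le\epsilon .$$ -/

import Mathlib

open MeasureTheory
open scoped ENNReal Matrix

noncomputable section

namespace ZeroOrderLQR

/-! ### Local smoothness properties of a function on a domain -/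

section Smoothness

variable {E : Type*} [NormedAddCommGroup E] [InnerProductSpace ℝ E] [CompleteSpace E]

/-- `g`, continuously differentiable on its domain `s`, has `(φ, β)` locally Lipschitz gradients
at `x`. -/
def HasLocLipGradient (g : E → ℝ) (s : Set E) (φ β : ℝ) (x : E) : Prop :=
  ContDiffOn ℝ 1 g s ∧ ∀ y ∈ s, ‖x - y‖ ≤ β → ‖gradient g y - gradient g x‖ ≤ φ * ‖y - x‖

/-- `g`, continuously differentiable on its domain `s`, is `(lam, ζ)` locally Lipschitz at `x`. -/
def IsLocLip (g : E → ℝ) (s : Set E) (lam ζ : ℝ) (x : E) : Prop :=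
  ContDiffOn ℝ 1 g s ∧ ∀ y ∈ s, ‖x - y‖ ≤ ζ → |g y - g x| ≤ lam * ‖y - x‖

/-- `g`, continuously differentiable on its domain `s` with a global minimum there, satisfies the
Polyak-Lojasiewicz inequality with constant `μ`. -/
def IsPL (g : E → ℝ) (s : Set E) (μ : ℝ) : Prop :=
  0 < μ ∧ ContDiffOn ℝ 1 g s ∧
    ∃ xstar ∈ s, (∀ x ∈ s, g xstar ≤ g x) ∧
      ∀ x ∈ s, μ * (g x - g xstar) ≤ ‖gradient g x‖ ^ 2

end Smoothness

/-! ### The discounted linear-quadratic system with noisy dynamics -/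

/-- Linear policies: `n × m` real matrices with the Frobenius norm and inner product. -/
abbrev Policy (m n : ℕ) : Type := EuclideanSpace ℝ (Fin n × Fin m)

/-- The matrix of a policy. -/
def Policy.mat {m n : ℕ} (K : Policy m n) : Matrix (Fin n) (Fin m) ℝ :=
  Matrix.of fun i j => K (i, j)

/-- The data of an LQR problem with state dimension `m` and control dimension `n`: transition
matrices, cost matrices, discount factor, noise distribution, and a bound for the squared norm of
the noise. -/
structure LQRSystem (m n : ℕ) where
  A : Matrix (Fin m) (Fin m) ℝ
  B : Matrix (Fin m) (Fin n) ℝ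
  Q : Matrix (Fin m) (Fin m) ℝ
  R : Matrix (Fin n) (Fin n) ℝ
  γ : ℝ
  noise : Measure (Fin m → ℝ)
  Cm : ℝ

namespace LQRSystem

variable {m n : ℕ}

/-- Standing assumptions: positive definite costs, discount in `(0, 1)`, and a noise distribution
with zero mean, identity covariance and squared Euclidean norm at most `Cm` almost surely. -/
structure Admissible (S : LQRSystem m n) : Prop where
  posDef_Q : S.Q.PosDef
  posDef_R : S.R.PosDef
  discount_pos : 0 < S.γ
  discount_lt_one : S.γ < 1
  noise_prob : IsProbabilityMeasure S.noise
  noise_mean : ∀ i, ∫ v, v i ∂S.noise = 0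
  noise_cov : ∀ i j, ∫ v, v i * v j ∂S.noise = if i = j then 1 else 0
  noise_bdd : ∀ᵐ v ∂S.noise, v ⬝ᵥ v ≤ S.Cm

/-- The control `-K s`. -/
def control (K : Policy m n) (s : Fin m → ℝ) : Fin n → ℝ := -(K.mat *ᵥ s)

/-- The state sequence of the policy `K` along the noise sequence `z`, started at `0`. -/
def state (S : LQRSystem m n) (K : Policy m n) (z : ℕ → Fin m → ℝ) : ℕ → Fin m → ℝ
  | 0 => 0
  | t + 1 => S.A *ᵥ state S K z t + S.B *ᵥ control K (state S K z t) + z t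

/-- The quadratic cost of being in state `s` and applying the control `u`. -/
def stageCost (S : LQRSystem m n) (s : Fin m → ℝ) (u : Fin n → ℝ) : ℝ :=
  s ⬝ᵥ (S.Q *ᵥ s) + u ⬝ᵥ (S.R *ᵥ u)

/-- The sample cost of the policy `K` on the noise sequence `z`, possibly infinite. -/
def sampleCost (S : LQRSystem m n) (K : Policy m n) (z : ℕ → Fin m → ℝ) : ℝ≥0∞ :=
  ∑' t, ENNReal.ofReal
    (S.γ ^ t * S.stageCost (S.state K z t) (control K (S.state K z t)))

/-- The law of the i.i.d. noise sequence. -/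
def noiseSeq (S : LQRSystem m n) : Measure (ℕ → Fin m → ℝ) :=
  Measure.infinitePi fun _ => S.noise

/-- The population cost of the policy `K`, possibly infinite. -/
def cost (S : LQRSystem m n) (K : Policy m n) : ℝ≥0∞ :=
  ∫⁻ z, S.sampleCost K z ∂S.noiseSeq

/-- The policies of finite population cost: the domain of the cost as a real function. -/
def dom (S : LQRSystem m n) : Set (Policy m n) := {K | S.cost K ≠ ⊤}

/-- The population cost as a real function, meaningful on `dom`. -/
def realCost (S : LQRSystem m n) (K : Policy m n) : ℝ := (S.cost K).toReal

/-- `Kstar` is a global minimizer of the population cost. -/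
def IsOptimal (S : LQRSystem m n) (Kstar : Policy m n) : Prop := ∀ K, S.cost Kstar ≤ S.cost K

/-- The gap between the costs of `K₀` and `Kstar`. -/
def gap (S : LQRSystem m n) (K₀ Kstar : Policy m n) : ℝ := S.realCost K₀ - S.realCost Kstar

/-- The policies whose cost gap is at most ten times that of `K₀`. -/
def boundedSet (S : LQRSystem m n) (K₀ Kstar : Policy m n) : Set (Policy m n) :=
  {K | K ∈ S.dom ∧ S.realCost K - S.realCost Kstar ≤ 10 * S.gap K₀ Kstar}

/-- `φ`, `lam`, `ρ`, `μ` are curvature parameters of the population cost: it has `(φ, ρ)` locally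
Lipschitz gradients and is `(lam, ρ)` locally Lipschitz at every point of the bounded set, and it
is globally `μ`-PL. -/
structure CurvatureParams (S : LQRSystem m n) (K₀ Kstar : Policy m n) (φ lam ρ μ : ℝ) :
    Prop where
  φ_pos : 0 < φ
  lam_pos : 0 < lam
  ρ_pos : 0 < ρ
  smooth : ∀ K ∈ S.boundedSet K₀ Kstar, HasLocLipGradient S.realCost S.dom φ ρ K
  lipschitz : ∀ K ∈ S.boundedSet K₀ Kstar, IsLocLip S.realCost S.dom lam ρ K
  pl : IsPL S.realCost S.dom μ

/-- The spectral (Euclidean operator) norm of a square matrix. -/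
def opNorm {k : ℕ} (M : Matrix (Fin k) (Fin k) ℝ) : ℝ :=
  ‖Matrix.toEuclideanCLM (n := Fin k) (𝕜 := ℝ) M‖

/-- The smallest singular value of a square matrix. -/
def sigmaMin {k : ℕ} (M : Matrix (Fin k) (Fin k) ℝ) : ℝ :=
  ⨅ v : Metric.sphere (0 : EuclideanSpace ℝ (Fin k)) 1,
    ‖Matrix.toEuclideanCLM (n := Fin k) (𝕜 := ℝ) M v‖

/-- The constant `G_∞`. -/
def Ginf (S : LQRSystem m n) (K₀ : Policy m n) (lam r : ℝ) : ℝ :=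
  ((m * n : ℕ) : ℝ) / r *
    (2 * (opNorm S.Q + opNorm S.R * lam ^ 2) * S.Cm / (1 - Real.sqrt S.γ)) *
    (20 * S.realCost K₀ / sigmaMin S.Q * ((1 - S.γ) / S.γ)) ^ (3 / 2 : ℝ)

/-- The constant `G_2`. -/
def G2 (S : LQRSystem m n) (K₀ : Policy m n) (lam r : ℝ) : ℝ :=
  (((m * n : ℕ) : ℝ) / r *
    (2 * (opNorm S.Q + opNorm S.R * lam ^ 2) * S.Cm / (1 - Real.sqrt S.γ))) ^ 2 *
    (20 * S.realCost K₀ / sigmaMin S.Q * ((1 - S.γ) / S.γ)) ^ 3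

/-! ### The zero-order algorithm with one-point feedback -/

/-- Unit directions in policy space. -/
abbrev Direction (m n : ℕ) : Type := Metric.sphere (0 : Policy m n) 1

/-- The uniform distribution on the unit directions. -/
def unifSphere (m n : ℕ) : Measure (Direction m n) :=
  ((volume : Measure (Policy m n)).toSphere Set.univ)⁻¹ •
    (volume : Measure (Policy m n)).toSphere

instance isProbabilityMeasure_unifSphere [NeZero m] [NeZero n] :
    IsProbabilityMeasure (unifSphere m n) := by
  constructor
  have h0 : (volume : Measure (Policy m n)).toSphere Set.univ ≠ 0 := by
    rw [Ne, Measure.measure_univ_eq_zero]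
    exact Measure.toSphere_ne_zero _
  simp only [unifSphere, Measure.smul_apply, smul_eq_mul]
  exact ENNReal.inv_mul_cancel h0 (measure_ne_top _ _)

/-- The randomness of one iteration: a noise sequence for the rollout, and a direction. -/
abbrev Draw (m n : ℕ) : Type := (ℕ → Fin m → ℝ) × Direction m n

/-- The law of the i.i.d. draws of all iterations; within a draw, the noise sequence and the
direction are independent. -/
def drawLaw (S : LQRSystem m n) : Measure (ℕ → Draw m n) :=
  Measure.infinitePi fun _ => S.noiseSeq.prod (unifSphere m n)

/-- The point at which the cost is queried. -/
def queryPoint (r : ℝ) (K : Policy m n) (d : Draw m n) : Policy m n :=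
  K + r • (d.2 : Policy m n)

/-- The one-point gradient estimate. -/
def gradEst (S : LQRSystem m n) (r : ℝ) (K : Policy m n) (d : Draw m n) : Policy m n :=
  ((S.sampleCost (queryPoint r K d) d.1).toReal * (((m * n : ℕ) : ℝ) / r)) •
    (d.2 : Policy m n)

/-- The iterates of the algorithm with step size `η` and smoothing radius `r`. -/
def iterate (S : LQRSystem m n) (η r : ℝ) (K₀ : Policy m n) (ω : ℕ → Draw m n) :
    ℕ → Policy m n
  | 0 => K₀
  | t + 1 => iterate S η r K₀ ω t - η • S.gradEst r (iterate S η r K₀ ω t) (ω t)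

/-- All observations in the first `T` iterations are finite (so that these iterations can be
carried out), and the iterate after `T` iterations is `ε`-optimal. -/
def successEvent (S : LQRSystem m n) (η r ε : ℝ) (K₀ Kstar : Policy m n) (T : ℕ) :
    Set (ℕ → Draw m n) :=
  {ω | (∀ t < T, S.sampleCost (queryPoint r (S.iterate η r K₀ ω t) (ω t)) (ω t).1 ≠ ⊤) ∧
    S.iterate η r K₀ ω T ∈ S.dom ∧
    S.realCost (S.iterate η r K₀ ω T) - S.realCost Kstar ≤ ε}

end LQRSystem

end ZeroOrderLQR

end

namespace ZeroOrderLQR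

/-! ### Resampling one coordinate of an infinite product -/

section Resample

variable {X : Type*} [MeasurableSpace X]

/-! Each noise vector has mean zero and identity covariance and is independent of the past, so the
population cost is a discounted series of traces. Where it is finite it equals `γ / (1 - γ) * tr P`,
with `P = valueMat K` the solution of the Stein equation `P = Q + KᵀRK + γ MᵀPM`, `M = A - BK`
(`Admissible.realCost_eq_trace`). Finiteness means `γ^N ‖M^N‖² < 1` for some `N`, so the domain is
open; the cost is smooth there because operator inversion is; its sublevel sets are compact because
it is lower semicontinuous with values in `[0, ∞]` and dominates a multiple of `‖K‖²`. This gives a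
minimizer and, by compactness, the local Lipschitz constants. The PL inequality rests on the cost
difference formula `Admissible.hasSum_advantage`: completing the square bounds the gap by a multiple
of `‖E‖²`, `E = residual K`, while the growth of the cost in the direction `E` bounds the gradient
below by a multiple of `‖E‖`.

Convergence is a stopping argument with the gap frozen at `10 Δ₀`. For a step of any length from
below that threshold, either the quadratic upper model at the new point is below the threshold, and
then the whole segment stays in the region of smoothness and the descent inequality holds
(`CurvatureParams.step`), or the model trivially exceeds the frozen gap. So the frozen gap always
obeys the model (`CurvatureParams.stoppedGap_add_le`), and only two moments of the estimate matter.
Integration by parts on the sphere puts its mean within `3/2 φ r` of the gradient (`abs_bias_le`).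
For the second moment, cost so far plus discounted value of the current state is a bounded noise sum
plus a martingale, which yields `10 Cm² C(K)²` for the squared sample cost
(`Admissible.lintegral_sampleCost_sq_le`); `Admissible.le_G2` compares this with `G2`.

By PL, one iteration contracts the gap by `1 - ημ/2` in expectation, up to noise `ημε/100`
(`CurvatureParams.integral_stoppedGap_le`). Ignoring the contraction bounds the probability of ever
crossing the threshold; using it bounds the expected gap on survival; Markov's inequality concludes
(`Admissible.lt_measure_successEvent_of_step`). -/

lemma measurable_update_prod (k : ℕ) :
    Measurable fun p : (ℕ → X) × X => Function.update p.1 k p.2 := by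
  refine measurable_pi_lambda _ fun i => ?_
  by_cases h : i = k
  · subst h; simpa using measurable_snd
  · simpa [Function.update_of_ne h] using measurable_fst.eval

/-- Resampling the `k`-th coordinate preserves the law of an i.i.d. sequence. -/
lemma map_update_infinitePi (ν : Measure X) [IsProbabilityMeasure ν] (k : ℕ) :
    ((Measure.infinitePi fun _ : ℕ => ν).prod ν).map (fun p => Function.update p.1 k p.2) =
      Measure.infinitePi fun _ : ℕ => ν := by
  refine Measure.eq_infinitePi (μ := fun _ : ℕ => ν) fun s t ht => ?_
  rw [Measure.map_apply (measurable_update_prod k)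
    (MeasurableSet.pi s.countable_toSet fun i _ => ht i)]
  have hpre : (fun p : (ℕ → X) × X => Function.update p.1 k p.2) ⁻¹' (Set.pi s t) =
      (Set.pi (s.erase k : Finset ℕ) t) ×ˢ (if k ∈ s then t k else Set.univ) := by
    ext p
    simp only [Set.mem_preimage, Set.mem_pi, Set.mem_prod, Finset.mem_coe, Finset.mem_erase]
    constructor
    · intro h
      refine ⟨fun i hi => by simpa [Function.update_of_ne hi.1] using h i hi.2, ?_⟩
      split_ifs with hk
      · simpa using h k hk
      · trivial
    · rintro ⟨h1, h2⟩ i hi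
      by_cases hik : i = k
      · subst hik; simpa [hi] using h2
      · simpa [Function.update_of_ne hik] using h1 i ⟨hik, hi⟩
  rw [hpre, Measure.prod_prod, Measure.infinitePi_pi (μ := fun _ : ℕ => ν) (fun i _ => ht i)]
  split_ifs with hk
  · rw [Finset.prod_erase_mul _ _ hk]
  · rw [Finset.erase_eq_of_notMem hk]; simp

variable {ν : Measure X} [IsProbabilityMeasure ν]

/-- Resampling coordinate `k` leaves `F` unchanged and replaces `ω k` by a fresh independent draw.
This does the work of conditioning on the past of an iteration. -/
lemma lintegral_eval_eq {F : (ℕ → X) → X → ℝ≥0∞} {k : ℕ}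
    (hF : Measurable fun p : (ℕ → X) × X => F p.1 p.2)
    (hk : ∀ ω v w, F (Function.update ω k v) w = F ω w) :
    ∫⁻ ω, F ω (ω k) ∂(Measure.infinitePi fun _ : ℕ => ν) =
      ∫⁻ ω, ∫⁻ v, F ω v ∂ν ∂(Measure.infinitePi fun _ : ℕ => ν) := by
  conv_lhs => rw [← map_update_infinitePi ν k]
  have hm : Measurable fun ω : ℕ → X => F ω (ω k) :=
    hF.comp (measurable_id.prodMk (measurable_pi_apply k))
  rw [lintegral_map hm (measurable_update_prod k), ← lintegral_prod _ hF.aemeasurable]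
  simp [hk]

lemma integral_eval_eq {F : (ℕ → X) → X → ℝ} {k : ℕ}
    (hF : Measurable fun p : (ℕ → X) × X => F p.1 p.2)
    (hk : ∀ ω v w, F (Function.update ω k v) w = F ω w) {C : ℝ} (hC : ∀ ω v, |F ω v| ≤ C) :
    ∫ ω, F ω (ω k) ∂(Measure.infinitePi fun _ : ℕ => ν) =
      ∫ ω, ∫ v, F ω v ∂ν ∂(Measure.infinitePi fun _ : ℕ => ν) := by
  conv_lhs => rw [← map_update_infinitePi ν k]
  have hm : Measurable fun ω : ℕ → X => F ω (ω k) :=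
    hF.comp (measurable_id.prodMk (measurable_pi_apply k))
  rw [integral_map (measurable_update_prod k).aemeasurable hm.aestronglyMeasurable]
  simp only [Function.update_self, hk]
  exact integral_prod (fun p : (ℕ → X) × X => F p.1 p.2)
    (Integrable.of_bound hF.aestronglyMeasurable C (.of_forall fun p => by simpa using hC _ _))

/-- A coordinate is independent of any function which does not depend on it. -/
lemma integral_mul_eval {F : (ℕ → X) → ℝ} {h : X → ℝ} {k : ℕ} (hF : Measurable F)
    (hh : Measurable h) (hk : ∀ ω v, F (Function.update ω k v) = F ω) :
    ∫ ω, F ω * h (ω k) ∂(Measure.infinitePi fun _ : ℕ => ν) =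
      (∫ ω, F ω ∂(Measure.infinitePi fun _ : ℕ => ν)) * ∫ v, h v ∂ν := by
  conv_lhs => rw [← map_update_infinitePi ν k]
  have hm : Measurable fun ω : ℕ → X => F ω * h (ω k) :=
    hF.mul (hh.comp (measurable_pi_apply k))
  rw [integral_map (measurable_update_prod k).aemeasurable hm.aestronglyMeasurable]
  simp only [Function.update_self, hk]
  exact integral_prod_mul F h

end Resample

end ZeroOrderLQR

namespace ZeroOrderLQR

/-! ### Essentially bounded random vectors -/

section BoundedVector

variable {Ω : Type*} [MeasurableSpace Ω] {μ : Measure Ω}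

lemma memLp_top_mul {f g : Ω → ℝ} (hf : MemLp f ⊤ μ) (hg : MemLp g ⊤ μ) :
    MemLp (fun ω => f ω * g ω) ⊤ μ :=
  hg.mul (r := ⊤) hf

lemma memLp_top_dotProduct {a : ℕ} {F G : Ω → Fin a → ℝ} (hF : ∀ i, MemLp (fun ω => F ω i) ⊤ μ)
    (hG : ∀ i, MemLp (fun ω => G ω i) ⊤ μ) : MemLp (fun ω => F ω ⬝ᵥ G ω) ⊤ μ :=
  memLp_finsetSum _ fun i _ => memLp_top_mul (hF i) (hG i)

lemma memLp_top_mulVec {a b : ℕ} (W : Matrix (Fin b) (Fin a) ℝ) {F : Ω → Fin a → ℝ}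
    (hF : ∀ i, MemLp (fun ω => F ω i) ⊤ μ) (i : Fin b) :
    MemLp (fun ω => (W *ᵥ F ω) i) ⊤ μ :=
  memLp_finsetSum Finset.univ fun j _ => (hF j).const_mul (W i j)

end BoundedVector

/-! ### Second moments of the state, and the cost as a series of impulse costs -/

namespace LQRSystem

variable {m n : ℕ} (S : LQRSystem m n)

/-- The closed-loop transition matrix `A - B K`. -/
def closedLoop (K : Policy m n) : Matrix (Fin m) (Fin m) ℝ := S.A - S.B * K.mat

/-- The closed-loop cost matrix `Q + Kᵀ R K`. -/
def costMat (K : Policy m n) : Matrix (Fin m) (Fin m) ℝ := S.Q + K.matᵀ * S.R * K.mat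

lemma state_succ (K : Policy m n) (z : ℕ → Fin m → ℝ) (t : ℕ) :
    S.state K z (t + 1) = S.closedLoop K *ᵥ S.state K z t + z t := by
  rw [closedLoop, Matrix.sub_mulVec]
  simp only [state, control, Matrix.mulVec_neg, Matrix.mulVec_mulVec, sub_eq_add_neg]

lemma stageCost_control (K : Policy m n) (s : Fin m → ℝ) :
    S.stageCost s (control K s) = s ⬝ᵥ (S.costMat K *ᵥ s) := by
  simp only [stageCost, control, costMat, Matrix.add_mulVec, dotProduct_add, Matrix.mulVec_neg,
    dotProduct_neg, neg_dotProduct, neg_neg, ← Matrix.mulVec_mulVec]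
  congr 1
  rw [Matrix.dotProduct_mulVec s, Matrix.vecMul_transpose]

lemma state_update (K : Policy m n) (z : ℕ → Fin m → ℝ) {k t : ℕ} (h : t ≤ k) (v : Fin m → ℝ) :
    S.state K (Function.update z k v) t = S.state K z t := by
  induction t with
  | zero => rfl
  | succ t ih =>
    rw [state_succ, state_succ, ih (by omega), Function.update_of_ne (by omega)]

lemma measurable_state (t : ℕ) :
    Measurable fun p : Policy m n × (ℕ → Fin m → ℝ) => S.state p.1 p.2 t := by
  have hc : Continuous fun p : Policy m n × (ℕ → Fin m → ℝ) => S.state p.1 p.2 t := by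
    induction t with
    | zero => exact continuous_const
    | succ t ih =>
      simp only [state_succ]
      refine Continuous.add (Continuous.matrix_mulVec ?_ ih) (by fun_prop)
      unfold closedLoop Policy.mat
      refine continuous_const.sub (continuous_const.matrix_mul ?_)
      refine continuous_matrix fun _ _ => ?_
      simp only [Matrix.of_apply]
      fun_prop
  exact hc.measurable

lemma measurable_state_right (K : Policy m n) (t : ℕ) : Measurable fun z => S.state K z t :=
  (S.measurable_state t).comp measurable_prodMk_left

lemma measurable_mulVec {a b : ℕ} {X : Type*} [MeasurableSpace X] (W : Matrix (Fin b) (Fin a) ℝ)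
    {F : X → Fin a → ℝ} (hF : Measurable F) : Measurable fun x => W *ᵥ F x :=
  (Continuous.matrix_mulVec continuous_const continuous_id).measurable.comp hF

lemma measurable_dotProduct {a : ℕ} {X : Type*} [MeasurableSpace X]
    {F G : X → Fin a → ℝ} (hF : Measurable F) (hG : Measurable G) :
    Measurable fun x => F x ⬝ᵥ G x :=
  Finset.measurable_sum _ fun _ _ => (hF.eval).mul (hG.eval)

variable {S}

lemma Admissible.isProbabilityMeasure_noiseSeq (hS : S.Admissible) :
    IsProbabilityMeasure S.noiseSeq := by
  have := hS.noise_prob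
  unfold noiseSeq
  infer_instance

lemma Admissible.ae_noise_bdd (hS : S.Admissible) (t : ℕ) :
    ∀ᵐ z ∂S.noiseSeq, z t ⬝ᵥ z t ≤ S.Cm := by
  have := hS.noise_prob
  exact (measurePreserving_eval_infinitePi (fun _ : ℕ => S.noise) t).quasiMeasurePreserving.ae
    hS.noise_bdd

lemma Admissible.memLp_noise (hS : S.Admissible) (t : ℕ) (i : Fin m) :
    MemLp (fun z : ℕ → Fin m → ℝ => z t i) ⊤ S.noiseSeq := by
  refine memLp_top_of_bound (Measurable.aestronglyMeasurable (by fun_prop)) (Real.sqrt S.Cm) ?_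
  filter_upwards [hS.ae_noise_bdd t] with z hz
  rw [Real.norm_eq_abs]
  refine Real.abs_le_sqrt (le_trans ?_ hz)
  rw [sq]
  exact Finset.single_le_sum (f := fun i => z t i * z t i) (fun _ _ => mul_self_nonneg _)
    (Finset.mem_univ i)

lemma Admissible.memLp_state (hS : S.Admissible) (K : Policy m n) (t : ℕ) :
    ∀ i, MemLp (fun z => S.state K z t i) ⊤ S.noiseSeq := by
  induction t with
  | zero => intro i; simp [state]
  | succ t ih =>
    intro i
    simp only [state_succ]
    exact (memLp_top_mulVec _ ih i).add (hS.memLp_noise t i)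

/-- Noise is uncorrelated with any function of the other noise vectors. -/
lemma Admissible.integral_dotProduct_noise (hS : S.Admissible) {k : ℕ}
    {F : (ℕ → Fin m → ℝ) → Fin m → ℝ} (hF : Measurable F)
    (hb : ∀ i, MemLp (fun z => F z i) ⊤ S.noiseSeq)
    (hk : ∀ z v, F (Function.update z k v) = F z) :
    ∫ z, F z ⬝ᵥ z k ∂S.noiseSeq = 0 := by
  have := hS.noise_prob
  have := hS.isProbabilityMeasure_noiseSeq
  simp only [dotProduct]
  rw [integral_finsetSum _ fun i _ =>
    (memLp_top_mul (hb i) (hS.memLp_noise k i)).integrable le_top]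
  refine Finset.sum_eq_zero fun i _ => ?_
  have := integral_mul_eval (ν := S.noise) (F := fun z => F z i) (h := fun v : Fin m → ℝ => v i)
    (k := k) hF.eval (measurable_pi_apply i) (fun z v => by rw [hk])
  rw [hS.noise_mean, mul_zero] at this
  exact this

/-- Expand the square: independence factors the noise covariance out of each term, and only the
diagonal survives. It is needed for the martingale increments in `crossSum`. -/
lemma Admissible.integral_dotProduct_noise_sq (hS : S.Admissible) {k : ℕ}
    {F : (ℕ → Fin m → ℝ) → Fin m → ℝ} (hF : Measurable F)
    (hb : ∀ i, MemLp (fun z => F z i) ⊤ S.noiseSeq)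
    (hk : ∀ z v, F (Function.update z k v) = F z) :
    ∫ z, (F z ⬝ᵥ z k) ^ 2 ∂S.noiseSeq = ∫ z, F z ⬝ᵥ F z ∂S.noiseSeq := by
  have := hS.noise_prob
  have := hS.isProbabilityMeasure_noiseSeq
  have h1 : ∀ z : ℕ → Fin m → ℝ, (F z ⬝ᵥ z k) ^ 2 =
      ∑ i, ∑ j, (F z i * F z j) * (z k i * z k j) := fun z => by
    rw [sq, dotProduct, Finset.sum_mul_sum]
    exact Finset.sum_congr rfl fun i _ => Finset.sum_congr rfl fun j _ => by ring
  have hint : ∀ i j, Integrable (fun z => (F z i * F z j) * (z k i * z k j)) S.noiseSeq :=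
    fun i j => (memLp_top_mul (memLp_top_mul (hb i) (hb j))
      (memLp_top_mul (hS.memLp_noise k i) (hS.memLp_noise k j))).integrable le_top
  simp only [h1]
  simp only [dotProduct]
  rw [integral_finsetSum _ fun i _ => integrable_finsetSum _ fun j _ => hint i j,
    integral_finsetSum _ fun i _ => (memLp_top_mul (hb i) (hb i)).integrable le_top]
  refine Finset.sum_congr rfl fun i _ => ?_
  rw [integral_finsetSum _ fun j _ => hint i j, Finset.sum_eq_single i]
  · have := integral_mul_eval (ν := S.noise) (F := fun z => F z i * F z i)
      (h := fun v : Fin m → ℝ => v i * v i) (k := k) (hF.eval.mul hF.eval)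
      ((measurable_pi_apply i).mul (measurable_pi_apply i)) (fun z v => by rw [hk])
    rw [hS.noise_cov, if_pos rfl, mul_one] at this
    exact this
  · intro j _ hj
    have := integral_mul_eval (ν := S.noise) (F := fun z => F z i * F z j)
      (h := fun v : Fin m → ℝ => v i * v j) (k := k) (hF.eval.mul hF.eval)
      ((measurable_pi_apply i).mul (measurable_pi_apply j)) (fun z v => by rw [hk])
    rw [hS.noise_cov, if_neg hj.symm, mul_zero] at this
    exact this
  · simp

lemma Admissible.integral_noise_quadratic (hS : S.Admissible) (k : ℕ)
    (W : Matrix (Fin m) (Fin m) ℝ) :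
    ∫ z, z k ⬝ᵥ (W *ᵥ z k) ∂S.noiseSeq = W.trace := by
  have := hS.noise_prob
  have := hS.isProbabilityMeasure_noiseSeq
  have hint : ∀ i j, Integrable (fun z : ℕ → Fin m → ℝ => W i j * (z k i * z k j)) S.noiseSeq :=
    fun i j => ((memLp_top_mul (hS.memLp_noise k i) (hS.memLp_noise k j)).integrable
      le_top).const_mul _
  have h1 : ∀ z : ℕ → Fin m → ℝ, z k ⬝ᵥ (W *ᵥ z k) = ∑ i, ∑ j, W i j * (z k i * z k j) :=
    fun z => Finset.sum_congr rfl fun i _ => by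
      rw [Matrix.mulVec, dotProduct, Finset.mul_sum]
      exact Finset.sum_congr rfl fun j _ => by ring
  simp only [h1]
  rw [integral_finsetSum _ fun i _ => integrable_finsetSum _ fun j _ => hint i j, Matrix.trace]
  refine Finset.sum_congr rfl fun i _ => ?_
  rw [integral_finsetSum _ fun j _ => hint i j]
  have hc : ∀ j, ∫ z : ℕ → Fin m → ℝ, z k i * z k j ∂S.noiseSeq = if i = j then 1 else 0 := by
    intro j
    have := integral_mul_eval (ν := S.noise) (F := fun _ => 1)
      (h := fun v : Fin m → ℝ => v i * v j) (k := k) measurable_const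
      ((measurable_pi_apply i).mul (measurable_pi_apply j)) (fun z v => rfl)
    simp only [one_mul, hS.noise_cov, integral_const, probReal_univ, smul_eq_mul] at this
    exact this
  simp [integral_const_mul, hc]

lemma Admissible.memLp_quadratic (hS : S.Admissible) (K : Policy m n) (t : ℕ)
    (W : Matrix (Fin m) (Fin m) ℝ) :
    MemLp (fun z => S.state K z t ⬝ᵥ (W *ᵥ S.state K z t)) ⊤ S.noiseSeq :=
  memLp_top_dotProduct (hS.memLp_state K t) (memLp_top_mulVec W (hS.memLp_state K t))

lemma quadratic_add {a : ℕ} (W : Matrix (Fin a) (Fin a) ℝ) (x y : Fin a → ℝ) :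
    (x + y) ⬝ᵥ (W *ᵥ (x + y)) = x ⬝ᵥ (W *ᵥ x) + (((W + Wᵀ) *ᵥ x) ⬝ᵥ y + y ⬝ᵥ (W *ᵥ y)) := by
  have : x ⬝ᵥ (W *ᵥ y) = (Wᵀ *ᵥ x) ⬝ᵥ y := by
    rw [Matrix.dotProduct_mulVec, Matrix.mulVec_transpose]
  simp only [Matrix.mulVec_add, dotProduct_add, add_dotProduct, Matrix.add_mulVec, this,
    dotProduct_comm y (W *ᵥ x)]
  ring

lemma quadratic_mulVec {a b : ℕ} (W : Matrix (Fin a) (Fin a) ℝ) (N : Matrix (Fin a) (Fin b) ℝ)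
    (x : Fin b → ℝ) : (N *ᵥ x) ⬝ᵥ (W *ᵥ (N *ᵥ x)) = x ⬝ᵥ ((Nᵀ * W * N) *ᵥ x) := by
  rw [← Matrix.mulVec_mulVec, ← Matrix.mulVec_mulVec, Matrix.dotProduct_mulVec x,
    Matrix.vecMul_transpose]

/-- In `M s + z` the cross term is linear in a noise vector independent of `s`, so it averages to
zero; the identity covariance turns the pure noise term into a trace. -/
lemma Admissible.integral_state_succ_quadratic (hS : S.Admissible) (K : Policy m n) (t : ℕ)
    (W : Matrix (Fin m) (Fin m) ℝ) :
    ∫ z, S.state K z (t + 1) ⬝ᵥ (W *ᵥ S.state K z (t + 1)) ∂S.noiseSeq =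
      (∫ z, S.state K z t ⬝ᵥ (((S.closedLoop K)ᵀ * W * S.closedLoop K) *ᵥ S.state K z t)
        ∂S.noiseSeq) + W.trace := by
  have := hS.isProbabilityMeasure_noiseSeq
  have hM := memLp_top_mulVec (S.closedLoop K) (hS.memLp_state K t)
  have hL := memLp_top_mulVec (W + Wᵀ) hM
  simp only [state_succ, quadratic_add, quadratic_mulVec]
  have h1 := (memLp_top_dotProduct hL (hS.memLp_noise t)).integrable le_top
  have h2 := (memLp_top_dotProduct (hS.memLp_noise t)
    (memLp_top_mulVec W (hS.memLp_noise t))).integrable le_top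
  rw [integral_add ((hS.memLp_quadratic K t _).integrable le_top) (by exact h1.add h2),
    integral_add h1 h2,
    hS.integral_noise_quadratic, hS.integral_dotProduct_noise
      (measurable_mulVec _ (measurable_mulVec _ (S.measurable_state_right K t))) hL
      (fun z v => by rw [S.state_update K z le_rfl]), zero_add]

lemma Admissible.integral_state_quadratic (hS : S.Admissible) (K : Policy m n) (t : ℕ)
    (W : Matrix (Fin m) (Fin m) ℝ) :
    ∫ z, S.state K z t ⬝ᵥ (W *ᵥ S.state K z t) ∂S.noiseSeq =
      ∑ i ∈ Finset.range t, ((S.closedLoop K ^ i)ᵀ * W * S.closedLoop K ^ i).trace := by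
  -- One step of the recursion replaces `W` by `MᵀWM`, so the induction hypothesis must cover all
  -- `W`.
  induction t generalizing W with
  | zero => simp [state]
  | succ t ih =>
    rw [hS.integral_state_succ_quadratic, ih, Finset.sum_range_succ']
    simp only [pow_zero, Matrix.transpose_one, one_mul, mul_one]
    congr 1
    refine Finset.sum_congr rfl fun i _ => ?_
    rw [pow_succ', Matrix.transpose_mul]
    simp only [mul_assoc]

lemma Admissible.costMat_posSemidef (hS : S.Admissible) (K : Policy m n) :
    (S.costMat K).PosSemidef := by
  refine hS.posDef_Q.posSemidef.add ?_
  simpa using hS.posDef_R.posSemidef.conjTranspose_mul_mul_same K.mat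

lemma Admissible.quadratic_costMat_nonneg (hS : S.Admissible) (K : Policy m n) (v : Fin m → ℝ) :
    0 ≤ v ⬝ᵥ (S.costMat K *ᵥ v) := by
  simpa using (hS.costMat_posSemidef K).dotProduct_mulVec_nonneg v

variable (S) in
/-- The expected cost incurred through a single noise vector `i + 1` steps after it occurred. -/
def impulseCost (K : Policy m n) (i : ℕ) : ℝ :=
  ((S.closedLoop K ^ i)ᵀ * S.costMat K * S.closedLoop K ^ i).trace

lemma Admissible.impulseCost_nonneg (hS : S.Admissible) (K : Policy m n) (i : ℕ) :
    0 ≤ S.impulseCost K i := by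
  have := (hS.costMat_posSemidef K).conjTranspose_mul_mul_same (S.closedLoop K ^ i)
  simpa [impulseCost] using this.trace_nonneg

lemma measurable_stageCost (t : ℕ) : Measurable fun p : Policy m n × (ℕ → Fin m → ℝ) =>
    S.stageCost (S.state p.1 p.2 t) (control p.1 (S.state p.1 p.2 t)) := by
  have hs := S.measurable_state t
  have hu : Measurable fun p : Policy m n × (ℕ → Fin m → ℝ) =>
      control p.1 (S.state p.1 p.2 t) := by
    have hc : Continuous fun p : Policy m n × (Fin m → ℝ) => control p.1 p.2 := by
      unfold control Policy.mat
      refine (Continuous.matrix_mulVec (continuous_matrix fun i j => ?_) continuous_snd).neg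
      simp only [Matrix.of_apply]
      fun_prop
    exact hc.measurable.comp (measurable_fst.prodMk hs)
  exact (measurable_dotProduct hs (measurable_mulVec _ hs)).add
    (measurable_dotProduct hu (measurable_mulVec _ hu))

lemma measurable_sampleCost :
    Measurable fun p : Policy m n × (ℕ → Fin m → ℝ) => S.sampleCost p.1 p.2 := by
  unfold sampleCost
  refine Measurable.tsum fun t => ?_
  exact ENNReal.measurable_ofReal.comp ((measurable_stageCost t).const_mul _)

lemma measurable_sampleCost_right (K : Policy m n) : Measurable (S.sampleCost K) := by
  unfold sampleCost
  refine Measurable.tsum fun t => ?_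
  exact ENNReal.measurable_ofReal.comp
    (((measurable_stageCost t).comp measurable_prodMk_left).const_mul _)

/-- Stage costs are nonnegative, so Tonelli exchanges expectation and time sum without assuming that
the cost is finite. -/
lemma Admissible.cost_eq_tsum (hS : S.Admissible) (K : Policy m n) :
    S.cost K = ∑' t, ENNReal.ofReal (S.γ ^ t * ∑ i ∈ Finset.range t, S.impulseCost K i) := by
  have := hS.isProbabilityMeasure_noiseSeq
  unfold cost sampleCost
  have hm : ∀ t, Measurable fun z => ENNReal.ofReal
      (S.γ ^ t * S.stageCost (S.state K z t) (control K (S.state K z t))) := fun t =>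
    ENNReal.measurable_ofReal.comp
      (((measurable_stageCost t).comp measurable_prodMk_left).const_mul _)
  rw [lintegral_tsum fun t => (hm t).aemeasurable]
  congr 1
  ext t
  simp only [stageCost_control]
  rw [← ofReal_integral_eq_lintegral_ofReal, integral_const_mul, hS.integral_state_quadratic]
  · rfl
  · exact ((hS.memLp_quadratic K t _).integrable le_top).const_mul _
  · exact .of_forall fun z => mul_nonneg (pow_nonneg hS.discount_pos.le _)
      (hS.quadratic_costMat_nonneg K _)

end LQRSystem
end ZeroOrderLQR

namespace ZeroOrderLQR

/-! ### Quadratic forms and the Frobenius norm -/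

section Frobenius

open scoped Matrix.Norms.Frobenius

variable {a b : ℕ}

lemma frobenius_sq (N : Matrix (Fin a) (Fin b) ℝ) : ‖N‖ ^ 2 = ∑ j, Nᵀ j ⬝ᵥ Nᵀ j := by
  rw [Matrix.frobenius_norm_def, ← Real.sqrt_eq_rpow, Real.sq_sqrt (by positivity),
    Finset.sum_comm]
  simp [dotProduct, sq]

lemma frobenius_sq_rows (N : Matrix (Fin a) (Fin b) ℝ) : ‖N‖ ^ 2 = ∑ i, N i ⬝ᵥ N i := by
  rw [← Matrix.frobenius_norm_transpose, frobenius_sq, Matrix.transpose_transpose]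

lemma dotProduct_self_nonneg' (v : Fin a → ℝ) : 0 ≤ v ⬝ᵥ v :=
  Finset.sum_nonneg fun _ _ => mul_self_nonneg _

lemma dotProduct_sq_le (v w : Fin a → ℝ) : (v ⬝ᵥ w) ^ 2 ≤ (v ⬝ᵥ v) * (w ⬝ᵥ w) := by
  simpa [dotProduct, sq] using Finset.sum_mul_sq_le_sq_mul_sq Finset.univ v w

lemma mulVec_dotProduct_self_le (W : Matrix (Fin a) (Fin b) ℝ) (v : Fin b → ℝ) :
    (W *ᵥ v) ⬝ᵥ (W *ᵥ v) ≤ ‖W‖ ^ 2 * (v ⬝ᵥ v) := by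
  rw [frobenius_sq_rows, Finset.sum_mul]
  refine Finset.sum_le_sum fun i _ => ?_
  rw [← sq]
  exact dotProduct_sq_le _ _

lemma abs_quadratic_le (W : Matrix (Fin a) (Fin a) ℝ) (v : Fin a → ℝ) :
    |v ⬝ᵥ (W *ᵥ v)| ≤ ‖W‖ * (v ⬝ᵥ v) := by
  refine abs_le_of_sq_le_sq ?_ (mul_nonneg (norm_nonneg _) (dotProduct_self_nonneg' v))
  calc (v ⬝ᵥ (W *ᵥ v)) ^ 2 ≤ (v ⬝ᵥ v) * ((W *ᵥ v) ⬝ᵥ (W *ᵥ v)) := dotProduct_sq_le _ _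
    _ ≤ (v ⬝ᵥ v) * (‖W‖ ^ 2 * (v ⬝ᵥ v)) :=
        mul_le_mul_of_nonneg_left (mulVec_dotProduct_self_le W v) (dotProduct_self_nonneg' v)
    _ = (‖W‖ * (v ⬝ᵥ v)) ^ 2 := by ring

lemma trace_conj (W : Matrix (Fin a) (Fin a) ℝ) (N : Matrix (Fin a) (Fin b) ℝ) :
    (Nᵀ * W * N).trace = ∑ j, Nᵀ j ⬝ᵥ (W *ᵥ Nᵀ j) := by
  refine Finset.sum_congr rfl fun j _ => ?_
  rw [Matrix.diag_apply, Matrix.mul_assoc, Matrix.mul_apply]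
  simp [dotProduct, Matrix.mulVec, Matrix.mul_apply]

lemma abs_trace_conj_le (W : Matrix (Fin a) (Fin a) ℝ) (N : Matrix (Fin a) (Fin b) ℝ) :
    |(Nᵀ * W * N).trace| ≤ ‖W‖ * ‖N‖ ^ 2 := by
  rw [trace_conj, frobenius_sq, Finset.mul_sum]
  exact (Finset.abs_sum_le_sum_abs _ _).trans (Finset.sum_le_sum fun j _ => abs_quadratic_le W _)

lemma le_trace_conj {W : Matrix (Fin a) (Fin a) ℝ} {c : ℝ}
    (hc : ∀ v, c * (v ⬝ᵥ v) ≤ v ⬝ᵥ (W *ᵥ v)) (N : Matrix (Fin a) (Fin b) ℝ) :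
    c * ‖N‖ ^ 2 ≤ (Nᵀ * W * N).trace := by
  rw [trace_conj, frobenius_sq, Finset.mul_sum]
  exact Finset.sum_le_sum fun j _ => hc _

/-- The minimum of the form on the compact unit sphere is the constant; in dimension zero the sphere
is empty and any constant does. -/
lemma exists_pos_le_quadratic {W : Matrix (Fin a) (Fin a) ℝ} (hW : W.PosDef) :
    ∃ c > 0, ∀ v : Fin a → ℝ, c * (v ⬝ᵥ v) ≤ v ⬝ᵥ (W *ᵥ v) := by
  have hcont : Continuous fun x : EuclideanSpace ℝ (Fin a) =>
      (x : Fin a → ℝ) ⬝ᵥ (W *ᵥ (x : Fin a → ℝ)) :=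
    Continuous.dotProduct (by fun_prop) (Continuous.matrix_mulVec continuous_const (by fun_prop))
  have hn : ∀ x : EuclideanSpace ℝ (Fin a), (x : Fin a → ℝ) ⬝ᵥ (x : Fin a → ℝ) = ‖x‖ ^ 2 := by
    intro x
    rw [EuclideanSpace.real_norm_sq_eq]
    simp [dotProduct, sq]
  rcases (Metric.sphere (0 : EuclideanSpace ℝ (Fin a)) 1).eq_empty_or_nonempty with he | hne
  · refine ⟨1, one_pos, fun v => ?_⟩
    have hv : v = 0 := by
      by_contra hv
      have hv' : WithLp.toLp 2 v ≠ (0 : EuclideanSpace ℝ (Fin a)) := by simpa using hv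
      have hmem : (‖WithLp.toLp 2 v‖⁻¹ • WithLp.toLp 2 v : EuclideanSpace ℝ (Fin a)) ∈
          Metric.sphere (0 : EuclideanSpace ℝ (Fin a)) 1 := by
        simp [norm_smul, hv]
      rw [he] at hmem
      exact hmem
    simp [hv]
  · obtain ⟨x, hx, hmin⟩ := (isCompact_sphere _ _).exists_isMinOn hne hcont.continuousOn
    have hx1 : ‖x‖ = 1 := by simpa using hx
    have hx0 : (x : Fin a → ℝ) ≠ 0 := by
      intro h
      have : x = 0 := by ext i; exact congrFun h i
      simp [this] at hx1
    refine ⟨_, by simpa using hW.dotProduct_mulVec_pos hx0, fun v => ?_⟩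
    rcases eq_or_ne v 0 with rfl | hv
    · simp
    have hv' : ‖(WithLp.toLp 2 v : EuclideanSpace ℝ (Fin a))‖ ≠ 0 := by simpa using hv
    set s := ‖(WithLp.toLp 2 v : EuclideanSpace ℝ (Fin a))‖ with hs
    have hmem : (s⁻¹ • WithLp.toLp 2 v : EuclideanSpace ℝ (Fin a)) ∈
        Metric.sphere (0 : EuclideanSpace ℝ (Fin a)) 1 := by
      simp [norm_smul, hv, hs]
    have h1 := hmin hmem
    simp only [Set.mem_ofPred_eq, WithLp.ofLp_smul, Matrix.mulVec_smul, dotProduct_smul,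
      smul_dotProduct, smul_eq_mul] at h1
    have h2 : v ⬝ᵥ v = s ^ 2 := hn (WithLp.toLp 2 v)
    rw [h2]
    have h3 := mul_le_mul_of_nonneg_right h1 (sq_nonneg s)
    refine h3.trans (le_of_eq ?_)
    field_simp

end Frobenius

/-! ### Discounted sums -/

section Discount

variable {γ : ℝ} {x : ℕ → ℝ}

/-- The partial sums `S_N` on the left satisfy `S_{N+1} = γ S_N + γ ∑_{t<N} γ^t x_t`, and `S_N ≤
S_{N+1}` then bounds `(1 - γ) S_N`. Conversely, the left term at `i + 1` dominates `γ * γ^i x_i`. -/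
lemma summable_discounted_sum_iff (h0 : 0 < γ) (h1 : γ < 1) (hx : ∀ i, 0 ≤ x i) :
    (Summable fun t => γ ^ t * ∑ i ∈ Finset.range t, x i) ↔ Summable fun i => γ ^ i * x i := by
  have hs : ∀ t, 0 ≤ ∑ i ∈ Finset.range t, x i := fun t => Finset.sum_nonneg fun i _ => hx i
  constructor
  · intro h
    have h2 := ((summable_nat_add_iff 1).2 h).mul_left γ⁻¹
    refine Summable.of_nonneg_of_le (fun i => mul_nonneg (pow_nonneg h0.le _) (hx i))
      (fun i => ?_) h2
    have : γ⁻¹ * (γ ^ (i + 1) * ∑ j ∈ Finset.range (i + 1), x j) =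
        γ ^ i * ∑ j ∈ Finset.range (i + 1), x j := by
      field_simp; ring
    rw [this, Finset.sum_range_succ]
    exact mul_le_mul_of_nonneg_left (by linarith [hs i]) (pow_nonneg h0.le _)
  · intro h
    refine summable_of_sum_range_le (c := γ / (1 - γ) * ∑' i, γ ^ i * x i)
      (fun t => mul_nonneg (pow_nonneg h0.le _) (hs t)) fun N => ?_
    have key : ∀ N, ∑ t ∈ Finset.range (N + 1), γ ^ t * ∑ i ∈ Finset.range t, x i =
        γ * ∑ t ∈ Finset.range N, γ ^ t * ∑ i ∈ Finset.range t, x i +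
          γ * ∑ t ∈ Finset.range N, γ ^ t * x t := by
      intro N
      rw [Finset.sum_range_succ']
      simp only [Finset.range_zero, Finset.sum_empty, mul_zero, add_zero]
      rw [Finset.mul_sum, Finset.mul_sum, ← Finset.sum_add_distrib]
      exact Finset.sum_congr rfl fun t _ => by rw [Finset.sum_range_succ]; ring
    have hle : ∑ t ∈ Finset.range N, γ ^ t * x t ≤ ∑' i, γ ^ i * x i :=
      h.sum_le_tsum _ fun i _ => mul_nonneg (pow_nonneg h0.le _) (hx i)
    have hmono : ∑ t ∈ Finset.range N, γ ^ t * ∑ i ∈ Finset.range t, x i ≤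
        ∑ t ∈ Finset.range (N + 1), γ ^ t * ∑ i ∈ Finset.range t, x i := by
      rw [Finset.sum_range_succ]
      exact le_add_of_nonneg_right (mul_nonneg (pow_nonneg h0.le _) (hs N))
    rw [key N] at hmono
    rw [div_mul_eq_mul_div, le_div_iff₀ (by linarith)]
    nlinarith

lemma tsum_discounted_sum (h0 : 0 < γ) (h1 : γ < 1) (hx : ∀ i, 0 ≤ x i)
    (h : Summable fun i => γ ^ i * x i) :
    ∑' t, γ ^ t * ∑ i ∈ Finset.range t, x i = γ / (1 - γ) * ∑' i, γ ^ i * x i := by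
  have hs := (summable_discounted_sum_iff h0 h1 hx).2 h
  have h2 := hs.tsum_eq_zero_add
  have h3 : ∀ t, γ ^ (t + 1) * ∑ i ∈ Finset.range (t + 1), x i =
      γ * (γ ^ t * ∑ i ∈ Finset.range t, x i) + γ * (γ ^ t * x t) := fun t => by
    rw [Finset.sum_range_succ]; ring
  simp only [h3, Finset.range_zero, Finset.sum_empty, mul_zero, zero_add] at h2
  rw [(hs.mul_left γ).tsum_add (h.mul_left γ), tsum_mul_left, tsum_mul_left] at h2
  have : (1 : ℝ) - γ ≠ 0 := by linarith
  field_simp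
  linarith

/-- A nonnegative sequence that contracts after a fixed number of steps is summable. -/
lemma summable_of_contracting {q : ℝ} {N : ℕ} (hx : ∀ i, 0 ≤ x i) (hq : q < 1)
    (h : ∀ i, x (i + N) ≤ q * x i) : Summable x := by
  rcases lt_or_ge q 0 with hq0 | hq0
  · have hz : ∀ i, x i = 0 := fun i => by
      have := h i
      nlinarith [hx i, hx (i + N)]
    simp [funext hz]
  refine summable_of_sum_range_le (c := (∑ i ∈ Finset.range N, x i) / (1 - q)) hx fun n => ?_
  rw [le_div_iff₀ (by linarith)]
  have h1 : ∑ i ∈ Finset.range n, x i ≤ ∑ i ∈ Finset.range (N + n), x i :=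
    Finset.sum_le_sum_of_subset_of_nonneg (Finset.range_mono (by omega)) fun i _ _ => hx i
  have h2 : ∑ i ∈ Finset.range n, x (N + i) ≤ q * ∑ i ∈ Finset.range n, x i := by
    rw [Finset.mul_sum]
    exact Finset.sum_le_sum fun i _ => by rw [add_comm]; exact h i
  rw [Finset.sum_range_add] at h1
  linarith

end Discount

/-! ### The domain of finite cost: openness, compact sublevel sets, existence of a minimizer -/

namespace LQRSystem

open scoped Matrix.Norms.Frobenius

variable {m n : ℕ} {S : LQRSystem m n}

lemma Admissible.exists_pos_le_costMat (hS : S.Admissible) : ∃ c > 0, ∀ (K : Policy m n)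
    (v : Fin m → ℝ), c * (v ⬝ᵥ v) ≤ v ⬝ᵥ (S.costMat K *ᵥ v) := by
  obtain ⟨c, hc, h⟩ := exists_pos_le_quadratic hS.posDef_Q
  refine ⟨c, hc, fun K v => (h v).trans ?_⟩
  have : 0 ≤ v ⬝ᵥ ((K.matᵀ * S.R * K.mat) *ᵥ v) := by
    rw [← quadratic_mulVec]
    simpa using hS.posDef_R.posSemidef.dotProduct_mulVec_nonneg (K.mat *ᵥ v)
  rw [costMat, Matrix.add_mulVec, dotProduct_add]
  linarith

lemma Admissible.mem_dom_iff_summable_impulseCost (hS : S.Admissible) (K : Policy m n) :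
    K ∈ S.dom ↔ Summable fun i => S.γ ^ i * S.impulseCost K i := by
  have h0 := hS.discount_pos
  have hx := hS.impulseCost_nonneg K
  have hn : ∀ t, 0 ≤ S.γ ^ t * ∑ i ∈ Finset.range t, S.impulseCost K i := fun t =>
    mul_nonneg (pow_nonneg h0.le _) (Finset.sum_nonneg fun i _ => hx i)
  rw [← summable_discounted_sum_iff h0 hS.discount_lt_one hx]
  change S.cost K ≠ ⊤ ↔ _
  rw [hS.cost_eq_tsum]
  constructor
  · intro h
    have := ENNReal.summable_toReal h
    simpa only [ENNReal.toReal_ofReal (hn _)] using this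
  · intro h
    rw [← ENNReal.ofReal_tsum_of_nonneg hn h]
    exact ENNReal.ofReal_ne_top

lemma Admissible.realCost_eq_tsum (hS : S.Admissible) {K : Policy m n} (hK : K ∈ S.dom) :
    S.realCost K = S.γ / (1 - S.γ) * ∑' i, S.γ ^ i * S.impulseCost K i := by
  have h0 := hS.discount_pos
  have hx := hS.impulseCost_nonneg K
  have hn : ∀ t, 0 ≤ S.γ ^ t * ∑ i ∈ Finset.range t, S.impulseCost K i := fun t =>
    mul_nonneg (pow_nonneg h0.le _) (Finset.sum_nonneg fun i _ => hx i)
  have hs := (hS.mem_dom_iff_summable_impulseCost K).1 hK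
  rw [← tsum_discounted_sum h0 hS.discount_lt_one hx hs, realCost, hS.cost_eq_tsum,
    ← ENNReal.ofReal_tsum_of_nonneg hn
      ((summable_discounted_sum_iff h0 hS.discount_lt_one hx).2 hs),
    ENNReal.toReal_ofReal (tsum_nonneg hn)]

lemma Admissible.mem_dom_iff_summable_norm (hS : S.Admissible) (K : Policy m n) :
    K ∈ S.dom ↔ Summable fun i => S.γ ^ i * ‖S.closedLoop K ^ i‖ ^ 2 := by
  rw [hS.mem_dom_iff_summable_impulseCost]
  obtain ⟨c, hc, h⟩ := hS.exists_pos_le_costMat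
  have hp : ∀ i, 0 ≤ S.γ ^ i := fun i => pow_nonneg hS.discount_pos.le _
  constructor
  · intro hs
    refine Summable.of_nonneg_of_le (fun i => mul_nonneg (hp i) (sq_nonneg _)) (fun i => ?_)
      (hs.mul_left c⁻¹)
    rw [inv_mul_eq_div, le_div_iff₀ hc, mul_assoc, mul_comm _ c]
    exact mul_le_mul_of_nonneg_left (le_trace_conj (h K) _) (hp i)
  · intro hs
    refine Summable.of_nonneg_of_le (fun i => mul_nonneg (hp i) (hS.impulseCost_nonneg K i))
      (fun i => ?_) (hs.mul_left ‖S.costMat K‖)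
    rw [mul_left_comm]
    exact mul_le_mul_of_nonneg_left ((le_abs_self _).trans (abs_trace_conj_le _ _)) (hp i)

/-- By submultiplicativity, one contracting power forces geometric decay over blocks of length `N`.
Each condition on the right involves a single power, hence is open in `K`. -/
lemma Admissible.mem_dom_iff_exists_pow (hS : S.Admissible) (K : Policy m n) :
    K ∈ S.dom ↔ ∃ N, S.γ ^ N * ‖S.closedLoop K ^ N‖ ^ 2 < 1 := by
  rw [hS.mem_dom_iff_summable_norm]
  have hp : ∀ i, 0 ≤ S.γ ^ i := fun i => pow_nonneg hS.discount_pos.le _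
  constructor
  · intro h
    exact (h.tendsto_atTop_zero.eventually_lt_const one_pos).exists
  · rintro ⟨N, hN⟩
    refine summable_of_contracting (N := N) (fun i => mul_nonneg (hp i) (sq_nonneg _)) hN
      fun i => ?_
    have h1 : ‖S.closedLoop K ^ (i + N)‖ ^ 2 ≤
        ‖S.closedLoop K ^ N‖ ^ 2 * ‖S.closedLoop K ^ i‖ ^ 2 := by
      rw [← mul_pow, add_comm i N, pow_add]
      exact pow_le_pow_left₀ (norm_nonneg _) (norm_mul_le _ _) 2
    calc S.γ ^ (i + N) * ‖S.closedLoop K ^ (i + N)‖ ^ 2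
        ≤ S.γ ^ (i + N) * (‖S.closedLoop K ^ N‖ ^ 2 * ‖S.closedLoop K ^ i‖ ^ 2) :=
          mul_le_mul_of_nonneg_left h1 (hp _)
      _ = _ := by rw [pow_add]; ring

lemma contDiff_mat {k : WithTop ℕ∞} : ContDiff ℝ k (Policy.mat : Policy m n → _) := by
  let L : Policy m n →ₗ[ℝ] Matrix (Fin n) (Fin m) ℝ :=
    { toFun := Policy.mat
      map_add' := fun _ _ => rfl
      map_smul' := fun _ _ => rfl }
  exact (LinearMap.toContinuousLinearMap L).contDiff

lemma contDiff_matrix_mul {a b c : ℕ} {k : WithTop ℕ∞} {E : Type*} [NormedAddCommGroup E]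
    [NormedSpace ℝ E] {F : E → Matrix (Fin a) (Fin b) ℝ} {G : E → Matrix (Fin b) (Fin c) ℝ}
    (hF : ContDiff ℝ k F) (hG : ContDiff ℝ k G) : ContDiff ℝ k fun x => F x * G x := by
  let L : Matrix (Fin a) (Fin b) ℝ →ₗ[ℝ] Matrix (Fin b) (Fin c) ℝ →ₗ[ℝ]
      Matrix (Fin a) (Fin c) ℝ := LinearMap.mk₂ ℝ (fun M N => M * N) Matrix.add_mul
        Matrix.smul_mul Matrix.mul_add (fun c M N => Matrix.mul_smul M c N)
  let L' := LinearMap.toContinuousLinearMap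
    ((LinearMap.toContinuousLinearMap : _ ≃ₗ[ℝ] _).toLinearMap ∘ₗ L)
  exact L'.isBoundedBilinearMap.contDiff.comp (hF.prodMk hG)

lemma contDiff_matrix_transpose {a b : ℕ} {k : WithTop ℕ∞} :
    ContDiff ℝ k fun M : Matrix (Fin a) (Fin b) ℝ => Mᵀ :=
  (LinearMap.toContinuousLinearMap
    (Matrix.transposeLinearEquiv (Fin a) (Fin b) ℝ ℝ).toLinearMap).contDiff

variable (S) in
lemma contDiff_closedLoop {k : WithTop ℕ∞} : ContDiff ℝ k S.closedLoop :=
  contDiff_const.sub (contDiff_matrix_mul contDiff_const contDiff_mat)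

variable (S) in
lemma contDiff_costMat {k : WithTop ℕ∞} : ContDiff ℝ k S.costMat :=
  contDiff_const.add (contDiff_matrix_mul (contDiff_matrix_mul
    (contDiff_matrix_transpose.comp contDiff_mat) contDiff_const) contDiff_mat)

lemma Admissible.isOpen_dom (hS : S.Admissible) : IsOpen S.dom := by
  have : S.dom = ⋃ N, {K | S.γ ^ N * ‖S.closedLoop K ^ N‖ ^ 2 < 1} := by
    ext K; simp [hS.mem_dom_iff_exists_pow]
  rw [this]
  refine isOpen_iUnion fun N => isOpen_lt ?_ continuous_const
  exact continuous_const.mul (((S.contDiff_closedLoop (k := 0)).continuous.pow N).norm.pow 2)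

/-- The terms of the series are nonnegative and continuous on all of policy space, so semicontinuity
also holds at policies of infinite cost. This keeps sublevel sets away from the boundary of the
domain. -/
lemma Admissible.lowerSemicontinuous_cost (hS : S.Admissible) : LowerSemicontinuous S.cost := by
  have : S.cost = fun K => ∑' t, ENNReal.ofReal
      (S.γ ^ t * ∑ i ∈ Finset.range t, S.impulseCost K i) := funext hS.cost_eq_tsum
  rw [this]
  refine lowerSemicontinuous_tsum fun t => Continuous.lowerSemicontinuous ?_
  refine ENNReal.continuous_ofReal.comp (continuous_const.mul
    (continuous_finsetSum _ fun i _ => Continuous.matrix_trace ?_))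
  have hc : Continuous S.closedLoop := (S.contDiff_closedLoop (k := 0)).continuous
  have hq : Continuous S.costMat := (S.contDiff_costMat (k := 0)).continuous
  exact ((hc.pow i).matrix_transpose.mul hq).mul (hc.pow i)

lemma Admissible.isClosed_sublevel (hS : S.Admissible) (c : ℝ) :
    IsClosed {K | K ∈ S.dom ∧ S.realCost K ≤ c} := by
  rcases lt_or_ge c 0 with hc | hc
  · convert isClosed_empty
    ext K
    simp only [Set.mem_ofPred_eq, Set.mem_empty_iff_false, iff_false, not_and, not_le]
    exact fun _ => hc.trans_le ENNReal.toReal_nonneg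
  · have : {K | K ∈ S.dom ∧ S.realCost K ≤ c} = S.cost ⁻¹' Set.Iic (ENNReal.ofReal c) := by
      ext K
      simp only [Set.mem_ofPred_eq, Set.mem_preimage, Set.mem_Iic, dom, realCost]
      constructor
      · rintro ⟨h1, h2⟩
        exact (ENNReal.le_ofReal_iff_toReal_le h1 hc).2 h2
      · intro h
        have h1 : S.cost K ≠ ⊤ := ne_top_of_le_ne_top ENNReal.ofReal_ne_top h
        exact ⟨h1, (ENNReal.le_ofReal_iff_toReal_le h1 hc).1 h⟩
    rw [this]
    exact hS.lowerSemicontinuous_cost.isClosed_preimage _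

lemma norm_mat (K : Policy m n) : ‖K.mat‖ = ‖K‖ := by
  rw [← sq_eq_sq₀ (norm_nonneg _) (norm_nonneg _), frobenius_sq_rows,
    EuclideanSpace.real_norm_sq_eq, Fintype.sum_prod_type]
  simp [dotProduct, Policy.mat, sq]

/-- The impulse at lag zero alone costs `tr (Q + KᵀRK)`, and `R` is positive definite. This
coercivity makes sublevel sets bounded. -/
lemma Admissible.exists_pos_le_realCost (hS : S.Admissible) :
    ∃ c > 0, ∀ K ∈ S.dom, c * ‖K‖ ^ 2 ≤ S.realCost K := by
  obtain ⟨c, hc, h⟩ := exists_pos_le_quadratic hS.posDef_R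
  have hγ : 0 < S.γ / (1 - S.γ) := div_pos hS.discount_pos (by linarith [hS.discount_lt_one])
  refine ⟨S.γ / (1 - S.γ) * c, mul_pos hγ hc, fun K hK => ?_⟩
  rw [hS.realCost_eq_tsum hK, mul_assoc]
  refine mul_le_mul_of_nonneg_left ?_ hγ.le
  have h1 := ((hS.mem_dom_iff_summable_impulseCost K).1 hK).le_tsum 0
    fun i _ => mul_nonneg (pow_nonneg hS.discount_pos.le _) (hS.impulseCost_nonneg K i)
  refine le_trans ?_ h1
  have h2 := le_trace_conj h K.mat
  have h3 := hS.posDef_Q.posSemidef.trace_nonneg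
  simp only [impulseCost, costMat, pow_zero, Matrix.transpose_one, one_mul, mul_one,
    Matrix.trace_add]
  rw [norm_mat] at h2
  linarith

lemma Admissible.isCompact_sublevel (hS : S.Admissible) (c : ℝ) :
    IsCompact {K | K ∈ S.dom ∧ S.realCost K ≤ c} := by
  refine Metric.isCompact_of_isClosed_isBounded (hS.isClosed_sublevel c) ?_
  obtain ⟨b, hb, h⟩ := hS.exists_pos_le_realCost
  refine (Metric.isBounded_closedBall (x := 0) (r := Real.sqrt (c / b))).subset ?_
  rintro K ⟨h1, h2⟩
  rw [mem_closedBall_zero_iff]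
  refine Real.le_sqrt_of_sq_le ?_
  rw [le_div_iff₀ hb]
  linarith [h K h1]

lemma Admissible.exists_isOptimal (hS : S.Admissible) {K₀ : Policy m n} (hK₀ : K₀ ∈ S.dom) :
    ∃ K, S.IsOptimal K := by
  obtain ⟨K, hK, hmin⟩ := LowerSemicontinuousOn.exists_isMinOn
    (s := {K | K ∈ S.dom ∧ S.realCost K ≤ S.realCost K₀}) ⟨K₀, hK₀, le_rfl⟩
    (hS.isCompact_sublevel _) (hS.lowerSemicontinuous_cost.lowerSemicontinuousOn _)
  refine ⟨K, fun K' => ?_⟩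
  by_cases h : K' ∈ S.dom
  · rcases le_total (S.realCost K') (S.realCost K₀) with h1 | h1
    · exact hmin ⟨h, h1⟩
    · exact (ENNReal.toReal_le_toReal hK.1 h).1 (hK.2.trans h1)
  · have : S.cost K' = ⊤ := by simpa [dom] using h
    rw [this]
    exact le_top

end LQRSystem
end ZeroOrderLQR

namespace ZeroOrderLQR
/-! ### The equation `w - x w y = q` in a Banach algebra -/

section SteinEquation

variable {𝔸 : Type*} [NormedRing 𝔸] [NormedAlgebra ℝ 𝔸]

/-- The solution `w` of `w - x w y = q`, when the powers of `x` and `y` decay. -/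
noncomputable def steinSolution (x y q : 𝔸) : 𝔸 :=
  Ring.inverse (1 - ContinuousLinearMap.mulLeftRight ℝ 𝔸 x y) q

variable [CompleteSpace 𝔸] {x y q : 𝔸}

/-- Neumann series: the `i`-th power of `w ↦ x w y` is `w ↦ x^i w y^i`, of norm at most `‖x^i‖
‖y^i‖`. -/
lemma isUnit_one_sub_mulLeftRight (h : Summable fun i => ‖x ^ i‖ * ‖y ^ i‖) :
    IsUnit (1 - ContinuousLinearMap.mulLeftRight ℝ 𝔸 x y) := by
  have hpow : ∀ (i : ℕ) (w : 𝔸),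
      (ContinuousLinearMap.mulLeftRight ℝ 𝔸 x y ^ i) w = x ^ i * w * y ^ i := by
    intro i w
    induction i with
    | zero => simp
    | succ i ih =>
      rw [pow_succ', mul_apply_eq_comp, ih, ContinuousLinearMap.mulLeftRight_apply, pow_succ' x,
        pow_succ y]
      simp only [mul_assoc]
  have hs : Summable (ContinuousLinearMap.mulLeftRight ℝ 𝔸 x y ^ ·) := by
    refine Summable.of_norm_bounded h fun i => ?_
    refine ContinuousLinearMap.opNorm_le_bound _ (by positivity) fun w => ?_
    rw [hpow]
    calc ‖x ^ i * w * y ^ i‖ ≤ ‖x ^ i‖ * ‖w‖ * ‖y ^ i‖ :=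
          (norm_mul_le _ _).trans (mul_le_mul_of_nonneg_right (norm_mul_le _ _) (norm_nonneg _))
      _ = ‖x ^ i‖ * ‖y ^ i‖ * ‖w‖ := by ring
  exact ⟨⟨_, _, hs.one_sub_mul_tsum_pow, hs.tsum_pow_mul_one_sub⟩, rfl⟩

lemma steinSolution_sub (h : Summable fun i => ‖x ^ i‖ * ‖y ^ i‖) :
    steinSolution x y q - x * steinSolution x y q * y = q := by
  simpa [steinSolution] using congrArg (fun f => f q)
    (Ring.mul_inverse_cancel _ (isUnit_one_sub_mulLeftRight h))

lemma eq_steinSolution (h : Summable fun i => ‖x ^ i‖ * ‖y ^ i‖) {w : 𝔸}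
    (hw : w - x * w * y = q) : w = steinSolution x y q := by
  have h1 := congrArg (fun f => f w) (Ring.inverse_mul_cancel _ (isUnit_one_sub_mulLeftRight h))
  rw [← hw]
  simpa [steinSolution] using h1.symm

/-- Inversion is smooth near a unit. Summability is needed only at the base point, so the value
matrix is smooth without differentiating a series term by term. -/
lemma contDiffAt_steinSolution (h : Summable fun i => ‖x ^ i‖ * ‖y ^ i‖) {k : WithTop ℕ∞} :
    ContDiffAt ℝ k (fun p : 𝔸 × 𝔸 × 𝔸 => steinSolution p.1 p.2.1 p.2.2) (x, y, q) := by
  obtain ⟨u, hu⟩ := isUnit_one_sub_mulLeftRight h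
  have h1 : ContDiff ℝ k fun p : 𝔸 × 𝔸 × 𝔸 =>
      1 - ContinuousLinearMap.mulLeftRight ℝ 𝔸 p.1 p.2.1 := by fun_prop
  have h2 := contDiffAt_ringInverse ℝ (n := k) u
  rw [hu] at h2
  exact (ContDiffAt.comp (x, y, q) h2 h1.contDiffAt).clm_apply
    (contDiff_snd.comp contDiff_snd).contDiffAt

end SteinEquation

namespace LQRSystem

/-! ### The value matrix of a policy -/

open scoped Matrix.Norms.Frobenius

variable {m n : ℕ} (S : LQRSystem m n)

/-- The solution `P` of `P = Q + Kᵀ R K + γ Mᵀ P M`, with `M` the closed-loop matrix. -/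
noncomputable def valueMat (K : Policy m n) : Matrix (Fin m) (Fin m) ℝ :=
  steinSolution (S.γ • (S.closedLoop K)ᵀ) (S.closedLoop K) (S.costMat K)

variable {S}

lemma Admissible.summable_norm_pow_mul (hS : S.Admissible) {K : Policy m n} (hK : K ∈ S.dom) :
    Summable fun i => ‖(S.γ • (S.closedLoop K)ᵀ) ^ i‖ * ‖S.closedLoop K ^ i‖ := by
  refine ((hS.mem_dom_iff_summable_norm K).1 hK).congr fun i => ?_
  rw [smul_pow, norm_smul, Real.norm_of_nonneg (pow_nonneg hS.discount_pos.le i),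
    ← Matrix.transpose_pow, Matrix.frobenius_norm_transpose]
  ring

lemma Admissible.valueMat_sub (hS : S.Admissible) {K : Policy m n} (hK : K ∈ S.dom) :
    S.valueMat K - S.γ • ((S.closedLoop K)ᵀ * S.valueMat K * S.closedLoop K) = S.costMat K := by
  have h := steinSolution_sub (q := S.costMat K) (hS.summable_norm_pow_mul hK)
  rwa [smul_mul_assoc, smul_mul_assoc] at h

lemma Admissible.costMat_transpose (hS : S.Admissible) (K : Policy m n) :
    (S.costMat K)ᵀ = S.costMat K := by
  simpa using (hS.costMat_posSemidef K).isHermitian.eq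

/-- The transpose solves the same Stein equation, whose solution is unique. -/
lemma Admissible.valueMat_transpose (hS : S.Admissible) {K : Policy m n} (hK : K ∈ S.dom) :
    (S.valueMat K)ᵀ = S.valueMat K := by
  refine eq_steinSolution (hS.summable_norm_pow_mul hK) ?_
  have := congrArg Matrix.transpose (hS.valueMat_sub hK)
  rw [hS.costMat_transpose] at this
  simpa [Matrix.mul_assoc] using this

lemma Admissible.contDiffAt_valueMat (hS : S.Admissible) {K : Policy m n} (hK : K ∈ S.dom)
    {k : WithTop ℕ∞} : ContDiffAt ℝ k S.valueMat K := by
  have h1 : ContDiff ℝ k fun K => (S.γ • (S.closedLoop K)ᵀ, S.closedLoop K, S.costMat K) :=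
    (ContDiff.const_smul S.γ (contDiff_matrix_transpose.comp S.contDiff_closedLoop)).prodMk
      (S.contDiff_closedLoop.prodMk S.contDiff_costMat)
  exact ContDiffAt.comp K (contDiffAt_steinSolution (hS.summable_norm_pow_mul hK))
    h1.contDiffAt

/-- A matrix is the discounted sum of its one-step decrements along a stable closed loop. -/
lemma Admissible.hasSum_trace_decrement (hS : S.Admissible) {K : Policy m n} (hK : K ∈ S.dom)
    {b : ℕ} (W : Matrix (Fin m) (Fin m) ℝ) (N : Matrix (Fin m) (Fin b) ℝ) :
    HasSum (fun i => S.γ ^ i * ((S.closedLoop K ^ i * N)ᵀ *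
      (W - S.γ • ((S.closedLoop K)ᵀ * W * S.closedLoop K)) * (S.closedLoop K ^ i * N)).trace)
      (Nᵀ * W * N).trace := by
  set M := S.closedLoop K
  set t : ℕ → ℝ := fun i => S.γ ^ i * ((M ^ i * N)ᵀ * W * (M ^ i * N)).trace with ht
  -- The series telescopes to `t 0`; the domain criterion makes `t` summable.
  have hterm : ∀ i, S.γ ^ i * ((M ^ i * N)ᵀ * (W - S.γ • (Mᵀ * W * M)) * (M ^ i * N)).trace =
      t i - t (i + 1) := by
    intro i
    simp only [ht, pow_succ' M, Matrix.mul_sub, Matrix.sub_mul, Matrix.trace_sub, Matrix.mul_smul,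
      Matrix.smul_mul, Matrix.trace_smul, smul_eq_mul, mul_sub, Matrix.transpose_mul,
      Matrix.mul_assoc]
    ring
  have hn := (hS.mem_dom_iff_summable_norm K).1 hK
  have hbound : ∀ i, |t i| ≤ ‖W‖ * ‖N‖ ^ 2 * (S.γ ^ i * ‖M ^ i‖ ^ 2) := by
    intro i
    have hp : 0 ≤ S.γ ^ i := pow_nonneg hS.discount_pos.le i
    rw [ht, abs_mul, abs_of_nonneg hp]
    calc S.γ ^ i * |((M ^ i * N)ᵀ * W * (M ^ i * N)).trace|
        ≤ S.γ ^ i * (‖W‖ * ‖M ^ i * N‖ ^ 2) :=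
          mul_le_mul_of_nonneg_left (abs_trace_conj_le _ _) hp
      _ ≤ S.γ ^ i * (‖W‖ * (‖M ^ i‖ * ‖N‖) ^ 2) := by
          gcongr; exact Matrix.frobenius_norm_mul _ _
      _ = _ := by ring
  have hst : Summable t := Summable.of_norm_bounded (hn.mul_left _) hbound
  have h0 : t 0 = (Nᵀ * W * N).trace := by simp [ht]
  simp only [hterm]
  have h1 := hst.hasSum.sub ((summable_nat_add_iff 1).2 hst).hasSum
  rwa [hst.tsum_eq_zero_add, add_sub_cancel_right, h0] at h1

lemma Admissible.hasSum_impulseCost (hS : S.Admissible) {K : Policy m n} (hK : K ∈ S.dom) :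
    HasSum (fun i => S.γ ^ i * S.impulseCost K i) (S.valueMat K).trace := by
  simpa [hS.valueMat_sub hK, impulseCost] using
    hS.hasSum_trace_decrement hK (S.valueMat K) (1 : Matrix (Fin m) (Fin m) ℝ)

lemma Admissible.realCost_eq_trace (hS : S.Admissible) {K : Policy m n} (hK : K ∈ S.dom) :
    S.realCost K = S.γ / (1 - S.γ) * (S.valueMat K).trace := by
  rw [hS.realCost_eq_tsum hK, (hS.hasSum_impulseCost hK).tsum_eq]

/-- With `N` the single column `v`, the decrement formula writes `vᵀPv` as the discounted cost of
the noiseless trajectory from `v`. -/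
lemma Admissible.quadratic_valueMat_nonneg (hS : S.Admissible) {K : Policy m n} (hK : K ∈ S.dom)
    (v : Fin m → ℝ) : 0 ≤ v ⬝ᵥ (S.valueMat K *ᵥ v) := by
  have h := hS.hasSum_trace_decrement hK (S.valueMat K) (Matrix.replicateCol (Fin 1) v)
  rw [hS.valueMat_sub hK] at h
  have h2 := h.nonneg fun i => mul_nonneg (pow_nonneg hS.discount_pos.le i) (by
    rw [trace_conj]
    exact Finset.sum_nonneg fun j _ => hS.quadratic_costMat_nonneg K _)
  rw [trace_conj, Fin.sum_univ_one] at h2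
  exact h2

lemma Admissible.valueMat_posSemidef (hS : S.Admissible) {K : Policy m n} (hK : K ∈ S.dom) :
    (S.valueMat K).PosSemidef :=
  .of_dotProduct_mulVec_nonneg (by simpa [Matrix.IsHermitian] using hS.valueMat_transpose hK)
    fun v => by simpa using hS.quadratic_valueMat_nonneg hK v

lemma Admissible.contDiffAt_realCost (hS : S.Admissible) {K : Policy m n} (hK : K ∈ S.dom)
    {k : WithTop ℕ∞} : ContDiffAt ℝ k S.realCost K := by
  have h1 : ContDiffAt ℝ k (fun K => S.γ / (1 - S.γ) * (S.valueMat K).trace) K :=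
    contDiffAt_const.mul ((LinearMap.toContinuousLinearMap
      (Matrix.traceLinearMap (Fin m) ℝ ℝ)).contDiff.contDiffAt.comp K (hS.contDiffAt_valueMat hK))
  exact h1.congr_of_eventuallyEq (Filter.eventually_of_mem (hS.isOpen_dom.mem_nhds hK)
    fun K' hK' => hS.realCost_eq_trace hK')

/-! ### Gradient domination -/

variable (S) in
/-- The matrix `R K - γ Bᵀ P M`, which vanishes exactly at stationary policies. -/
noncomputable def residual (K : Policy m n) : Matrix (Fin n) (Fin m) ℝ :=
  S.R * K.mat - S.γ • (S.Bᵀ * S.valueMat K * S.closedLoop K)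

variable (S) in
/-- The one-step gain of switching from the policy `K` to `K'`. -/
noncomputable def advantage (K K' : Policy m n) : Matrix (Fin m) (Fin m) ℝ :=
  S.costMat K' - (S.valueMat K - S.γ • ((S.closedLoop K')ᵀ * S.valueMat K * S.closedLoop K'))

/-- The Stein equation of `K` cancels the terms of order zero in `δ = K' - K`. The residual is the
coefficient of first order, and the second-order part is the nonnegative form of `R + γ BᵀPB`. -/
lemma Admissible.quadratic_advantage (hS : S.Admissible) {K : Policy m n} (hK : K ∈ S.dom)
    (K' : Policy m n) (v : Fin m → ℝ) :
    v ⬝ᵥ (S.advantage K K' *ᵥ v) = 2 * (((K' - K).mat *ᵥ v) ⬝ᵥ (S.residual K *ᵥ v)) +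
      ((K' - K).mat *ᵥ v) ⬝ᵥ (S.R *ᵥ ((K' - K).mat *ᵥ v)) +
      S.γ * ((S.B *ᵥ ((K' - K).mat *ᵥ v)) ⬝ᵥ
        (S.valueMat K *ᵥ (S.B *ᵥ ((K' - K).mat *ᵥ v)))) := by
  have hmat : K'.mat = K.mat + (K' - K).mat := by ext i j; simp [Policy.mat]
  set δ := (K' - K).mat
  set P := S.valueMat K with hP
  set M := S.closedLoop K with hM
  have hPT : Pᵀ = P := hS.valueMat_transpose hK
  have hRT : S.Rᵀ = S.R := by simpa using hS.posDef_R.isHermitian.eq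
  have hM' : S.closedLoop K' *ᵥ v = M *ᵥ v + -(S.B *ᵥ (δ *ᵥ v)) := by
    rw [hM, closedLoop, closedLoop, hmat, Matrix.mul_add, ← sub_sub, Matrix.sub_mulVec,
      Matrix.mulVec_mulVec, sub_eq_add_neg]
  have hK' : K'.mat *ᵥ v = K.mat *ᵥ v + δ *ᵥ v := by rw [hmat, Matrix.add_mulVec]
  have h1 := congrArg (fun W => v ⬝ᵥ (W *ᵥ v)) (hS.valueMat_sub hK)
  simp only [costMat, Matrix.sub_mulVec, Matrix.add_mulVec, dotProduct_sub, dotProduct_add,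
    Matrix.smul_mulVec, dotProduct_smul, smul_eq_mul, ← quadratic_mulVec] at h1
  have h2 : (δ *ᵥ v) ⬝ᵥ (S.residual K *ᵥ v) = (S.R *ᵥ (K.mat *ᵥ v)) ⬝ᵥ (δ *ᵥ v) -
      S.γ * ((P *ᵥ (M *ᵥ v)) ⬝ᵥ (S.B *ᵥ (δ *ᵥ v))) := by
    rw [residual, Matrix.sub_mulVec, dotProduct_sub, Matrix.smul_mulVec, dotProduct_smul,
      smul_eq_mul, ← Matrix.mulVec_mulVec, dotProduct_comm, ← Matrix.mulVec_mulVec,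
      ← Matrix.mulVec_mulVec, dotProduct_comm (P *ᵥ _), Matrix.dotProduct_mulVec _ S.Bᵀ,
      Matrix.vecMul_transpose]
  simp only [advantage, costMat, Matrix.sub_mulVec, Matrix.add_mulVec, dotProduct_sub,
    dotProduct_add, Matrix.smul_mulVec, dotProduct_smul, smul_eq_mul, ← quadratic_mulVec]
  rw [hM', hK', quadratic_add, quadratic_add, hRT, hPT, h2]
  simp only [Matrix.add_mulVec, add_dotProduct, Matrix.mulVec_neg, dotProduct_neg,
    neg_dotProduct, neg_neg]
  linarith

/-- The cost difference formula. -/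
lemma Admissible.hasSum_advantage (hS : S.Admissible) (K : Policy m n) {K' : Policy m n}
    (hK' : K' ∈ S.dom) :
    HasSum (fun i => S.γ ^ i *
      ((S.closedLoop K' ^ i)ᵀ * S.advantage K K' * S.closedLoop K' ^ i).trace)
      ((S.valueMat K').trace - (S.valueMat K).trace) := by
  have h1 := hS.hasSum_impulseCost hK'
  have h2 := hS.hasSum_trace_decrement hK' (S.valueMat K) (1 : Matrix (Fin m) (Fin m) ℝ)
  simp only [Matrix.mul_one, Matrix.transpose_one, Matrix.one_mul] at h2
  refine (h1.sub h2).congr_fun fun i => ?_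
  rw [← mul_sub, impulseCost, ← Matrix.trace_sub, ← Matrix.sub_mul, ← Matrix.mul_sub, advantage]

/-- Drop the `P`-term of the advantage and complete the square, `c |d|² + 2 ⟨d, e⟩ ≥ -|e|² / c` with
`e = residual K *ᵥ v`. The bound no longer involves `K' - K`, so it can be summed along the closed
loop of `K'`, later the minimizer. -/
lemma Admissible.trace_valueMat_sub_le (hS : S.Admissible) {c : ℝ} (hc : 0 < c)
    (hR : ∀ v, c * (v ⬝ᵥ v) ≤ v ⬝ᵥ (S.R *ᵥ v)) {K K' : Policy m n} (hK : K ∈ S.dom)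
    (hK' : K' ∈ S.dom) :
    (S.valueMat K).trace - (S.valueMat K').trace ≤
      ‖S.residual K‖ ^ 2 / c * ∑' i, S.γ ^ i * ‖S.closedLoop K' ^ i‖ ^ 2 := by
  have hn := (hS.mem_dom_iff_summable_norm K').1 hK'
  have hW : ∀ v, -(‖S.residual K‖ ^ 2 / c) * (v ⬝ᵥ v) ≤ v ⬝ᵥ (S.advantage K K' *ᵥ v) := by
    intro v
    rw [hS.quadratic_advantage hK]
    set d := (K' - K).mat *ᵥ v
    have h1 := mulVec_dotProduct_self_le (S.residual K) v
    set e := S.residual K *ᵥ v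
    have h2 := hR d
    have h3 : 0 ≤ S.γ * ((S.B *ᵥ d) ⬝ᵥ (S.valueMat K *ᵥ (S.B *ᵥ d))) :=
      mul_nonneg hS.discount_pos.le (hS.quadratic_valueMat_nonneg hK _)
    have h4 : 0 ≤ (c • d + e) ⬝ᵥ (c • d + e) := dotProduct_self_nonneg' _
    simp only [dotProduct_add, add_dotProduct, dotProduct_smul, smul_dotProduct,
      smul_eq_mul, dotProduct_comm e d] at h4
    have h5 : 0 ≤ c * (c * (d ⬝ᵥ d) + 2 * (d ⬝ᵥ e)) + ‖S.residual K‖ ^ 2 * (v ⬝ᵥ v) := by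
      linarith
    have h6 : -(‖S.residual K‖ ^ 2 / c) * (v ⬝ᵥ v) ≤ c * (d ⬝ᵥ d) + 2 * (d ⬝ᵥ e) := by
      rw [neg_mul, div_mul_eq_mul_div, ← neg_div, div_le_iff₀ hc]
      linarith
    linarith
  have h := (hn.hasSum.mul_left (-(‖S.residual K‖ ^ 2 / c)))
  have h2 := hasSum_le (fun i => ?_) h (hS.hasSum_advantage K hK')
  · linarith
  · rw [mul_left_comm]
    exact mul_le_mul_of_nonneg_left (le_trace_conj hW _) (pow_nonneg hS.discount_pos.le i)

variable (S) in
/-- The residual as an element of policy space. -/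
noncomputable def residualPolicy (K : Policy m n) : Policy m n :=
  WithLp.toLp 2 fun p => S.residual K p.1 p.2

lemma residualPolicy_mat (K : Policy m n) : (S.residualPolicy K).mat = S.residual K := rfl

/-- In the direction of the residual `E` the advantage is at least `2 t |E v|²`. All terms of the
cost difference formula are then nonnegative, and the term `i = 0` alone yields `2 t ‖E‖²`. -/
lemma Admissible.le_realCost_add_residual (hS : S.Admissible) {K : Policy m n} (hK : K ∈ S.dom)
    {t : ℝ} (ht : 0 ≤ t) (hK' : K + t • S.residualPolicy K ∈ S.dom) :
    2 * (S.γ / (1 - S.γ)) * t * ‖S.residual K‖ ^ 2 ≤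
      S.realCost (K + t • S.residualPolicy K) - S.realCost K := by
  have hγ : 0 ≤ S.γ / (1 - S.γ) :=
    div_nonneg hS.discount_pos.le (by linarith [hS.discount_lt_one])
  have hW : ∀ v, 2 * t * ((S.residual K *ᵥ v) ⬝ᵥ (S.residual K *ᵥ v)) ≤
      v ⬝ᵥ (S.advantage K (K + t • S.residualPolicy K) *ᵥ v) := by
    intro v
    have hd : (K + t • S.residualPolicy K - K).mat = t • S.residual K := by
      rw [add_sub_cancel_left]; rfl
    rw [hS.quadratic_advantage hK, hd, Matrix.smul_mulVec, smul_dotProduct, smul_eq_mul]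
    have h1 : 0 ≤ (t • (S.residual K *ᵥ v)) ⬝ᵥ (S.R *ᵥ (t • (S.residual K *ᵥ v))) := by
      simpa using hS.posDef_R.posSemidef.dotProduct_mulVec_nonneg (t • (S.residual K *ᵥ v))
    have h2 := mul_nonneg hS.discount_pos.le
      (hS.quadratic_valueMat_nonneg hK (S.B *ᵥ (t • (S.residual K *ᵥ v))))
    linarith
  rw [hS.realCost_eq_trace hK, hS.realCost_eq_trace hK', ← mul_sub]
  have h := hS.hasSum_advantage K hK'
  have h0 : ∀ i, 0 ≤ S.γ ^ i * ((S.closedLoop (K + t • S.residualPolicy K) ^ i)ᵀ *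
      S.advantage K (K + t • S.residualPolicy K) *
        S.closedLoop (K + t • S.residualPolicy K) ^ i).trace := by
    intro i
    refine mul_nonneg (pow_nonneg hS.discount_pos.le i) ?_
    rw [trace_conj]
    exact Finset.sum_nonneg fun j _ => (mul_nonneg (by linarith)
      (dotProduct_self_nonneg' _)).trans (hW _)
  have h1 := le_hasSum h 0 fun i _ => h0 i
  have h2 : 2 * t * ‖S.residual K‖ ^ 2 ≤
      ((1 : Matrix (Fin m) (Fin m) ℝ)ᵀ * S.advantage K (K + t • S.residualPolicy K) * 1).trace := by
    rw [trace_conj, frobenius_sq, Finset.mul_sum]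
    refine Finset.sum_le_sum fun j _ => le_trans (le_of_eq ?_) (hW _)
    have : S.residual K *ᵥ (1 : Matrix (Fin m) (Fin m) ℝ)ᵀ j = (S.residual K)ᵀ j := by
      ext i
      simp [Matrix.mulVec, dotProduct, Matrix.one_apply]
    rw [this]
  simp only [pow_zero, one_mul] at h1
  calc 2 * (S.γ / (1 - S.γ)) * t * ‖S.residual K‖ ^ 2
      = S.γ / (1 - S.γ) * (2 * t * ‖S.residual K‖ ^ 2) := by ring
    _ ≤ _ := mul_le_mul_of_nonneg_left (h2.trans h1) hγ

/-- The preceding growth bound passes to the directional derivative along the residual, and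
Cauchy-Schwarz finishes. No formula for the gradient is required. -/
lemma Admissible.residual_le_gradient (hS : S.Admissible) {K : Policy m n} (hK : K ∈ S.dom) :
    2 * (S.γ / (1 - S.γ)) * ‖S.residual K‖ ≤ ‖gradient S.realCost K‖ := by
  have hd : DifferentiableAt ℝ S.realCost K :=
    (hS.contDiffAt_realCost hK (k := 1)).differentiableAt one_ne_zero
  have hγ : 0 < S.γ / (1 - S.γ) := div_pos hS.discount_pos (by linarith [hS.discount_lt_one])
  have hnorm : ‖S.residualPolicy K‖ = ‖S.residual K‖ := by
    rw [← norm_mat, residualPolicy_mat]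
  have hline : HasDerivAt (fun t : ℝ => S.realCost (K + t • S.residualPolicy K))
      (inner ℝ (gradient S.realCost K) (S.residualPolicy K)) 0 := by
    have h1 : HasDerivAt (fun t : ℝ => K + t • S.residualPolicy K) (S.residualPolicy K) 0 := by
      simpa using ((hasDerivAt_id (0 : ℝ)).smul_const (S.residualPolicy K)).const_add K
    have h2 := hd.hasGradientAt.hasFDerivAt
    have h3 : K = K + (0 : ℝ) • S.residualPolicy K := by simp
    have := HasFDerivAt.comp_hasDerivAt (0 : ℝ) (by rw [← h3]; exact h2) h1
    simpa [Function.comp_def] using this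
  have hev : ∀ᶠ t : ℝ in nhdsWithin 0 (Set.Ioi 0), 2 * (S.γ / (1 - S.γ)) * ‖S.residual K‖ ^ 2 ≤
      t⁻¹ • (S.realCost (K + (0 + t) • S.residualPolicy K) -
        S.realCost (K + (0 : ℝ) • S.residualPolicy K)) := by
    have hc : Filter.Tendsto (fun t : ℝ => K + t • S.residualPolicy K) (nhds 0) (nhds K) := by
      have : Continuous fun t : ℝ => K + t • S.residualPolicy K := by fun_prop
      simpa using this.tendsto 0
    filter_upwards [self_mem_nhdsWithin,
      nhdsWithin_le_nhds (hc.eventually (hS.isOpen_dom.mem_nhds hK))] with t ht hmem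
    have ht0 : (0 : ℝ) < t := ht
    have := hS.le_realCost_add_residual hK ht0.le hmem
    rw [zero_add, zero_smul, add_zero, smul_eq_mul, inv_mul_eq_div, le_div_iff₀ ht0]
    linarith
  have hge := ge_of_tendsto hline.tendsto_slope_zero_right hev
  have hcs := hge.trans (real_inner_le_norm _ _)
  rw [hnorm] at hcs
  rcases (norm_nonneg (S.residual K)).eq_or_lt with h0 | h0
  · rw [← h0]; simp
  · refine le_of_mul_le_mul_right ?_ h0
    linarith

lemma IsOptimal.mem_dom {Kstar K₀ : Policy m n} (h : S.IsOptimal Kstar) (hK₀ : K₀ ∈ S.dom) :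
    Kstar ∈ S.dom := ne_top_of_le_ne_top hK₀ (h K₀)

lemma IsOptimal.realCost_le {Kstar K : Policy m n} (h : S.IsOptimal Kstar) (hK : K ∈ S.dom) :
    S.realCost Kstar ≤ S.realCost K := ENNReal.toReal_mono hK (h K)

lemma Admissible.contDiffOn_realCost (hS : S.Admissible) {k : WithTop ℕ∞} :
    ContDiffOn ℝ k S.realCost S.dom :=
  fun _ hK => (hS.contDiffAt_realCost hK).contDiffWithinAt

lemma Admissible.exists_isPL (hS : S.Admissible) {Kstar : Policy m n} (h : S.IsOptimal Kstar)
    (hd : Kstar ∈ S.dom) : ∃ μ, IsPL S.realCost S.dom μ := by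
  obtain ⟨c, hc, hR⟩ := exists_pos_le_quadratic hS.posDef_R
  have hγ : 0 < S.γ / (1 - S.γ) := div_pos hS.discount_pos (by linarith [hS.discount_lt_one])
  set g := S.γ / (1 - S.γ)
  set X := ∑' i, S.γ ^ i * ‖S.closedLoop Kstar ^ i‖ ^ 2 with hX
  have hX0 : 0 ≤ X := tsum_nonneg fun i => mul_nonneg (pow_nonneg hS.discount_pos.le i)
    (sq_nonneg _)
  -- The two estimates, gap at most `g ‖E‖² X / c` and gradient at least `2 g ‖E‖`, suggest `4 g c /
  -- X`; the `+ 1` keeps the denominator positive.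
  refine ⟨4 * g * c / (X + 1), by positivity, hS.contDiffOn_realCost, Kstar, hd,
    fun K hK => h.realCost_le hK, fun K hK => ?_⟩
  have h1 := hS.trace_valueMat_sub_le hc hR hK hd
  have h2 := hS.residual_le_gradient hK
  rw [hS.realCost_eq_trace hK, hS.realCost_eq_trace hd, ← mul_sub]
  have h3 : (2 * g * ‖S.residual K‖) ^ 2 ≤ ‖gradient S.realCost K‖ ^ 2 :=
    pow_le_pow_left₀ (by positivity) h2 2
  refine le_trans ?_ h3
  calc 4 * g * c / (X + 1) * (g * ((S.valueMat K).trace - (S.valueMat Kstar).trace))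
      ≤ 4 * g * c / (X + 1) * (g * (‖S.residual K‖ ^ 2 / c * (X + 1))) := by
        gcongr
        exact h1.trans (mul_le_mul_of_nonneg_left (by linarith) (by positivity))
    _ = (2 * g * ‖S.residual K‖) ^ 2 := by field_simp; ring

end LQRSystem
end ZeroOrderLQR

namespace ZeroOrderLQR

/-! ### Existence of curvature parameters -/

/-- The derivative is bounded on the compact set and balls are convex, so the mean value inequality
gives one constant for all balls inside it. -/
lemma exists_lipschitz_on_balls {E F : Type*} [NormedAddCommGroup E] [NormedSpace ℝ E]
    [NormedAddCommGroup F] [NormedSpace ℝ F] {f : E → F} {C : Set E} (hC : IsCompact C)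
    (hf : ∀ x ∈ C, ContDiffAt ℝ 1 f x) (ρ : ℝ) :
    ∃ L > 0, ∀ x, Metric.closedBall x ρ ⊆ C → ∀ y, ‖x - y‖ ≤ ρ →
      ‖f y - f x‖ ≤ L * ‖y - x‖ := by
  have hc : ContinuousOn (fderiv ℝ f) C := fun x hx =>
    ((hf x hx).continuousAt_fderiv one_ne_zero).continuousWithinAt
  obtain ⟨L, hL⟩ := hC.exists_bound_of_continuousOn hc
  refine ⟨max L 1, by positivity, fun x hx y hy => ?_⟩
  have hxρ : 0 ≤ ρ := (norm_nonneg _).trans hy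
  refine (convex_closedBall x ρ).norm_image_sub_le_of_norm_fderiv_le
    (fun z hz => (hf z (hx hz)).differentiableAt one_ne_zero)
    (fun z hz => (hL z (hx hz)).trans (le_max_left _ _)) (Metric.mem_closedBall_self hxρ) ?_
  rwa [mem_closedBall_iff_norm, norm_sub_rev]

namespace LQRSystem

variable {m n : ℕ} {S : LQRSystem m n}

lemma Admissible.isCompact_boundedSet (hS : S.Admissible) (K₀ Kstar : Policy m n) :
    IsCompact (S.boundedSet K₀ Kstar) := by
  have : S.boundedSet K₀ Kstar =
      {K | K ∈ S.dom ∧ S.realCost K ≤ 10 * S.gap K₀ Kstar + S.realCost Kstar} := by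
    ext K; simp only [boundedSet, Set.mem_ofPred_eq, sub_le_iff_le_add]
  rw [this]
  exact hS.isCompact_sublevel _

lemma Admissible.contDiffAt_gradient (hS : S.Admissible) {K : Policy m n} (hK : K ∈ S.dom) :
    ContDiffAt ℝ 1 (gradient S.realCost) K := by
  have h : ContDiffAt ℝ 1 (fderiv ℝ S.realCost) K :=
    (hS.contDiffAt_realCost hK (k := 2)).fderiv_right (by norm_num)
  exact (InnerProductSpace.toDual ℝ (Policy m n)).symm.contDiff.contDiffAt.comp K h

/-- The compact bounded set has a closed thickening inside the open domain. Its width is `ρ`, and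
the bounds there for the derivatives of the cost and of its gradient are `lam` and `φ`. -/
lemma Admissible.exists_curvatureParams (hS : S.Admissible) {K₀ Kstar : Policy m n}
    (h : S.IsOptimal Kstar) (hd : Kstar ∈ S.dom) :
    ∃ φ lam ρ μ : ℝ, S.CurvatureParams K₀ Kstar φ lam ρ μ := by
  have hG := hS.isCompact_boundedSet K₀ Kstar
  obtain ⟨ρ, hρ, hsub⟩ := hG.exists_cthickening_subset_open hS.isOpen_dom fun K hK => hK.1
  have hC : IsCompact (Metric.cthickening ρ (S.boundedSet K₀ Kstar)) := hG.cthickening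
  obtain ⟨lam, hlam, h1⟩ := exists_lipschitz_on_balls hC
    (fun K hK => hS.contDiffAt_realCost (hsub hK)) ρ
  obtain ⟨φ, hφ, h2⟩ := exists_lipschitz_on_balls hC
    (fun K hK => hS.contDiffAt_gradient (hsub hK)) ρ
  obtain ⟨μ, hμ⟩ := hS.exists_isPL h hd
  have hb : ∀ K ∈ S.boundedSet K₀ Kstar, Metric.closedBall K ρ ⊆
      Metric.cthickening ρ (S.boundedSet K₀ Kstar) := fun K hK =>
    Metric.closedBall_subset_cthickening hK ρ
  exact ⟨φ, lam, ρ, μ, hφ, hlam, hρ,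
    fun K hK => ⟨hS.contDiffOn_realCost, fun y _ hy => h2 K (hb K hK) y hy⟩,
    fun K hK => ⟨hS.contDiffOn_realCost, fun y _ hy => h1 K (hb K hK) y hy⟩, hμ⟩

end LQRSystem
end ZeroOrderLQR

namespace ZeroOrderLQR

/-! ### Positive semidefinite matrices and the trace -/

section PosSemidef

variable {a : ℕ} {P : Matrix (Fin a) (Fin a) ℝ}

lemma PosSemidef.quadratic_nonneg (hP : P.PosSemidef) (v : Fin a → ℝ) :
    0 ≤ v ⬝ᵥ (P *ᵥ v) := by
  simpa using hP.dotProduct_mulVec_nonneg v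

lemma PosSemidef.dotProduct_mulVec_sq_le (hP : P.PosSemidef) (u v : Fin a → ℝ) :
    (u ⬝ᵥ (P *ᵥ v)) ^ 2 ≤ (u ⬝ᵥ (P *ᵥ u)) * (v ⬝ᵥ (P *ᵥ v)) := by
  have hT : Pᵀ = P := by simpa using hP.isHermitian.eq
  have hsymm : v ⬝ᵥ (P *ᵥ u) = u ⬝ᵥ (P *ᵥ v) := by
    rw [Matrix.dotProduct_mulVec, dotProduct_comm, ← Matrix.mulVec_transpose, hT]
  have h : ∀ t : ℝ, 0 ≤ (v ⬝ᵥ (P *ᵥ v)) * (t * t) + (2 * (u ⬝ᵥ (P *ᵥ v))) * t +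
      u ⬝ᵥ (P *ᵥ u) := by
    intro t
    have := PosSemidef.quadratic_nonneg hP (u + t • v)
    simp only [Matrix.mulVec_add, Matrix.mulVec_smul, dotProduct_add, add_dotProduct,
      dotProduct_smul, smul_dotProduct, smul_eq_mul, hsymm] at this
    linarith
  have := discrim_le_zero h
  rw [discrim] at this
  linarith

/-- Cauchy-Schwarz for the form of `P` against the basis vectors bounds `(P v)_i²` by `P_ii · vᵀPv`;
the diagonal entries sum to the trace. -/
lemma PosSemidef.mulVec_dotProduct_self_le (hP : P.PosSemidef) (v : Fin a → ℝ) :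
    (P *ᵥ v) ⬝ᵥ (P *ᵥ v) ≤ P.trace * (v ⬝ᵥ (P *ᵥ v)) := by
  rw [Matrix.trace, Finset.sum_mul]
  refine Finset.sum_le_sum fun i _ => ?_
  have := PosSemidef.dotProduct_mulVec_sq_le hP (Pi.single i 1) v
  simpa [sq] using this

lemma PosSemidef.quadratic_le_trace_mul (hP : P.PosSemidef) (v : Fin a → ℝ) :
    v ⬝ᵥ (P *ᵥ v) ≤ P.trace * (v ⬝ᵥ v) := by
  rcases (PosSemidef.quadratic_nonneg hP v).eq_or_lt with h | h
  · rw [← h]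
    exact mul_nonneg hP.trace_nonneg (dotProduct_self_nonneg' v)
  · refine le_of_mul_le_mul_right ?_ h
    have h1 := dotProduct_sq_le v (P *ᵥ v)
    have h2 := mul_le_mul_of_nonneg_left (PosSemidef.mulVec_dotProduct_self_le hP v)
      (dotProduct_self_nonneg' v)
    linarith

end PosSemidef

namespace LQRSystem

/-! ### Second moment of the sample cost -/

variable {m n : ℕ} (S : LQRSystem m n)

/-- The sample cost of the first `T` steps. -/
def partialCost (K : Policy m n) (z : ℕ → Fin m → ℝ) (T : ℕ) : ℝ :=
  ∑ t ∈ Finset.range T, S.γ ^ t * (S.state K z t ⬝ᵥ (S.costMat K *ᵥ S.state K z t))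

/-- The martingale part of the accumulated value along a trajectory. -/
noncomputable def crossSum (K : Policy m n) (z : ℕ → Fin m → ℝ) (T : ℕ) : ℝ :=
  ∑ t ∈ Finset.range T, 2 * S.γ ^ (t + 1) *
    (((S.valueMat K *ᵥ (S.closedLoop K *ᵥ S.state K z t))) ⬝ᵥ z t)

/-- The accumulated value of the noise vectors. -/
noncomputable def noiseSum (K : Policy m n) (z : ℕ → Fin m → ℝ) (T : ℕ) : ℝ :=
  ∑ t ∈ Finset.range T, S.γ ^ (t + 1) * (z t ⬝ᵥ (S.valueMat K *ᵥ z t))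

variable {S}

lemma Admissible.quadratic_closedLoop (hS : S.Admissible) {K : Policy m n} (hK : K ∈ S.dom)
    (s : Fin m → ℝ) :
    S.γ * ((S.closedLoop K *ᵥ s) ⬝ᵥ (S.valueMat K *ᵥ (S.closedLoop K *ᵥ s))) =
      s ⬝ᵥ (S.valueMat K *ᵥ s) - s ⬝ᵥ (S.costMat K *ᵥ s) := by
  rw [← hS.valueMat_sub hK, Matrix.sub_mulVec, dotProduct_sub, Matrix.smul_mulVec,
    dotProduct_smul, ← quadratic_mulVec, smul_eq_mul]
  ring

/-- The form `sᵀPs` is a potential: by the Stein equation its discounted value drops by exactly the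
stage cost, while fresh noise adds its own potential and a cross term of mean zero. -/
lemma Admissible.partialCost_add_value (hS : S.Admissible) {K : Policy m n} (hK : K ∈ S.dom)
    (z : ℕ → Fin m → ℝ) (T : ℕ) :
    S.partialCost K z T + S.γ ^ T * (S.state K z T ⬝ᵥ (S.valueMat K *ᵥ S.state K z T)) =
      S.noiseSum K z T + S.crossSum K z T := by
  induction T with
  | zero => simp [partialCost, noiseSum, crossSum, state]
  | succ T ih =>
    have h := hS.quadratic_closedLoop hK (S.state K z T)
    simp only [partialCost, noiseSum, crossSum, Finset.sum_range_succ] at ih ⊢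
    rw [state_succ, quadratic_add, hS.valueMat_transpose hK, Matrix.add_mulVec, add_dotProduct]
    linear_combination ih + S.γ ^ T * h

lemma sum_pow_succ_le {γ : ℝ} (h0 : 0 ≤ γ) (h1 : γ < 1) (T : ℕ) :
    ∑ t ∈ Finset.range T, γ ^ (t + 1) ≤ γ / (1 - γ) := by
  have := (summable_geometric_of_lt_one h0 h1).sum_le_tsum (Finset.range T)
    fun i _ => pow_nonneg h0 i
  rw [tsum_geometric_of_lt_one h0 h1] at this
  simp only [pow_succ', ← Finset.mul_sum]
  rw [div_eq_mul_inv]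
  exact mul_le_mul_of_nonneg_left this h0

lemma Admissible.natCast_le_Cm (hS : S.Admissible) : (m : ℝ) ≤ S.Cm := by
  have := hS.isProbabilityMeasure_noiseSeq
  have h := hS.integral_noise_quadratic 0 1
  simp only [Matrix.one_mulVec, Matrix.trace_one, Fintype.card_fin] at h
  rw [← h]
  have hi : Integrable (fun z : ℕ → Fin m → ℝ => z 0 ⬝ᵥ z 0) S.noiseSeq :=
    (memLp_top_dotProduct (hS.memLp_noise 0) (hS.memLp_noise 0)).integrable le_top
  calc ∫ z : ℕ → Fin m → ℝ, z 0 ⬝ᵥ z 0 ∂S.noiseSeq ≤ ∫ _, S.Cm ∂S.noiseSeq :=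
        integral_mono_ae hi (integrable_const _) (hS.ae_noise_bdd 0)
    _ = S.Cm := by simp

lemma Admissible.noiseSum_le (hS : S.Admissible) {K : Policy m n} (hK : K ∈ S.dom)
    {z : ℕ → Fin m → ℝ} (hz : ∀ t, z t ⬝ᵥ z t ≤ S.Cm) (T : ℕ) :
    S.noiseSum K z T ≤ S.Cm * S.realCost K := by
  have hP := hS.valueMat_posSemidef hK
  have hC : 0 ≤ S.Cm := (Nat.cast_nonneg m).trans hS.natCast_le_Cm
  have h1 : ∀ t, z t ⬝ᵥ (S.valueMat K *ᵥ z t) ≤ (S.valueMat K).trace * S.Cm := fun t =>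
    (PosSemidef.quadratic_le_trace_mul hP _).trans
      (mul_le_mul_of_nonneg_left (hz t) hP.trace_nonneg)
  calc S.noiseSum K z T
      ≤ ∑ t ∈ Finset.range T, S.γ ^ (t + 1) * ((S.valueMat K).trace * S.Cm) :=
        Finset.sum_le_sum fun t _ =>
          mul_le_mul_of_nonneg_left (h1 t) (pow_nonneg hS.discount_pos.le _)
    _ ≤ S.γ / (1 - S.γ) * ((S.valueMat K).trace * S.Cm) := by
        rw [← Finset.sum_mul]
        exact mul_le_mul_of_nonneg_right (sum_pow_succ_le hS.discount_pos.le hS.discount_lt_one T)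
          (mul_nonneg hP.trace_nonneg hC)
    _ = S.Cm * S.realCost K := by rw [hS.realCost_eq_trace hK]; ring

lemma Admissible.discounted_value_le (hS : S.Admissible) {K : Policy m n} (hK : K ∈ S.dom)
    (t : ℕ) :
    S.γ ^ t * ∫ z, S.state K z t ⬝ᵥ (S.valueMat K *ᵥ S.state K z t) ∂S.noiseSeq ≤
      S.realCost K := by
  have := hS.isProbabilityMeasure_noiseSeq
  have hP := hS.valueMat_posSemidef hK
  suffices h : S.γ ^ t * ∫ z, S.state K z t ⬝ᵥ (S.valueMat K *ᵥ S.state K z t) ∂S.noiseSeq ≤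
      (∑ k ∈ Finset.range t, S.γ ^ (k + 1)) * (S.valueMat K).trace by
    rw [hS.realCost_eq_trace hK]
    exact h.trans (mul_le_mul_of_nonneg_right
      (sum_pow_succ_le hS.discount_pos.le hS.discount_lt_one t) hP.trace_nonneg)
  induction t with
  | zero => simp [state]
  | succ t ih =>
    have h1 : S.γ * ∫ z, S.state K z t ⬝ᵥ (((S.closedLoop K)ᵀ * S.valueMat K * S.closedLoop K) *ᵥ
        S.state K z t) ∂S.noiseSeq ≤
        ∫ z, S.state K z t ⬝ᵥ (S.valueMat K *ᵥ S.state K z t) ∂S.noiseSeq := by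
      rw [← integral_const_mul]
      refine integral_mono (((hS.memLp_quadratic K t _).integrable le_top).const_mul _)
        ((hS.memLp_quadratic K t _).integrable le_top) fun z => ?_
      simp only [← quadratic_mulVec]
      rw [hS.quadratic_closedLoop hK]
      linarith [hS.quadratic_costMat_nonneg K (S.state K z t)]
    have h2 := mul_le_mul_of_nonneg_left h1 (pow_nonneg hS.discount_pos.le t)
    rw [hS.integral_state_succ_quadratic, Finset.sum_range_succ, add_mul, mul_add, pow_succ]
    linarith

lemma measurable_crossSum (K : Policy m n) (T : ℕ) : Measurable fun z => S.crossSum K z T :=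
  Finset.measurable_sum _ fun t _ => (measurable_dotProduct (measurable_mulVec _
    (measurable_mulVec _ (S.measurable_state_right K t))) (measurable_pi_apply t)).const_mul _

lemma crossSum_update (K : Policy m n) (z : ℕ → Fin m → ℝ) (T : ℕ) (v : Fin m → ℝ) :
    S.crossSum K (Function.update z T v) T = S.crossSum K z T := by
  refine Finset.sum_congr rfl fun t ht => ?_
  have := Finset.mem_range.1 ht
  rw [S.state_update K z this.le, Function.update_of_ne this.ne]

lemma Admissible.memLp_crossSum (hS : S.Admissible) (K : Policy m n) (T : ℕ) :
    MemLp (fun z => S.crossSum K z T) ⊤ S.noiseSeq :=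
  memLp_finsetSum _ fun t _ => (memLp_top_dotProduct (memLp_top_mulVec _
    (memLp_top_mulVec _ (hS.memLp_state K t))) (hS.memLp_noise t)).const_mul _

/-- Martingale increments are orthogonal, so second moments add. With `F = P M s` the increment at
time `t` contributes `4 γ^(2t+2) E|F|²`, and `|P x|² ≤ tr P · xᵀPx` gives `γ^(t+1) E|F|² ≤ tr P ·
C(K)`. The geometric sum makes this `4 γ/(1-γ) tr P · C(K) = 4 C(K)²`. -/
lemma Admissible.integral_crossSum_sq_le (hS : S.Admissible) {K : Policy m n} (hK : K ∈ S.dom)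
    (T : ℕ) : ∫ z, S.crossSum K z T ^ 2 ∂S.noiseSeq ≤ 4 * S.realCost K ^ 2 := by
  have := hS.isProbabilityMeasure_noiseSeq
  have hP := hS.valueMat_posSemidef hK
  have hγ := hS.discount_pos
  have hc : 0 ≤ S.realCost K := ENNReal.toReal_nonneg
  suffices h : ∫ z, S.crossSum K z T ^ 2 ∂S.noiseSeq ≤
      (∑ k ∈ Finset.range T, S.γ ^ (k + 1)) * (4 * (S.valueMat K).trace * S.realCost K) by
    calc _ ≤ _ := h
      _ ≤ S.γ / (1 - S.γ) * (4 * (S.valueMat K).trace * S.realCost K) :=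
          mul_le_mul_of_nonneg_right (sum_pow_succ_le hγ.le hS.discount_lt_one T)
            (mul_nonneg (mul_nonneg zero_le_four hP.trace_nonneg) hc)
      _ = 4 * S.realCost K ^ 2 := by
          conv_rhs => rw [sq]
          nth_rw 2 [hS.realCost_eq_trace hK]
          ring
  induction T with
  | zero => simp [crossSum]
  | succ T ih =>
    set F : (ℕ → Fin m → ℝ) → Fin m → ℝ := fun z =>
      S.valueMat K *ᵥ (S.closedLoop K *ᵥ S.state K z T) with hF
    have hFm : Measurable F :=
      measurable_mulVec _ (measurable_mulVec _ (S.measurable_state_right K T))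
    have hFb : ∀ i, MemLp (fun z => F z i) ⊤ S.noiseSeq :=
      memLp_top_mulVec _ (memLp_top_mulVec _ (hS.memLp_state K T))
    have hFk : ∀ z v, F (Function.update z T v) = F z := fun z v => by
      simp only [hF, S.state_update K z le_rfl]
    have hd : MemLp (fun z => F z ⬝ᵥ z T) ⊤ S.noiseSeq :=
      memLp_top_dotProduct hFb (hS.memLp_noise T)
    have hN := hS.memLp_crossSum K T
    have hcross : ∫ z, S.crossSum K z T * (F z ⬝ᵥ z T) ∂S.noiseSeq = 0 := by
      have := hS.integral_dotProduct_noise (k := T) (F := fun z => S.crossSum K z T • F z)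
        ((measurable_crossSum K T).smul hFm) (fun i => memLp_top_mul hN (hFb i))
        (fun z v => by rw [crossSum_update, hFk])
      simpa only [smul_dotProduct, smul_eq_mul] using this
    have hexp : ∀ z, S.crossSum K z (T + 1) ^ 2 = S.crossSum K z T ^ 2 +
        (4 * S.γ ^ (T + 1) * (S.crossSum K z T * (F z ⬝ᵥ z T)) +
          4 * S.γ ^ (2 * T + 2) * (F z ⬝ᵥ z T) ^ 2) := fun z => by
      have : S.crossSum K z (T + 1) = S.crossSum K z T + 2 * S.γ ^ (T + 1) * (F z ⬝ᵥ z T) :=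
        Finset.sum_range_succ _ _
      rw [this]; ring
    have i1 : Integrable (fun z => S.crossSum K z T ^ 2) S.noiseSeq := by
      simpa only [sq] using (memLp_top_mul hN hN).integrable le_top
    have i2 : Integrable (fun z => 4 * S.γ ^ (T + 1) * (S.crossSum K z T * (F z ⬝ᵥ z T)))
      S.noiseSeq := ((memLp_top_mul hN hd).integrable le_top).const_mul _
    have i3 : Integrable (fun z => 4 * S.γ ^ (2 * T + 2) * (F z ⬝ᵥ z T) ^ 2) S.noiseSeq := by
      simpa only [sq] using ((memLp_top_mul hd hd).integrable le_top).const_mul _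
    have hsq : S.γ ^ (T + 1) * ∫ z, F z ⬝ᵥ F z ∂S.noiseSeq ≤
        (S.valueMat K).trace * S.realCost K := by
      have h1 : S.γ * ∫ z, F z ⬝ᵥ F z ∂S.noiseSeq ≤ (S.valueMat K).trace *
          ∫ z, S.state K z T ⬝ᵥ (S.valueMat K *ᵥ S.state K z T) ∂S.noiseSeq := by
        rw [← integral_const_mul, ← integral_const_mul]
        refine integral_mono (((memLp_top_dotProduct hFb hFb).integrable le_top).const_mul _)
          (((hS.memLp_quadratic K T _).integrable le_top).const_mul _) fun z => ?_
        have h2 := PosSemidef.mulVec_dotProduct_self_le hP (S.closedLoop K *ᵥ S.state K z T)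
        have h3 := hS.quadratic_closedLoop hK (S.state K z T)
        have h4 := hS.quadratic_costMat_nonneg K (S.state K z T)
        have h5 := hP.trace_nonneg
        calc S.γ * (F z ⬝ᵥ F z) ≤ S.γ * _ := mul_le_mul_of_nonneg_left h2 hγ.le
          _ = (S.valueMat K).trace * (S.γ * _) := by rw [mul_left_comm]
          _ ≤ _ := mul_le_mul_of_nonneg_left (h3.trans_le (by linarith)) h5
      calc _ = S.γ ^ T * (S.γ * ∫ z, F z ⬝ᵥ F z ∂S.noiseSeq) := by ring
        _ ≤ S.γ ^ T * _ := mul_le_mul_of_nonneg_left h1 (pow_nonneg hγ.le T)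
        _ = (S.valueMat K).trace * (S.γ ^ T * _) := by rw [mul_left_comm]
        _ ≤ _ := mul_le_mul_of_nonneg_left (hS.discounted_value_le hK T) hP.trace_nonneg
    simp only [hexp]
    rw [integral_add i1 (by exact i2.add i3), integral_add i2 i3, integral_const_mul,
      integral_const_mul, hcross, hS.integral_dotProduct_noise_sq hFm hFb hFk,
      Finset.sum_range_succ, add_mul]
    have h6 := mul_le_mul_of_nonneg_left hsq
      (mul_nonneg zero_le_four (pow_nonneg hγ.le (T + 1)))
    have h7 : 4 * S.γ ^ (2 * T + 2) * ∫ z, F z ⬝ᵥ F z ∂S.noiseSeq =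
        4 * S.γ ^ (T + 1) * (S.γ ^ (T + 1) * ∫ z, F z ⬝ᵥ F z ∂S.noiseSeq) := by ring
    linarith

lemma Admissible.partialCost_nonneg (hS : S.Admissible) (K : Policy m n) (z : ℕ → Fin m → ℝ)
    (T : ℕ) : 0 ≤ S.partialCost K z T :=
  Finset.sum_nonneg fun _ _ =>
    mul_nonneg (pow_nonneg hS.discount_pos.le _) (hS.quadratic_costMat_nonneg K _)

lemma Admissible.ofReal_partialCost (hS : S.Admissible) (K : Policy m n) (z : ℕ → Fin m → ℝ)
    (T : ℕ) : ENNReal.ofReal (S.partialCost K z T) = ∑ t ∈ Finset.range T, ENNReal.ofReal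
      (S.γ ^ t * S.stageCost (S.state K z t) (control K (S.state K z t))) := by
  simp only [stageCost_control]
  exact ENNReal.ofReal_sum_of_nonneg fun _ _ =>
    mul_nonneg (pow_nonneg hS.discount_pos.le _) (hS.quadratic_costMat_nonneg K _)

lemma Admissible.lintegral_partialCost_sq_le [NeZero m] (hS : S.Admissible) {K : Policy m n}
    (hK : K ∈ S.dom) (T : ℕ) : ∫⁻ z, ENNReal.ofReal (S.partialCost K z T) ^ 2 ∂S.noiseSeq ≤
      ENNReal.ofReal (10 * S.Cm ^ 2 * S.realCost K ^ 2) := by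
  have := hS.isProbabilityMeasure_noiseSeq
  have hc : 0 ≤ S.realCost K := ENNReal.toReal_nonneg
  have hm : (1 : ℝ) ≤ S.Cm :=
    le_trans (by exact_mod_cast NeZero.one_le) hS.natCast_le_Cm
  have hN := hS.memLp_crossSum K T
  have i1 : Integrable (fun z => S.crossSum K z T ^ 2) S.noiseSeq := by
    simpa only [sq] using (memLp_top_mul hN hN).integrable le_top
  calc ∫⁻ z, ENNReal.ofReal (S.partialCost K z T) ^ 2 ∂S.noiseSeq
      ≤ ∫⁻ z, ENNReal.ofReal (2 * (S.Cm * S.realCost K) ^ 2 + 2 * S.crossSum K z T ^ 2)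
          ∂S.noiseSeq := by
        refine lintegral_mono_ae ?_
        filter_upwards [ae_all_iff.2 hS.ae_noise_bdd] with z hz
        rw [← ENNReal.ofReal_pow (hS.partialCost_nonneg K z T)]
        refine ENNReal.ofReal_le_ofReal ?_
        have h1 := hS.partialCost_add_value hK z T
        have h2 := hS.noiseSum_le hK hz T
        have h3 := mul_nonneg (pow_nonneg hS.discount_pos.le T)
          (hS.quadratic_valueMat_nonneg hK (S.state K z T))
        have h4 := hS.partialCost_nonneg K z T
        calc S.partialCost K z T ^ 2 ≤ (S.Cm * S.realCost K + S.crossSum K z T) ^ 2 :=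
              pow_le_pow_left₀ h4 (by linarith) 2
          _ ≤ _ := by nlinarith [sq_nonneg (S.Cm * S.realCost K - S.crossSum K z T)]
    _ = ENNReal.ofReal (∫ z, (2 * (S.Cm * S.realCost K) ^ 2 + 2 * S.crossSum K z T ^ 2)
          ∂S.noiseSeq) := by
        exact (ofReal_integral_eq_lintegral_ofReal ((integrable_const _).add (i1.const_mul _))
          (.of_forall fun z => by
            change 0 ≤ 2 * (S.Cm * S.realCost K) ^ 2 + 2 * S.crossSum K z T ^ 2
            positivity)).symm
    _ ≤ _ := by
        refine ENNReal.ofReal_le_ofReal ?_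
        rw [integral_add (integrable_const _) (i1.const_mul _), integral_const,
          integral_const_mul, probReal_univ, one_smul]
        -- The constant is `10 = 2 + 2 · 4`: the twos from `(x + y)² ≤ 2x² + 2y²`, the four from the
        -- martingale, with `1 ≤ S.Cm` absorbing the difference.
        have h1 := hS.integral_crossSum_sq_le hK T
        have h2 : S.realCost K ^ 2 ≤ S.Cm ^ 2 * S.realCost K ^ 2 :=
          le_mul_of_one_le_left (sq_nonneg _) (one_le_pow₀ hm)
        nlinarith

/-- Fatou's lemma applied to the truncated costs, whose second moments are bounded uniformly in the
horizon. -/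
lemma Admissible.lintegral_sampleCost_sq_le [NeZero m] (hS : S.Admissible) {K : Policy m n}
    (hK : K ∈ S.dom) : ∫⁻ z, S.sampleCost K z ^ 2 ∂S.noiseSeq ≤
      ENNReal.ofReal (10 * S.Cm ^ 2 * S.realCost K ^ 2) := by
  have hlim : ∀ z, Filter.Tendsto (fun T => ENNReal.ofReal (S.partialCost K z T) ^ 2)
      Filter.atTop (nhds (S.sampleCost K z ^ 2)) := fun z => by
    simp only [hS.ofReal_partialCost]
    exact ((ENNReal.continuous_pow 2).tendsto _).comp (ENNReal.tendsto_nat_tsum _)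
  have hmeas : ∀ T, Measurable fun z => ENNReal.ofReal (S.partialCost K z T) ^ 2 := fun T =>
    (ENNReal.measurable_ofReal.comp (Finset.measurable_sum _ fun t _ =>
      (measurable_dotProduct (S.measurable_state_right K t)
        (measurable_mulVec _ (S.measurable_state_right K t))).const_mul _)).pow_const 2
  calc ∫⁻ z, S.sampleCost K z ^ 2 ∂S.noiseSeq
      = ∫⁻ z, Filter.liminf (fun T => ENNReal.ofReal (S.partialCost K z T) ^ 2) Filter.atTop
          ∂S.noiseSeq := lintegral_congr fun z => (hlim z).liminf_eq.symm
    _ ≤ Filter.liminf (fun T => ∫⁻ z, ENNReal.ofReal (S.partialCost K z T) ^ 2 ∂S.noiseSeq)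
          Filter.atTop := lintegral_liminf_le hmeas
    _ ≤ _ := Filter.liminf_le_of_frequently_le' (Filter.Frequently.of_forall fun T =>
          hS.lintegral_partialCost_sq_le hK T)

/-! ### Comparison with the constant `G₂` -/

lemma opNorm_mulVec_le {k : ℕ} (W : Matrix (Fin k) (Fin k) ℝ) (v : EuclideanSpace ℝ (Fin k)) :
    ‖Matrix.toEuclideanCLM (n := Fin k) (𝕜 := ℝ) W v‖ ≤ opNorm W * ‖v‖ :=
  ContinuousLinearMap.le_opNorm _ _

lemma sigmaMin_le {k : ℕ} (W : Matrix (Fin k) (Fin k) ℝ)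
    (v : Metric.sphere (0 : EuclideanSpace ℝ (Fin k)) 1) :
    sigmaMin W ≤ ‖Matrix.toEuclideanCLM (n := Fin k) (𝕜 := ℝ) W v‖ :=
  ciInf_le ⟨0, by rintro _ ⟨v, rfl⟩; exact norm_nonneg _⟩ v

lemma euclidean_norm_sq {k : ℕ} (x : EuclideanSpace ℝ (Fin k)) :
    ‖x‖ ^ 2 = (x : Fin k → ℝ) ⬝ᵥ (x : Fin k → ℝ) := by
  rw [EuclideanSpace.real_norm_sq_eq]
  simp [dotProduct, sq]

lemma toEuclideanCLM_norm_sq {k : ℕ} (W : Matrix (Fin k) (Fin k) ℝ)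
    (x : EuclideanSpace ℝ (Fin k)) :
    ‖Matrix.toEuclideanCLM (n := Fin k) (𝕜 := ℝ) W x‖ ^ 2 =
      (W *ᵥ (x : Fin k → ℝ)) ⬝ᵥ (W *ᵥ (x : Fin k → ℝ)) := by
  rw [euclidean_norm_sq, Matrix.ofLp_toEuclideanCLM]

lemma exists_unit_euclidean (k : ℕ) [NeZero k] :
    Nonempty (Metric.sphere (0 : EuclideanSpace ℝ (Fin k)) 1) :=
  ⟨⟨EuclideanSpace.single 0 1, by simp⟩⟩

lemma sigmaMin_pos {k : ℕ} [NeZero k] {W : Matrix (Fin k) (Fin k) ℝ} (hW : W.PosDef) :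
    0 < sigmaMin W := by
  obtain ⟨c, hc, h⟩ := exists_pos_le_quadratic hW
  have := exists_unit_euclidean k
  refine hc.trans_le (le_ciInf fun v => ?_)
  have hv : ((v : EuclideanSpace ℝ (Fin k)) : Fin k → ℝ) ⬝ᵥ
      ((v : EuclideanSpace ℝ (Fin k)) : Fin k → ℝ) = 1 := by
    rw [← euclidean_norm_sq]; simp
  have h1 := h ((v : EuclideanSpace ℝ (Fin k)) : Fin k → ℝ)
  have h2 := dotProduct_sq_le ((v : EuclideanSpace ℝ (Fin k)) : Fin k → ℝ)
    (W *ᵥ ((v : EuclideanSpace ℝ (Fin k)) : Fin k → ℝ))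
  rw [hv, one_mul, ← toEuclideanCLM_norm_sq] at h2
  rw [hv, mul_one] at h1
  exact h1.trans (le_trans (le_abs_self _) (abs_le_of_sq_le_sq h2 (norm_nonneg _)))

lemma sigmaMin_le_opNorm {k : ℕ} [NeZero k] (W : Matrix (Fin k) (Fin k) ℝ) :
    sigmaMin W ≤ opNorm W := by
  obtain ⟨v⟩ := exists_unit_euclidean k
  refine (sigmaMin_le W v).trans ((opNorm_mulVec_le W v).trans (le_of_eq ?_))
  simp

lemma sigmaMin_le_trace {k : ℕ} [NeZero k] {W : Matrix (Fin k) (Fin k) ℝ} (hW : W.PosSemidef) :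
    sigmaMin W ≤ W.trace := by
  obtain ⟨v⟩ := exists_unit_euclidean k
  have hv : ((v : EuclideanSpace ℝ (Fin k)) : Fin k → ℝ) ⬝ᵥ
      ((v : EuclideanSpace ℝ (Fin k)) : Fin k → ℝ) = 1 := by
    rw [← euclidean_norm_sq]; simp
  refine (sigmaMin_le W v).trans (le_of_sq_le_sq ?_ hW.trace_nonneg)
  rw [toEuclideanCLM_norm_sq]
  calc _ ≤ _ := PosSemidef.mulVec_dotProduct_self_le hW _
    _ ≤ W.trace * (W.trace * _) :=
        mul_le_mul_of_nonneg_left (PosSemidef.quadratic_le_trace_mul hW _) hW.trace_nonneg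
    _ = W.trace ^ 2 := by rw [hv]; ring

lemma Admissible.sigmaMin_le_realCost (hS : S.Admissible) [NeZero m] {K : Policy m n}
    (hK : K ∈ S.dom) : sigmaMin S.Q ≤ S.realCost K * ((1 - S.γ) / S.γ) := by
  have hγ := hS.discount_pos
  have hγ1 : 0 < 1 - S.γ := by linarith [hS.discount_lt_one]
  have h1 : S.realCost K * ((1 - S.γ) / S.γ) = (S.valueMat K).trace := by
    rw [hS.realCost_eq_trace hK]; field_simp
  rw [h1]
  have h2 := le_hasSum (hS.hasSum_impulseCost hK) 0 fun i _ =>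
    mul_nonneg (pow_nonneg hγ.le i) (hS.impulseCost_nonneg K i)
  refine (sigmaMin_le_trace hS.posDef_Q.posSemidef).trans (le_trans ?_ h2)
  have h3 : 0 ≤ (K.matᵀ * S.R * K.mat).trace := by
    simpa using (hS.posDef_R.posSemidef.conjTranspose_mul_mul_same K.mat).trace_nonneg
  simpa [impulseCost, costMat, Matrix.trace_add] using h3

lemma Admissible.one_le_Cm [NeZero m] (hS : S.Admissible) : 1 ≤ S.Cm :=
  le_trans (by exact_mod_cast NeZero.one_le) hS.natCast_le_Cm

lemma Admissible.realCost_pos [NeZero m] (hS : S.Admissible) {K : Policy m n} (hK : K ∈ S.dom) :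
    0 < S.realCost K := by
  have h := (sigmaMin_pos hS.posDef_Q).trans_le (hS.sigmaMin_le_realCost hK)
  have hγ1 : 0 < (1 - S.γ) / S.γ :=
    div_pos (by linarith [hS.discount_lt_one]) hS.discount_pos
  exact pos_of_mul_pos_left h hγ1.le

/-- Write `G2 = (D/r)² (H Y)² Y` with `Y = 20 C(K₀)/σ · (1-γ)/γ`. Then `σ ≤ C(K₀) (1-γ)/γ` gives `Y
≥ 20`, while `σ ≤ ‖Q‖`, `γ ≤ √γ` and `1-γ ≤ (1-γ)/γ` give `H Y ≥ 40 Cm C(K₀)`; and `32000 = 40² ·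
20`. -/
lemma Admissible.le_G2 [NeZero m] (hS : S.Admissible) {K₀ : Policy m n} (hK₀ : K₀ ∈ S.dom)
    (lam r : ℝ) :
    32000 * (((m * n : ℕ) : ℝ) / r * (S.Cm * S.realCost K₀)) ^ 2 ≤ S.G2 K₀ lam r := by
  have hγ := hS.discount_pos
  have hγ1 : 0 < 1 - S.γ := by linarith [hS.discount_lt_one]
  have hσ := sigmaMin_pos hS.posDef_Q
  have hC := hS.one_le_Cm
  have hc := hS.realCost_pos hK₀
  set σ := sigmaMin S.Q
  set c := S.realCost K₀
  set w := (1 - S.γ) / S.γ with hw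
  have hw1 : 1 - S.γ ≤ w := by
    rw [hw, le_div_iff₀ hγ]; nlinarith [hS.discount_lt_one]
  have hw0 : 0 < w := hγ1.trans_le hw1
  have hs1 : Real.sqrt S.γ < 1 := by
    rw [Real.sqrt_lt' one_pos]; linarith
  have hs2 : S.γ ≤ Real.sqrt S.γ := Real.le_sqrt_of_sq_le (by nlinarith)
  have hY : 20 ≤ 20 * c / σ * w := by
    have h1 : σ ≤ c * w := hS.sigmaMin_le_realCost hK₀
    rw [div_mul_eq_mul_div, le_div_iff₀ hσ]; linarith
  have hR : 0 ≤ opNorm S.R * lam ^ 2 := mul_nonneg (norm_nonneg _) (sq_nonneg _)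
  have hQ : σ ≤ opNorm S.Q := sigmaMin_le_opNorm S.Q
  have hH : 2 * σ * S.Cm / (1 - S.γ) ≤
      2 * (opNorm S.Q + opNorm S.R * lam ^ 2) * S.Cm / (1 - Real.sqrt S.γ) := by
    have : 0 < opNorm S.Q := hσ.trans_le hQ
    have : 0 ≤ 2 * (opNorm S.Q + opNorm S.R * lam ^ 2) * S.Cm := by positivity
    gcongr
    linarith
  set H := 2 * (opNorm S.Q + opNorm S.R * lam ^ 2) * S.Cm / (1 - Real.sqrt S.γ)
  have hH0 : 0 ≤ H := le_trans (by positivity) hH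
  have hHY : 40 * (S.Cm * c) ≤ H * (20 * c / σ * w) := by
    calc 40 * (S.Cm * c) = 2 * σ * S.Cm / (1 - S.γ) * (20 * c / σ * (1 - S.γ)) := by
          field_simp; norm_num
      _ ≤ H * (20 * c / σ * w) := by gcongr
  set Y := 20 * c / σ * w
  have hD : 0 ≤ (((m * n : ℕ) : ℝ) / r) ^ 2 := sq_nonneg _
  have e1 : S.G2 K₀ lam r = (((m * n : ℕ) : ℝ) / r) ^ 2 * ((H * Y) ^ 2 * Y) := by
    change (((m * n : ℕ) : ℝ) / r * H) ^ 2 * Y ^ 3 = _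
    ring
  have e2 : (40 * (S.Cm * c)) ^ 2 * 20 ≤ (H * Y) ^ 2 * Y := by gcongr
  rw [e1, mul_pow]
  calc _ = (((m * n : ℕ) : ℝ) / r) ^ 2 * ((40 * (S.Cm * c)) ^ 2 * 20) := by ring
    _ ≤ _ := mul_le_mul_of_nonneg_left e2 hD

end LQRSystem
end ZeroOrderLQR

namespace ZeroOrderLQR

/-! ### Taylor estimate along a segment -/

section Taylor

variable {E : Type*} [NormedAddCommGroup E] [InnerProductSpace ℝ E] [CompleteSpace E]

lemma hasDerivAt_line {f : E → ℝ} {x v : E} {t : ℝ} (hf : DifferentiableAt ℝ f (x + t • v)) :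
    HasDerivAt (fun s : ℝ => f (x + s • v)) (inner ℝ (gradient f (x + t • v)) v) t := by
  have h1 : HasDerivAt (fun s : ℝ => x + s • v) v t := by
    simpa using ((hasDerivAt_id t).smul_const v).const_add x
  simpa [Function.comp_def] using
    hf.hasGradientAt.hasFDerivAt.comp_hasDerivAt t h1

/-- The remainder has derivative at most `φ t ‖v‖²` along the segment. Gradients are compared only
with that at `x`, which is all that smoothness on the bounded set offers. -/
lemma abs_sub_le_of_gradient_lipschitz {f : E → ℝ} {x v : E} {φ : ℝ}
    (hd : ∀ t ∈ Set.Icc (0 : ℝ) 1, DifferentiableAt ℝ f (x + t • v))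
    (hL : ∀ t ∈ Set.Icc (0 : ℝ) 1,
      ‖gradient f (x + t • v) - gradient f x‖ ≤ φ * (t * ‖v‖)) :
    |f (x + v) - f x - inner ℝ (gradient f x) v| ≤ φ / 2 * ‖v‖ ^ 2 := by
  set h : ℝ → ℝ := fun t => f (x + t • v) - f x - t * inner ℝ (gradient f x) v with hh
  have hder : ∀ t ∈ Set.Icc (0 : ℝ) 1,
      HasDerivAt h (inner ℝ (gradient f (x + t • v)) v - inner ℝ (gradient f x) v) t := by
    intro t ht
    have := ((hasDerivAt_line (hd t ht)).sub_const (f x)).sub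
      ((hasDerivAt_id t).mul_const (inner ℝ (gradient f x) v))
    rwa [one_mul] at this
  have key := image_norm_le_of_norm_deriv_right_le_deriv_boundary (a := 0) (b := 1) (f := h)
    (f' := fun t => inner ℝ (gradient f (x + t • v)) v - inner ℝ (gradient f x) v)
    (B := fun t => φ / 2 * ‖v‖ ^ 2 * t ^ 2) (B' := fun t => φ * ‖v‖ ^ 2 * t)
    (fun t ht => (hder t ht).continuousAt.continuousWithinAt)
    (fun t ht => (hder t ⟨ht.1, ht.2.le⟩).hasDerivWithinAt) (by simp [hh])
    (fun t => by
      have := (hasDerivAt_pow 2 t).const_mul (φ / 2 * ‖v‖ ^ 2)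
      refine this.congr_deriv ?_
      norm_num
      ring)
    (fun t ht => by
      rw [← inner_sub_left]
      refine (norm_inner_le_norm _ _).trans ?_
      refine (mul_le_mul_of_nonneg_right (hL t ⟨ht.1, ht.2.le⟩) (norm_nonneg v)).trans
        (le_of_eq ?_)
      ring)
    (Set.right_mem_Icc.2 zero_le_one)
  simpa [hh] using key

end Taylor

/-! ### Rotation invariance of the uniform distribution on the sphere -/

section Sphere

open LQRSystem
open scoped Pointwise

variable {m n : ℕ}

/-- The action of a linear isometry on unit directions. -/
noncomputable def rotateDirection (L : Policy m n ≃ₗᵢ[ℝ] Policy m n) (u : Direction m n) : Direction m n :=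
  ⟨L u, by simp⟩

/-- The sphere measure of a set is a multiple of the volume of the cone over it; linear isometries
carry cones to cones and preserve volume. -/
lemma measurePreserving_rotateDirection (L : Policy m n ≃ₗᵢ[ℝ] Policy m n) :
    MeasurePreserving (rotateDirection L) (unifSphere m n) (unifSphere m n) := by
  have hm : Measurable (rotateDirection L) :=
    (L.continuous.comp continuous_subtype_val).subtype_mk _ |>.measurable
  refine MeasurePreserving.smul_measure (μa := (volume : Measure (Policy m n)).toSphere)
    (μb := (volume : Measure (Policy m n)).toSphere) ⟨hm, ?_⟩ _
  ext s hs
  rw [Measure.map_apply hm hs, Measure.toSphere_apply' _ (hm hs), Measure.toSphere_apply' _ hs]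
  congr 1
  have : Set.Ioo (0 : ℝ) 1 • ((↑) '' (rotateDirection L ⁻¹' s) : Set (Policy m n)) =
      L ⁻¹' (Set.Ioo (0 : ℝ) 1 • ((↑) '' s : Set (Policy m n))) := by
    ext x
    simp only [Set.mem_smul, Set.mem_image, Set.mem_preimage]
    constructor
    · rintro ⟨t, ht, _, ⟨u, hu, rfl⟩, rfl⟩
      exact ⟨t, ht, _, ⟨_, hu, rfl⟩, by simp [rotateDirection]⟩
    · rintro ⟨t, ht, _, ⟨u, hu, rfl⟩, hx⟩
      refine ⟨t, ht, _, ⟨rotateDirection L.symm u, ?_, rfl⟩, ?_⟩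
      · have : rotateDirection L (rotateDirection L.symm u) = u := by
          ext1; simp [rotateDirection]
        rwa [this]
      · apply L.injective
        simp [rotateDirection, hx]
  rw [this]
  have hp : MeasurePreserving L.toMeasurableEquiv (volume : Measure (Policy m n)) volume :=
    L.measurePreserving
  exact hp.measure_preimage_equiv _

lemma integral_rotateDirection (L : Policy m n ≃ₗᵢ[ℝ] Policy m n) (g : Policy m n → ℝ) :
    ∫ u : Direction m n, g (L u) ∂unifSphere m n = ∫ u : Direction m n, g u ∂unifSphere m n := by
  have he : MeasurableEmbedding (rotateDirection L) := by
    refine Continuous.measurableEmbedding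
      ((L.continuous.comp continuous_subtype_val).subtype_mk _) fun u v huv => ?_
    exact Subtype.ext (L.injective (congrArg Subtype.val huv))
  exact (measurePreserving_rotateDirection L).integral_comp he fun u => g u

variable {i j : Fin n × Fin m}

/-- The rotation by the angle `θ` in the plane of the coordinates `i` and `j`. -/
noncomputable def planeRotation (i j : Fin n × Fin m) (θ : ℝ) (x : Policy m n) : Policy m n :=
  x + ((Real.cos θ - 1) * x i - Real.sin θ * x j) • EuclideanSpace.single i 1 +
    ((Real.cos θ - 1) * x j + Real.sin θ * x i) • EuclideanSpace.single j 1

lemma norm_planeRotation (hij : i ≠ j) (θ : ℝ) (x : Policy m n) :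
    ‖planeRotation i j θ x‖ = ‖x‖ := by
  rw [← sq_eq_sq₀ (norm_nonneg _) (norm_nonneg _), planeRotation]
  set a := (Real.cos θ - 1) * x i - Real.sin θ * x j
  set b := (Real.cos θ - 1) * x j + Real.sin θ * x i
  have h1 : inner ℝ x (a • EuclideanSpace.single i (1 : ℝ) : Policy m n) = a * x i := by
    simp [inner_smul_right, EuclideanSpace.inner_single_right]
  have h2 : inner ℝ (x + a • EuclideanSpace.single i (1 : ℝ))
      (b • EuclideanSpace.single j (1 : ℝ) : Policy m n) = b * x j := by
    simp [inner_add_left, inner_smul_right, inner_smul_left, EuclideanSpace.inner_single_right,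
      hij.symm]
  rw [norm_add_sq_real, norm_add_sq_real, h1, h2, norm_smul, norm_smul]
  simp only [PiLp.norm_single, norm_one, mul_one, Real.norm_eq_abs, sq_abs]
  have := Real.sin_sq_add_cos_sq θ
  simp only [a, b]
  linear_combination (x i ^ 2 + x j ^ 2) * this

/-- The rotation as a linear isometry. -/
noncomputable def planeRotationEquiv (hij : i ≠ j) (θ : ℝ) : Policy m n ≃ₗᵢ[ℝ] Policy m n :=
  LinearIsometry.toLinearIsometryEquiv
    { toFun := planeRotation i j θ
      map_add' := fun x y => by
        ext k; simp only [planeRotation, PiLp.add_apply, PiLp.smul_apply, smul_eq_mul]; ring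
      map_smul' := fun c x => by
        ext k
        simp only [planeRotation, PiLp.add_apply, PiLp.smul_apply, smul_eq_mul, RingHom.id_apply]
        ring
      norm_map' := norm_planeRotation hij θ } rfl

lemma integrable_direction [NeZero m] [NeZero n] {g : Direction m n → ℝ} (hg : Continuous g) :
    Integrable g (unifSphere m n) := by
  refine hg.integrable_of_hasCompactSupport ?_
  exact HasCompactSupport.of_compactSpace g

lemma hasDerivAt_planeRotation (θ : ℝ) (x : Policy m n) :
    HasDerivAt (fun θ => planeRotation i j θ x)
      ((-Real.sin θ * x i - Real.cos θ * x j) • EuclideanSpace.single i 1 +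
        (-Real.sin θ * x j + Real.cos θ * x i) • EuclideanSpace.single j 1) θ := by
  have h1 : HasDerivAt (fun θ => (Real.cos θ - 1) * x i - Real.sin θ * x j)
      (-Real.sin θ * x i - Real.cos θ * x j) θ :=
    (((Real.hasDerivAt_cos θ).sub_const 1).mul_const _).sub
      ((Real.hasDerivAt_sin θ).mul_const _)
  have h2 : HasDerivAt (fun θ => (Real.cos θ - 1) * x j + Real.sin θ * x i)
      (-Real.sin θ * x j + Real.cos θ * x i) θ :=
    (((Real.hasDerivAt_cos θ).sub_const 1).mul_const _).add
      ((Real.hasDerivAt_sin θ).mul_const _)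
  exact ((h1.smul_const _).const_add x).add (h2.smul_const _)

lemma abs_coord_le (x : Policy m n) (hx : ‖x‖ = 1) (k : Fin n × Fin m) : |x k| ≤ 1 := by
  rw [← hx]; exact PiLp.norm_apply_le x k

/-- The infinitesimal form of rotation invariance. -/
lemma integral_fderiv_rotation [NeZero m] [NeZero n] (hij : i ≠ j) {h : Policy m n → ℝ}
    (hh : ∀ u : Direction m n, ContDiffAt ℝ 1 h u) :
    ∫ u : Direction m n, fderiv ℝ h u (-(u : Policy m n) j • EuclideanSpace.single i 1 +
      (u : Policy m n) i • EuclideanSpace.single j 1) ∂unifSphere m n = 0 := by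
  have hcd : Continuous fun u : Direction m n => fderiv ℝ h u := by
    refine continuous_iff_continuousAt.2 fun u => ?_
    exact ContinuousAt.comp (f := fun u : Direction m n => (u : Policy m n))
      ((hh u).continuousAt_fderiv one_ne_zero) continuous_subtype_val.continuousAt
  have hc : Continuous fun u : Direction m n => h u := by
    refine continuous_iff_continuousAt.2 fun u => ?_
    exact ContinuousAt.comp (f := fun u : Direction m n => (u : Policy m n))
      (hh u).continuousAt continuous_subtype_val.continuousAt
  obtain ⟨C, hC⟩ := isCompact_univ.exists_bound_of_continuousOn hcd.continuousOn
  have hrot : ∀ θ (u : Direction m n), planeRotation i j θ u =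
      (rotateDirection (planeRotationEquiv hij θ) u : Policy m n) := fun θ u => rfl
  have hrc : ∀ θ, Continuous (rotateDirection (planeRotationEquiv hij θ)) := fun θ =>
    ((planeRotationEquiv hij θ).continuous.comp continuous_subtype_val).subtype_mk _
  have hderiv : ∀ (u : Direction m n) (θ : ℝ), HasDerivAt (fun θ => h (planeRotation i j θ u))
      (fderiv ℝ h (planeRotation i j θ u)
        ((-Real.sin θ * (u : Policy m n) i - Real.cos θ * (u : Policy m n) j) •
          EuclideanSpace.single i 1 +
        (-Real.sin θ * (u : Policy m n) j + Real.cos θ * (u : Policy m n) i) •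
          EuclideanSpace.single j 1)) θ := by
    intro u θ
    have h1 : DifferentiableAt ℝ h (planeRotation i j θ u) := by
      rw [hrot]; exact (hh _).differentiableAt one_ne_zero
    exact h1.hasFDerivAt.comp_hasDerivAt θ (hasDerivAt_planeRotation θ _)
  have key := hasDerivAt_integral_of_dominated_loc_of_deriv_le (μ := unifSphere m n)
    (F := fun θ u => h (planeRotation i j θ u)) (x₀ := (0 : ℝ)) (s := Set.univ)
    -- The velocity has two coefficients, each a sum of two products of numbers in `[-1, 1]`.
    (bound := fun _ => C * 4)
    (F' := fun θ u => fderiv ℝ h (planeRotation i j θ u)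
        ((-Real.sin θ * (u : Policy m n) i - Real.cos θ * (u : Policy m n) j) •
          EuclideanSpace.single i 1 +
        (-Real.sin θ * (u : Policy m n) j + Real.cos θ * (u : Policy m n) i) •
          EuclideanSpace.single j 1))
    Filter.univ_mem
    (.of_forall fun θ => (hc.comp (hrc θ)).aestronglyMeasurable)
    (integrable_direction (hc.comp (hrc 0)))
    (by
      refine Continuous.aestronglyMeasurable ?_
      refine Continuous.clm_apply (hcd.comp (hrc 0)) ?_
      fun_prop)
    (.of_forall fun u θ _ => by
      have hu : ‖(u : Policy m n)‖ = 1 := by simp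
      have a1 := abs_coord_le _ hu i
      have a2 := abs_coord_le _ hu j
      have a3 := Real.abs_sin_le_one θ
      have a4 := Real.abs_cos_le_one θ
      have b : ∀ s t : ℝ, |s| ≤ 1 → |t| ≤ 1 → |s * t| ≤ 1 := fun s t hs ht => by
        rw [abs_mul]; exact mul_le_one₀ hs (abs_nonneg _) ht
      refine (ContinuousLinearMap.le_opNorm _ _).trans ?_
      rw [hrot]
      have hC0 := hC (rotateDirection (planeRotationEquiv hij θ) u) (Set.mem_univ _)
      refine mul_le_mul hC0 ?_ (norm_nonneg _) ((norm_nonneg _).trans hC0)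
      refine (norm_add_le _ _).trans ?_
      rw [norm_smul, norm_smul, PiLp.norm_single, PiLp.norm_single,
        norm_one, mul_one, mul_one, Real.norm_eq_abs, Real.norm_eq_abs]
      have c1 := abs_sub (-Real.sin θ * (u : Policy m n) i) (Real.cos θ * (u : Policy m n) j)
      have c2 := abs_add_le (-Real.sin θ * (u : Policy m n) j) (Real.cos θ * (u : Policy m n) i)
      have d1 := b (-Real.sin θ) ((u : Policy m n) i) (by rwa [abs_neg]) a1
      have d2 := b (-Real.sin θ) ((u : Policy m n) j) (by rwa [abs_neg]) a2
      have d3 := b _ _ a4 a1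
      have d4 := b _ _ a4 a2
      linarith)
    (integrable_const _)
    (.of_forall fun u θ _ => hderiv u θ)
  have hconst : (fun θ => ∫ u : Direction m n, h (planeRotation i j θ u) ∂unifSphere m n) =
      fun _ => ∫ u : Direction m n, h u ∂unifSphere m n := by
    funext θ
    exact integral_rotateDirection (planeRotationEquiv hij θ) h
  have h0 := key.2
  rw [hconst] at h0
  have h1 := h0.unique (hasDerivAt_const (0 : ℝ) _)
  have hr0 : ∀ x : Policy m n, planeRotation i j 0 x = x := fun x => by simp [planeRotation]
  simpa [hr0] using h1

end Sphere
end ZeroOrderLQR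

namespace ZeroOrderLQR

/-! ### The bias of the one-point gradient estimate -/

section Bias

open LQRSystem

variable {m n : ℕ}

lemma continuous_comp_direction {F : Type*} [TopologicalSpace F] {g : Policy m n → F}
    (hg : ∀ u : Direction m n, ContinuousAt g u) : Continuous fun u : Direction m n => g u :=
  continuous_iff_continuousAt.2 fun u =>
    ContinuousAt.comp (f := fun u : Direction m n => (u : Policy m n)) (hg u)
      continuous_subtype_val.continuousAt

lemma norm_sub_inner_smul_le (u : Direction m n) (w : Policy m n) :
    ‖w - inner ℝ (u : Policy m n) w • (u : Policy m n)‖ ≤ ‖w‖ := by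
  have hu : ‖(u : Policy m n)‖ = 1 := by simp
  refine le_of_sq_le_sq ?_ (norm_nonneg _)
  rw [norm_sub_sq_real, inner_smul_right, norm_smul, mul_pow, hu, real_inner_comm,
    Real.norm_eq_abs, sq_abs]
  nlinarith [sq_nonneg (inner ℝ w (u : Policy m n))]

lemma integral_inner_direction (w : Policy m n) :
    ∫ u : Direction m n, inner ℝ (u : Policy m n) w ∂unifSphere m n = 0 := by
  have h := integral_rotateDirection (LinearIsometryEquiv.neg ℝ)
    (fun x : Policy m n => inner ℝ x w)
  simp only [LinearIsometryEquiv.coe_neg, inner_neg_left, integral_neg] at h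
  linarith

variable [NeZero m] [NeZero n]

/-- Apply infinitesimal rotation invariance in the `(i, j)` plane to `x ↦ g x * x j`:
differentiating the coordinate yields `g u * u i`, differentiating `g` the other terms. -/
lemma integral_mul_coord {i j : Fin n × Fin m} (hij : j ≠ i) {g : Policy m n → ℝ}
    (hg : ∀ u : Direction m n, ContDiffAt ℝ 1 g u) :
    ∫ u : Direction m n, g u * (u : Policy m n) i ∂unifSphere m n =
      ∫ u : Direction m n, ((u : Policy m n) j ^ 2 * fderiv ℝ g u (EuclideanSpace.single i 1) -
        (u : Policy m n) i * ((u : Policy m n) j * fderiv ℝ g u (EuclideanSpace.single j 1)))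
        ∂unifSphere m n := by
  have hcoord : ∀ (k : Fin n × Fin m) (x : Policy m n),
      HasFDerivAt (fun y : Policy m n => y k) (EuclideanSpace.proj k : Policy m n →L[ℝ] ℝ) x :=
    fun k x => (EuclideanSpace.proj k : Policy m n →L[ℝ] ℝ).hasFDerivAt
  have hgc := continuous_comp_direction fun u => (hg u).continuousAt
  have hgd : Continuous fun u : Direction m n => fderiv ℝ g u :=
    continuous_comp_direction fun u => (hg u).continuousAt_fderiv one_ne_zero
  have h := integral_fderiv_rotation (i := i) (j := j) hij.symm
    (h := fun x => g x * x j) fun u => (hg u).mul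
      (EuclideanSpace.proj j : Policy m n →L[ℝ] ℝ).contDiff.contDiffAt
  have hfd : ∀ (u : Direction m n), fderiv ℝ (fun x : Policy m n => g x * x j) u
      (-(u : Policy m n) j • EuclideanSpace.single i 1 +
        (u : Policy m n) i • EuclideanSpace.single j 1) = g u * (u : Policy m n) i -
      ((u : Policy m n) j ^ 2 * fderiv ℝ g u (EuclideanSpace.single i 1) -
        (u : Policy m n) i * ((u : Policy m n) j * fderiv ℝ g u (EuclideanSpace.single j 1))) := by
    intro u
    have h1 := ((hg u).differentiableAt one_ne_zero).hasFDerivAt.mul (hcoord j u)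
    have h2 : fderiv ℝ (fun x : Policy m n => g x * x j) u = _ := h1.fderiv
    rw [h2]
    simp [hij]
    ring
  simp only [hfd] at h
  rw [integral_sub (integrable_direction (by exact hgc.mul (by fun_prop)))
    (integrable_direction (by fun_prop))] at h
  linarith

/-- Sum over the `D - 1` indices `j ≠ i`. The missing summand `j = i` vanishes identically, so the
sum may run over all `j`, where `∑ u j² = 1`. -/
lemma integral_mul_coord_eq {g : Policy m n → ℝ}
    (hg : ∀ u : Direction m n, ContDiffAt ℝ 1 g u) (i : Fin n × Fin m) :
    (((m * n : ℕ) : ℝ) - 1) * ∫ u : Direction m n, g u * (u : Policy m n) i ∂unifSphere m n =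
      ∫ u : Direction m n, (fderiv ℝ g u (EuclideanSpace.single i 1) -
        (u : Policy m n) i * fderiv ℝ g u u) ∂unifSphere m n := by
  have hgd : Continuous fun u : Direction m n => fderiv ℝ g u :=
    continuous_comp_direction fun u => (hg u).continuousAt_fderiv one_ne_zero
  have h1 : (((m * n : ℕ) : ℝ) - 1) *
      ∫ u : Direction m n, g u * (u : Policy m n) i ∂unifSphere m n =
      ∑ j ∈ Finset.univ.erase i, ∫ u : Direction m n,
        ((u : Policy m n) j ^ 2 * fderiv ℝ g u (EuclideanSpace.single i 1) -
        (u : Policy m n) i * ((u : Policy m n) j * fderiv ℝ g u (EuclideanSpace.single j 1)))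
        ∂unifSphere m n := by
    rw [Finset.sum_congr rfl fun j hj => (integral_mul_coord (Finset.ne_of_mem_erase hj) hg).symm,
      Finset.sum_const, Finset.card_erase_of_mem (Finset.mem_univ i), nsmul_eq_mul]
    congr 1
    have : 1 ≤ m * n := Nat.one_le_iff_ne_zero.2 (mul_ne_zero (NeZero.ne m) (NeZero.ne n))
    simp only [Finset.card_univ, Fintype.card_prod, Fintype.card_fin]
    rw [mul_comm n m, Nat.cast_sub this, Nat.cast_one]
  rw [h1, ← integral_finsetSum _ fun j _ => integrable_direction (by fun_prop)]
  refine integral_congr_ae (.of_forall fun u => ?_)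
  have hu : ‖(u : Policy m n)‖ = 1 := by simp
  have hsq : ∑ j, (u : Policy m n) j ^ 2 = 1 := by
    rw [← EuclideanSpace.real_norm_sq_eq, hu, one_pow]
  have hsum : ∑ j, (u : Policy m n) j * fderiv ℝ g u (EuclideanSpace.single j 1) =
      fderiv ℝ g u u := by
    have h := congrArg (fderiv ℝ g u)
      ((EuclideanSpace.basisFun (Fin n × Fin m) ℝ).sum_repr (u : Policy m n))
    simpa only [map_sum, map_smul, smul_eq_mul, EuclideanSpace.basisFun_repr,
      EuclideanSpace.basisFun_apply] using h
  have h2 := Finset.sum_erase_eq_sub (f := fun j =>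
    ((u : Policy m n) j ^ 2 * fderiv ℝ g u (EuclideanSpace.single i 1) -
        (u : Policy m n) i * ((u : Policy m n) j * fderiv ℝ g u (EuclideanSpace.single j 1))))
    (Finset.mem_univ i)
  simp only
  rw [h2, Finset.sum_sub_distrib, ← Finset.sum_mul, ← Finset.mul_sum, hsq, hsum]
  ring

/-- Integration by parts on the sphere. -/
lemma integral_mul_inner {g : Policy m n → ℝ}
    (hg : ∀ u : Direction m n, ContDiffAt ℝ 1 g u) (w : Policy m n) :
    (((m * n : ℕ) : ℝ) - 1) *
      ∫ u : Direction m n, g u * inner ℝ (u : Policy m n) w ∂unifSphere m n =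
      ∫ u : Direction m n, fderiv ℝ g u (w - inner ℝ (u : Policy m n) w • (u : Policy m n))
        ∂unifSphere m n := by
  have hgc := continuous_comp_direction fun u => (hg u).continuousAt
  have hgd : Continuous fun u : Direction m n => fderiv ℝ g u :=
    continuous_comp_direction fun u => (hg u).continuousAt_fderiv one_ne_zero
  have hw : ∑ i, w i • (EuclideanSpace.single i 1 : Policy m n) = w := by
    simpa using (EuclideanSpace.basisFun (Fin n × Fin m) ℝ).sum_repr w
  have hin : ∀ u : Policy m n, inner ℝ u w = ∑ i, w i * u i := fun u => by
    simp [PiLp.inner_apply]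
  have h1 : ∀ u : Direction m n, g u * inner ℝ (u : Policy m n) w =
      ∑ i, w i * (g u * (u : Policy m n) i) := fun u => by
    rw [hin, Finset.mul_sum]
    exact Finset.sum_congr rfl fun i _ => by ring
  have h2 : ∀ u : Direction m n,
      fderiv ℝ g u (w - inner ℝ (u : Policy m n) w • (u : Policy m n)) =
      ∑ i, w i * (fderiv ℝ g u (EuclideanSpace.single i 1) -
        (u : Policy m n) i * fderiv ℝ g u u) := fun u => by
    have h := congrArg (fderiv ℝ g u) hw
    simp only [map_sum, map_smul, smul_eq_mul] at h
    rw [hin, map_sub, ← h, map_smul, smul_eq_mul, Finset.sum_mul, ← Finset.sum_sub_distrib]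
    exact Finset.sum_congr rfl fun i _ => by ring
  simp only [h1, h2]
  rw [integral_finsetSum _ fun i _ => integrable_direction
      (by exact (hgc.mul (by fun_prop)).const_mul (w i)),
    integral_finsetSum _ fun i _ => integrable_direction (by fun_prop), Finset.mul_sum]
  refine Finset.sum_congr rfl fun i _ => ?_
  rw [integral_const_mul, integral_const_mul, ← integral_mul_coord_eq hg]
  ring

lemma integral_inner_sub (a w : Policy m n) :
    (((m * n : ℕ) : ℝ) - 1) *
      ∫ u : Direction m n, inner ℝ a (u : Policy m n) * inner ℝ (u : Policy m n) w
        ∂unifSphere m n =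
      ∫ u : Direction m n, inner ℝ a (w - inner ℝ (u : Policy m n) w • (u : Policy m n))
        ∂unifSphere m n := by
  have h := integral_mul_inner (g := fun x : Policy m n => inner ℝ a x)
    (fun u => (innerSL ℝ a).contDiff.contDiffAt) w
  have hf : ∀ x : Policy m n, fderiv ℝ (fun x : Policy m n => inner ℝ a x) x = innerSL ℝ a :=
    fun x => (innerSL ℝ a).hasFDerivAt.fderiv
  simpa [hf] using h

/-- For linear `g`, integration by parts reads `(D - 1) J = ⟨a, w⟩ - J`. Nothing is divided by `D -
1`, so `D = 1` is included. -/
lemma integral_inner_mul_inner (a w : Policy m n) :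
    ((m * n : ℕ) : ℝ) * ∫ u : Direction m n, inner ℝ a (u : Policy m n) *
      inner ℝ (u : Policy m n) w ∂unifSphere m n = inner ℝ a w := by
  have h := integral_inner_sub a w
  have h1 : ∀ u : Direction m n,
      inner ℝ a (w - inner ℝ (u : Policy m n) w • (u : Policy m n)) =
        inner ℝ a w - inner ℝ a (u : Policy m n) * inner ℝ (u : Policy m n) w := fun u => by
    rw [inner_sub_right, inner_smul_right, mul_comm]
  simp only [h1] at h
  rw [integral_sub (integrable_const _) (integrable_direction (by fun_prop)), integral_const,
    probReal_univ, one_smul] at h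
  linarith

lemma abs_integral_direction_le {g : Direction m n → ℝ} {C : ℝ} (h : ∀ u, |g u| ≤ C) :
    |∫ u, g u ∂unifSphere m n| ≤ C := by
  have := norm_integral_le_of_norm_le_const (μ := unifSphere m n) (f := g) (C := C)
    (.of_forall h)
  simpa using this

/-- For `D ≥ 3`, integration by parts turns the error into an average of tangential components of
gradient differences, with factor `D / (D - 1) ≤ 3/2`. For `D ≤ 2` that factor is too large or
undefined; there the Taylor remainder `φ r² / 2` times `D / r` is at most `φ r`. -/
lemma abs_bias_le {f : Policy m n → ℝ} {K : Policy m n} {r φ : ℝ} (hr : 0 < r) (hφ : 0 ≤ φ)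
    (hf : ∀ x, ‖x - K‖ ≤ r → ContDiffAt ℝ 1 f x)
    (hL : ∀ x, ‖x - K‖ ≤ r → ‖gradient f x - gradient f K‖ ≤ φ * ‖x - K‖) (w : Policy m n) :
    |((m * n : ℕ) : ℝ) / r * (∫ u : Direction m n, f (K + r • (u : Policy m n)) *
      inner ℝ (u : Policy m n) w ∂unifSphere m n) - inner ℝ (gradient f K) w| ≤
      3 / 2 * φ * r * ‖w‖ := by
  set D : ℝ := ((m * n : ℕ) : ℝ) with hD
  have hpt : ∀ u : Direction m n, ‖K + r • (u : Policy m n) - K‖ = r := fun u => by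
    rw [add_sub_cancel_left, norm_smul, Real.norm_of_nonneg hr.le]; simp
  have hu : ∀ u : Direction m n, ‖(u : Policy m n)‖ = 1 := fun u => by simp
  have haff : ContDiff ℝ 1 fun x : Policy m n => K + r • x := by fun_prop
  have hg : ∀ u : Direction m n, ContDiffAt ℝ 1 (fun x => f (K + r • x)) u := fun u =>
    ContDiffAt.comp (u : Policy m n) (hf _ (hpt u).le) haff.contDiffAt
  have hgc : Continuous fun u : Direction m n => f (K + r • (u : Policy m n)) :=
    continuous_comp_direction (g := fun x => f (K + r • x)) fun u => (hg u).continuousAt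
  have hgrad := integral_inner_mul_inner (gradient f K) w
  rcases le_or_gt (m * n) 2 with h2 | h3
  · have hD2 : D ≤ 2 := by rw [hD]; exact_mod_cast h2
    have hrem : ∀ u : Direction m n, |(f (K + r • (u : Policy m n)) - f K -
        inner ℝ (gradient f K) (r • (u : Policy m n))) * inner ℝ (u : Policy m n) w| ≤
        φ / 2 * r ^ 2 * ‖w‖ := by
      intro u
      rw [abs_mul]
      have hn : ‖r • (u : Policy m n)‖ = r := by
        rw [norm_smul, Real.norm_of_nonneg hr.le, hu, mul_one]
      have hball : ∀ t ∈ Set.Icc (0 : ℝ) 1, ‖K + t • r • (u : Policy m n) - K‖ = t * r := by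
        intro t ht
        rw [add_sub_cancel_left, norm_smul, hn, Real.norm_of_nonneg ht.1]
      have h := abs_sub_le_of_gradient_lipschitz (f := f) (x := K) (v := r • (u : Policy m n))
        (φ := φ) (fun t ht => (hf _ (by
          rw [hball t ht]; nlinarith [ht.2])).differentiableAt one_ne_zero)
        (fun t ht => by
          have := hL (K + t • r • (u : Policy m n)) (by rw [hball t ht]; nlinarith [ht.2])
          rw [hball t ht] at this
          rwa [hn])
      rw [hn] at h
      have h' : |inner ℝ (u : Policy m n) w| ≤ ‖w‖ := by
        simpa [hu] using abs_real_inner_le_norm (u : Policy m n) w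
      exact mul_le_mul h h' (abs_nonneg _) (by positivity)
    have hint := abs_integral_direction_le hrem
    have hexp : ∫ u : Direction m n, (f (K + r • (u : Policy m n)) - f K -
        inner ℝ (gradient f K) (r • (u : Policy m n))) * inner ℝ (u : Policy m n) w
        ∂unifSphere m n = (∫ u : Direction m n, f (K + r • (u : Policy m n)) *
          inner ℝ (u : Policy m n) w ∂unifSphere m n) - r * ∫ u : Direction m n,
          inner ℝ (gradient f K) (u : Policy m n) * inner ℝ (u : Policy m n) w
          ∂unifSphere m n := by
      have e : ∀ u : Direction m n, (f (K + r • (u : Policy m n)) - f K -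
          inner ℝ (gradient f K) (r • (u : Policy m n))) * inner ℝ (u : Policy m n) w =
          f (K + r • (u : Policy m n)) * inner ℝ (u : Policy m n) w -
          (f K * inner ℝ (u : Policy m n) w + r * (inner ℝ (gradient f K) (u : Policy m n) *
            inner ℝ (u : Policy m n) w)) := fun u => by
        rw [inner_smul_right]; ring
      simp only [e]
      rw [integral_sub (integrable_direction (by exact hgc.mul (by fun_prop)))
          (integrable_direction (by fun_prop)),
        integral_add (integrable_direction (by fun_prop)) (integrable_direction (by fun_prop)),
        integral_const_mul, integral_const_mul, integral_inner_direction, mul_zero, zero_add]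
    rw [hexp] at hint
    set I := ∫ u : Direction m n, f (K + r • (u : Policy m n)) *
          inner ℝ (u : Policy m n) w ∂unifSphere m n
    have hD0 : 0 ≤ D := Nat.cast_nonneg _
    rw [← hgrad]
    set J := ∫ u : Direction m n, inner ℝ (gradient f K) (u : Policy m n) *
          inner ℝ (u : Policy m n) w ∂unifSphere m n
    have e : D / r * I - D * J = D / r * (I - r * J) := by field_simp
    rw [e, abs_mul, abs_of_nonneg (by positivity)]
    calc D / r * |I - r * J| ≤ D / r * (φ / 2 * r ^ 2 * ‖w‖) := by gcongr
      _ = D * (φ * r * ‖w‖ / 2) := by field_simp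
      _ ≤ 3 * (φ * r * ‖w‖ / 2) := by gcongr; linarith
      _ = _ := by ring
  · have hD3 : 3 ≤ D := by rw [hD]; exact_mod_cast h3
    have hfd : ∀ (u : Direction m n) (v : Policy m n),
        fderiv ℝ (fun x => f (K + r • x)) u v =
          r * inner ℝ (gradient f (K + r • (u : Policy m n))) v := by
      intro u v
      have h1 := ((hf _ (hpt u).le).differentiableAt one_ne_zero).hasGradientAt.hasFDerivAt
      have h2 : HasFDerivAt (fun x : Policy m n => K + r • x)
          (r • ContinuousLinearMap.id ℝ (Policy m n)) (u : Policy m n) :=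
        ((hasFDerivAt_id (u : Policy m n)).const_smul r).const_add K
      have h3 : HasFDerivAt (fun x => f (K + r • x)) _ (u : Policy m n) :=
        HasFDerivAt.comp (u : Policy m n) h1 h2
      rw [h3.fderiv]
      simp
    have hI := integral_mul_inner hg w
    have hJ := integral_inner_sub (gradient f K) w
    simp only [hfd] at hI
    rw [integral_const_mul] at hI
    have hgrc : Continuous fun u : Direction m n => gradient f (K + r • (u : Policy m n)) := by
      refine continuous_comp_direction (g := fun x => gradient f (K + r • x)) fun u => ?_
      have h1 : ContinuousAt (gradient f) (K + r • (u : Policy m n)) :=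
        (InnerProductSpace.toDual ℝ (Policy m n)).symm.continuous.continuousAt.comp
          ((hf _ (hpt u).le).continuousAt_fderiv one_ne_zero)
      exact ContinuousAt.comp (f := fun x : Policy m n => K + r • x) h1
        haff.continuous.continuousAt
    have hdiff : ∀ u : Direction m n, |inner ℝ (gradient f (K + r • (u : Policy m n)))
        (w - inner ℝ (u : Policy m n) w • (u : Policy m n)) - inner ℝ (gradient f K)
        (w - inner ℝ (u : Policy m n) w • (u : Policy m n))| ≤ φ * r * ‖w‖ := by
      intro u
      rw [← inner_sub_left]
      refine (abs_real_inner_le_norm _ _).trans ?_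
      have h1 := hL _ (hpt u).le
      rw [hpt] at h1
      exact mul_le_mul h1 (norm_sub_inner_smul_le u w) (norm_nonneg _) (by positivity)
    have hint := abs_integral_direction_le hdiff
    rw [integral_sub (integrable_direction (by fun_prop)) (integrable_direction (by fun_prop)),
      ← hJ] at hint
    set G := ∫ u : Direction m n, inner ℝ (gradient f (K + r • (u : Policy m n)))
        (w - inner ℝ (u : Policy m n) w • (u : Policy m n)) ∂unifSphere m n
    set I := ∫ u : Direction m n, f (K + r • (u : Policy m n)) *
          inner ℝ (u : Policy m n) w ∂unifSphere m n
    rw [← hgrad]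
    set J := ∫ u : Direction m n, inner ℝ (gradient f K) (u : Policy m n) *
          inner ℝ (u : Policy m n) w ∂unifSphere m n
    have hG : G = (D - 1) * I / r := by rw [eq_div_iff hr.ne']; linarith
    rw [hG] at hint
    have hD1 : 0 < D - 1 := by linarith
    have e : D / r * I - D * J = D / (D - 1) * ((D - 1) * I / r - (D - 1) * J) := by
      field_simp
    rw [e, abs_mul, abs_of_nonneg (by positivity)]
    have hq : D / (D - 1) ≤ 3 / 2 := by rw [div_le_iff₀ hD1]; linarith
    calc _ ≤ D / (D - 1) * (φ * r * ‖w‖) := by gcongr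
      _ ≤ 3 / 2 * (φ * r * ‖w‖) := by gcongr
      _ = _ := by ring

end Bias
end ZeroOrderLQR

namespace ZeroOrderLQR
namespace LQRSystem

/-! ### Steps inside and out of the bounded set -/

variable {m n : ℕ} {S : LQRSystem m n} {K₀ Kstar : Policy m n} {φ lam ρ μ : ℝ}

variable (S) in
/-- The policies whose cost gap is less than ten times that of `K₀`. -/
def interiorSet (K₀ Kstar : Policy m n) : Set (Policy m n) :=
  {K | K ∈ S.dom ∧ S.realCost K - S.realCost Kstar < 10 * S.gap K₀ Kstar}

lemma mem_boundedSet_of_mem_interiorSet {K : Policy m n} (h : K ∈ S.interiorSet K₀ Kstar) :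
    K ∈ S.boundedSet K₀ Kstar := ⟨h.1, h.2.le⟩

lemma Admissible.differentiableAt_realCost (hS : S.Admissible) {K : Policy m n}
    (hK : K ∈ S.dom) : DifferentiableAt ℝ S.realCost K :=
  (hS.contDiffAt_realCost hK (k := 1)).differentiableAt one_ne_zero

/-- The Lipschitz bound speaks only of points already in the domain. Along the segment it caps the
cost at `C(K) + lam ρ`; since that sublevel set is closed and the domain open, continuous induction
reaches the endpoint. -/
lemma CurvatureParams.add_mem_dom (h : S.CurvatureParams K₀ Kstar φ lam ρ μ) (hS : S.Admissible)
    {K v : Policy m n} (hK : K ∈ S.boundedSet K₀ Kstar) (hv : ‖v‖ ≤ ρ) : K + v ∈ S.dom := by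
  have hline : Continuous fun t : ℝ => K + t • v := by fun_prop
  set Z : Set ℝ := {t | K + t • v ∈ {K' | K' ∈ S.dom ∧ S.realCost K' ≤ S.realCost K + lam * ρ}}
  have hZ : IsClosed Z := (hS.isClosed_sublevel _).preimage hline
  have hsub : Set.Icc (0 : ℝ) 1 ⊆ Z := by
    refine (hZ.inter isClosed_Icc).Icc_subset_of_forall_exists_gt ?_ fun x hx y hy => ?_
    · simp only [Z, Set.mem_ofPred_eq, zero_smul, add_zero]
      exact ⟨hK.1, le_add_of_nonneg_right (mul_nonneg h.lam_pos.le h.ρ_pos.le)⟩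
    · have h1 : ∀ᶠ t in nhdsWithin x (Set.Ioi x), K + t • v ∈ S.dom :=
        nhdsWithin_le_nhds (hline.continuousAt.eventually (hS.isOpen_dom.mem_nhds hx.1.1))
      have h2 : ∀ᶠ t in nhdsWithin x (Set.Ioi x), t ∈ Set.Ioc x (min y 1) :=
        Ioc_mem_nhdsGT (lt_min hy hx.2.2)
      obtain ⟨t, ht1, ht2⟩ := (h1.and h2).exists
      have ht0 : 0 ≤ t := hx.2.1.trans ht2.1.le
      have ht1' : t ≤ 1 := ht2.2.trans (min_le_right _ _)
      have hn : ‖K + t • v - K‖ ≤ ρ := by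
        rw [add_sub_cancel_left, norm_smul, Real.norm_of_nonneg ht0]
        exact (mul_le_of_le_one_left (norm_nonneg v) ht1').trans hv
      refine ⟨t, ⟨ht1, ?_⟩, ht2.1, ht2.2.trans (min_le_left _ _)⟩
      have h3 := (h.lipschitz K hK).2 _ ht1 (by rwa [norm_sub_rev])
      have h4 := mul_le_mul_of_nonneg_left hn h.lam_pos.le
      linarith [le_abs_self (S.realCost (K + t • v) - S.realCost K)]
  have := (hsub (Set.right_mem_Icc.2 zero_le_one)).1
  rwa [one_smul] at this

/-- Either a step obeys the descent inequality, or the quadratic upper model already exceeds the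
threshold of the bounded set. -/
lemma CurvatureParams.step (h : S.CurvatureParams K₀ Kstar φ lam ρ μ) (hS : S.Admissible)
    {K v : Policy m n} (hK : K ∈ S.interiorSet K₀ Kstar)
    (hv : S.realCost K + (inner ℝ (gradient S.realCost K) v + φ / 2 * ‖v‖ ^ 2) -
      S.realCost Kstar < 10 * S.gap K₀ Kstar) :
    K + v ∈ S.dom ∧ S.realCost (K + v) ≤
      S.realCost K + (inner ℝ (gradient S.realCost K) v + φ / 2 * ‖v‖ ^ 2) := by
  have hφ := h.φ_pos
  have hline : Continuous fun t : ℝ => K + t • v := by fun_prop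
  set f := S.realCost with hf
  set a := inner ℝ (gradient f K) v
  set b := φ / 2 * ‖v‖ ^ 2 with hb
  have hb0 : 0 ≤ b := by positivity
  set q : ℝ → ℝ := fun t => f K + (t * a + t ^ 2 * b) with hq
  set c := f Kstar + 10 * S.gap K₀ Kstar with hc
  -- The model `q` is convex, hence below its chord, and both end values lie below the threshold
  -- `c`.
  have hqlt : ∀ t ∈ Set.Icc (0 : ℝ) 1, q t < c := by
    intro t ht
    have h1 : t ^ 2 * b ≤ t * b :=
      mul_le_mul_of_nonneg_right (by nlinarith [ht.1, ht.2]) hb0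
    have h2 : f K < c := by have := hK.2; linarith
    have h3 : f K + (a + b) < c := by linarith
    have h4 : q t ≤ (1 - t) * f K + t * (f K + (a + b)) := by simp only [hq]; linarith
    refine h4.trans_lt ?_
    rcases ht.1.eq_or_lt with h0 | h0
    · rw [← h0]; simpa using h2
    · nlinarith [ht.2]
  have hGc : IsClosed ((fun t : ℝ => K + t • v) ⁻¹' {K' | K' ∈ S.dom ∧ f K' ≤ c} ∩
      Set.Icc 0 1) := ((hS.isClosed_sublevel c).preimage hline).inter isClosed_Icc
  set G := (fun t : ℝ => K + t • v) ⁻¹' {K' | K' ∈ S.dom ∧ f K' ≤ c} ∩ Set.Icc 0 1 with hG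
  have hfc : ContinuousOn (fun t : ℝ => f (K + t • v)) G := fun t ht =>
    (ContinuousAt.comp (f := fun t : ℝ => K + t • v)
      (hS.differentiableAt_realCost ht.1.1).continuousAt hline.continuousAt).continuousWithinAt
  have hgc : ContinuousOn (fun t : ℝ => ‖gradient f (K + t • v) - gradient f K‖) G :=
    fun t ht => ((ContinuousAt.comp (f := fun t : ℝ => K + t • v)
      (hS.contDiffAt_gradient ht.1.1).continuousAt hline.continuousAt).sub
        continuousAt_const).norm.continuousWithinAt
  -- Invariant of a continuous induction along the segment. The gradient bound belongs to it because
  -- smoothness is local of radius `ρ`: the comparison with `K` is chained over short pieces.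
  set Z : Set ℝ := {t | K + t • v ∈ S.dom ∧ f (K + t • v) ≤ q t ∧
    ‖gradient f (K + t • v) - gradient f K‖ ≤ φ * t * ‖v‖} with hZ
  have hZc : IsClosed (Z ∩ Set.Icc 0 1) := by
    have : Z ∩ Set.Icc 0 1 = {t ∈ G | f (K + t • v) ≤ q t} ∩
        {t ∈ G | ‖gradient f (K + t • v) - gradient f K‖ ≤ φ * t * ‖v‖} := by
      ext t
      constructor
      · rintro ⟨⟨h1, h2, h3⟩, h4⟩
        have : t ∈ G := ⟨⟨h1, h2.trans (hqlt t h4).le⟩, h4⟩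
        exact ⟨⟨this, h2⟩, this, h3⟩
      · rintro ⟨⟨h1, h2⟩, _, h3⟩
        exact ⟨⟨h1.1.1, h2, h3⟩, h1.2⟩
    rw [this]
    exact (hGc.isClosed_le hfc (by fun_prop)).inter (hGc.isClosed_le hgc (by fun_prop))
  have hsub : Set.Icc (0 : ℝ) 1 ⊆ Z := by
    refine hZc.Icc_subset_of_forall_exists_gt ?_ fun x hx y hy => ?_
    · simp [hZ, hq, hK.1]
    · obtain ⟨⟨hx1, hx2, hx3⟩, hx4⟩ := hx
      have hxI : x ∈ Set.Icc (0 : ℝ) 1 := ⟨hx4.1, hx4.2.le⟩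
      have hxb : K + x • v ∈ S.boundedSet K₀ Kstar :=
        ⟨hx1, by have := hqlt x hxI; linarith⟩
      -- The new piece stays within `ρ` of `K + x • v`; the `+ 1` covers `v = 0`.
      set t := min (min y 1) (x + ρ / (‖v‖ + 1)) with ht
      have hv1 : 0 < ‖v‖ + 1 := by positivity
      have hxt : x < t := lt_min (lt_min hy hx4.2)
        (lt_add_of_pos_right _ (div_pos h.ρ_pos hv1))
      have hty : t ≤ y := (min_le_left _ _).trans (min_le_left _ _)
      have ht1 : t ≤ 1 := (min_le_left _ _).trans (min_le_right _ _)
      have hsmall : ∀ τ ∈ Set.Icc x t, (τ - x) * ‖v‖ ≤ ρ := by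
        intro τ hτ
        have h1 : τ - x ≤ ρ / (‖v‖ + 1) := by
          have := hτ.2.trans (min_le_right _ _); linarith
        calc (τ - x) * ‖v‖ ≤ ρ / (‖v‖ + 1) * (‖v‖ + 1) := by
              gcongr
              · exact div_nonneg h.ρ_pos.le hv1.le
              · linarith
          _ = ρ := div_mul_cancel₀ _ hv1.ne'
      have heq : ∀ τ : ℝ, K + τ • v = K + x • v + (τ - x) • v := fun τ => by
        rw [sub_smul]; abel
      have hnorm : ∀ τ ∈ Set.Icc x t, ‖(τ - x) • v‖ = (τ - x) * ‖v‖ := fun τ hτ => by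
        rw [norm_smul, Real.norm_of_nonneg (sub_nonneg.2 hτ.1)]
      have hdom : ∀ τ ∈ Set.Icc x t, K + τ • v ∈ S.dom := fun τ hτ => by
        rw [heq]
        exact h.add_mem_dom hS hxb (by rw [hnorm τ hτ]; exact hsmall τ hτ)
      have hgrad : ∀ τ ∈ Set.Icc x t,
          ‖gradient f (K + τ • v) - gradient f K‖ ≤ φ * τ * ‖v‖ := by
        intro τ hτ
        have h1 := (h.smooth _ hxb).2 _ (hdom τ hτ) (by
          rw [heq τ, sub_add_cancel_left, norm_neg, hnorm τ hτ]; exact hsmall τ hτ)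
        have h2 : ‖K + τ • v - (K + x • v)‖ = (τ - x) * ‖v‖ := by
          rw [heq τ, add_sub_cancel_left, hnorm τ hτ]
        rw [h2] at h1
        calc _ ≤ ‖gradient f (K + τ • v) - gradient f (K + x • v)‖ +
              ‖gradient f (K + x • v) - gradient f K‖ := norm_sub_le_norm_sub_add_norm_sub _ _ _
          _ ≤ φ * ((τ - x) * ‖v‖) + φ * x * ‖v‖ := add_le_add h1 hx3
          _ = φ * τ * ‖v‖ := by ring
      have hder : ∀ τ ∈ Set.Icc x t, HasDerivAt (fun τ => f (K + τ • v) - q τ)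
          (inner ℝ (gradient f (K + τ • v)) v - (a + 2 * τ * b)) τ := by
        intro τ hτ
        have h1 := hasDerivAt_line (hS.differentiableAt_realCost (hdom τ hτ))
        have h2 : HasDerivAt q (a + 2 * τ * b) τ := by
          have := (((hasDerivAt_id τ).mul_const a).add ((hasDerivAt_pow 2 τ).mul_const b)).const_add
            (f K)
          refine this.congr_deriv ?_
          norm_num
        exact h1.sub h2
      have hanti : AntitoneOn (fun τ => f (K + τ • v) - q τ) (Set.Icc x t) := by
        refine antitoneOn_of_deriv_nonpos (convex_Icc _ _)
          (fun τ hτ => (hder τ hτ).continuousAt.continuousWithinAt)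
          (fun τ hτ => (hder τ (interior_subset hτ)).differentiableAt.differentiableWithinAt)
          fun τ hτ => ?_
        have hτ' := interior_subset hτ
        rw [(hder τ hτ').deriv]
        have h1 := (real_inner_le_norm (gradient f (K + τ • v) - gradient f K) v).trans
          (mul_le_mul_of_nonneg_right (hgrad τ hτ') (norm_nonneg v))
        rw [inner_sub_left] at h1
        have h2 : φ * τ * ‖v‖ * ‖v‖ = 2 * τ * b := by rw [hb]; ring
        linarith
      have h5 := hanti (Set.left_mem_Icc.2 hxt.le) (Set.right_mem_Icc.2 hxt.le) hxt.le
      have htI : t ∈ Set.Icc x t := Set.right_mem_Icc.2 hxt.le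
      refine ⟨t, ⟨hdom t htI, ?_, hgrad t htI⟩, hxt, hty⟩
      simp only at h5
      linarith
  obtain ⟨h1, h2, _⟩ := hsub (Set.right_mem_Icc.2 zero_le_one)
  rw [one_smul] at h1 h2
  exact ⟨h1, by simpa [hq] using h2⟩

/-- The step `-∇C / φ` lowers the quadratic model by `‖∇C‖² / (2φ)`. The model thus stays below the
threshold, the descent inequality applies, and the new cost cannot be below the minimum. -/
lemma CurvatureParams.gradient_sq_le (h : S.CurvatureParams K₀ Kstar φ lam ρ μ)
    (hS : S.Admissible) (hopt : S.IsOptimal Kstar) {K : Policy m n}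
    (hK : K ∈ S.interiorSet K₀ Kstar) :
    ‖gradient S.realCost K‖ ^ 2 ≤ 2 * φ * (S.realCost K - S.realCost Kstar) := by
  have hφ := h.φ_pos
  set g := gradient S.realCost K
  have hq : inner ℝ g (-(φ⁻¹ • g)) + φ / 2 * ‖-(φ⁻¹ • g)‖ ^ 2 = -(‖g‖ ^ 2 / (2 * φ)) := by
    rw [inner_neg_right, inner_smul_right, real_inner_self_eq_norm_sq, norm_neg, norm_smul,
      Real.norm_of_nonneg (by positivity)]
    field_simp
    ring
  have hn : 0 ≤ ‖g‖ ^ 2 / (2 * φ) := by positivity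
  obtain ⟨h1, h2⟩ := h.step hS hK (v := -(φ⁻¹ • g)) (by rw [hq]; have := hK.2; linarith)
  rw [hq] at h2
  have h3 := hopt.realCost_le h1
  have h4 : ‖g‖ ^ 2 / (2 * φ) ≤ S.realCost K - S.realCost Kstar := by linarith
  rw [div_le_iff₀ (by positivity)] at h4
  linarith

lemma CurvatureParams.pl_le (h : S.CurvatureParams K₀ Kstar φ lam ρ μ) (hopt : S.IsOptimal Kstar)
    {K : Policy m n} (hK : K ∈ S.dom) :
    μ * (S.realCost K - S.realCost Kstar) ≤ ‖gradient S.realCost K‖ ^ 2 := by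
  obtain ⟨hμ, _, x, hx, hmin, hPL⟩ := h.pl
  have h1 : S.realCost Kstar = S.realCost x :=
    le_antisymm (hopt.realCost_le hx) (hmin _ (hopt.mem_dom hx))
  rw [h1]
  exact hPL K hK

lemma mem_interiorSet_start (hK₀ : K₀ ∈ S.dom) (hg : 0 < S.gap K₀ Kstar) :
    K₀ ∈ S.interiorSet K₀ Kstar :=
  ⟨hK₀, by change S.gap K₀ Kstar < _; linarith⟩

lemma CurvatureParams.mu_le (h : S.CurvatureParams K₀ Kstar φ lam ρ μ) (hS : S.Admissible)
    (hopt : S.IsOptimal Kstar) (hK₀ : K₀ ∈ S.dom) (hg : 0 < S.gap K₀ Kstar) : μ ≤ 2 * φ := by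
  have h1 := (h.pl_le hopt hK₀).trans (h.gradient_sq_le hS hopt (mem_interiorSet_start hK₀ hg))
  exact le_of_mul_le_mul_right h1 hg

/-- Taylor's estimate, the gradient bound and AM-GM bound the gap at the query by `2 gap + φ ‖v‖² ≤
20 Δ₀ + 2 Δ₀`; the minimal cost is nonnegative. -/
lemma CurvatureParams.realCost_query_le (h : S.CurvatureParams K₀ Kstar φ lam ρ μ)
    (hS : S.Admissible) (hopt : S.IsOptimal Kstar) {K v : Policy m n}
    (hK : K ∈ S.interiorSet K₀ Kstar) (hv : ‖v‖ ≤ ρ)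
    (hr : φ * ‖v‖ ^ 2 ≤ 2 * S.gap K₀ Kstar) : S.realCost (K + v) ≤ 22 * S.realCost K₀ := by
  have hb := mem_boundedSet_of_mem_interiorSet hK
  have hφ := h.φ_pos
  have hn : ∀ t ∈ Set.Icc (0 : ℝ) 1, ‖t • v‖ = t * ‖v‖ := fun t ht => by
    rw [norm_smul, Real.norm_of_nonneg ht.1]
  have hle : ∀ t ∈ Set.Icc (0 : ℝ) 1, ‖t • v‖ ≤ ρ := fun t ht => by
    rw [hn t ht]; exact (mul_le_of_le_one_left (norm_nonneg v) ht.2).trans hv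
  have h1 := abs_sub_le_of_gradient_lipschitz (f := S.realCost) (x := K) (v := v) (φ := φ)
    (fun t ht => hS.differentiableAt_realCost (h.add_mem_dom hS hb (hle t ht)))
    (fun t ht => by
      have := (h.smooth K hb).2 _ (h.add_mem_dom hS hb (hle t ht))
        (by rw [sub_add_cancel_left, norm_neg]; exact hle t ht)
      rwa [add_sub_cancel_left, hn t ht] at this)
  have h2 := h.gradient_sq_le hS hopt hK
  have h3 := real_inner_le_norm (gradient S.realCost K) v
  have h4 : ‖gradient S.realCost K‖ * ‖v‖ ≤
      (S.realCost K - S.realCost Kstar) + φ / 2 * ‖v‖ ^ 2 := by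
    have h5 : 0 ≤ (‖gradient S.realCost K‖ - φ * ‖v‖) ^ 2 := sq_nonneg _
    have h6 : 2 * φ * (‖gradient S.realCost K‖ * ‖v‖) ≤
        2 * φ * ((S.realCost K - S.realCost Kstar) + φ / 2 * ‖v‖ ^ 2) := by nlinarith
    exact le_of_mul_le_mul_left h6 (by positivity)
  have h7 := hK.2
  have h8 : 0 ≤ S.realCost Kstar := ENNReal.toReal_nonneg
  have h9 := (le_abs_self _).trans h1
  simp only [gap] at h7 hr
  linarith

end LQRSystem
end ZeroOrderLQR

namespace ZeroOrderLQR
namespace LQRSystem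

/-! ### The expected effect of one iteration -/

variable {m n : ℕ} {S : LQRSystem m n} {K₀ Kstar : Policy m n} {φ lam ρ μ : ℝ}

lemma measurable_queryPoint (r : ℝ) :
    Measurable fun p : Policy m n × Draw m n => queryPoint r p.1 p.2 :=
  measurable_fst.add ((measurable_subtype_coe.comp
    (measurable_snd.comp measurable_snd)).const_smul r)

variable (S) in
lemma measurable_observation (r : ℝ) : Measurable fun p : Policy m n × Draw m n =>
    S.sampleCost (queryPoint r p.1 p.2) p.2.1 := by
  have h : Measurable fun p : Policy m n × Draw m n => (queryPoint r p.1 p.2, p.2.1) :=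
    (measurable_queryPoint r).prodMk (measurable_fst.comp measurable_snd)
  exact Measurable.comp (f := fun p : Policy m n × Draw m n => (queryPoint r p.1 p.2, p.2.1))
    S.measurable_sampleCost h
variable (S) in
lemma measurable_observation_right (r : ℝ) (K : Policy m n) : Measurable fun d : Draw m n =>
    S.sampleCost (queryPoint r K d) d.1 :=
  (S.measurable_observation r).of_uncurry_left
    (f := fun K d => S.sampleCost (queryPoint r K d) d.1)

variable (S) in
lemma measurable_gradEst (r : ℝ) :
    Measurable fun p : Policy m n × Draw m n => S.gradEst r p.1 p.2 :=
  ((S.measurable_observation r).ennreal_toReal.mul_const _).smul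
    (measurable_subtype_coe.comp (measurable_snd.comp measurable_snd))

variable (S) in
/-- The law of a single draw. -/
noncomputable def singleDraw : Measure (Draw m n) := S.noiseSeq.prod (unifSphere m n)

section Observation

variable [NeZero m] [NeZero n]

lemma Admissible.isProbabilityMeasure_singleDraw (hS : S.Admissible) :
    IsProbabilityMeasure S.singleDraw := by
  have := hS.isProbabilityMeasure_noiseSeq
  unfold singleDraw
  infer_instance

variable {K : Policy m n} {r c : ℝ}

lemma Admissible.lintegral_observation_sq_le (hS : S.Admissible)
    (hK : ∀ u : Direction m n, K + r • (u : Policy m n) ∈ S.dom ∧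
      S.realCost (K + r • (u : Policy m n)) ≤ c) :
    ∫⁻ d, S.sampleCost (queryPoint r K d) d.1 ^ 2 ∂S.singleDraw ≤
      ENNReal.ofReal (10 * S.Cm ^ 2 * c ^ 2) := by
  have := hS.isProbabilityMeasure_noiseSeq
  have hm := S.measurable_observation_right r K
  rw [singleDraw, lintegral_prod_symm _ (hm.pow_const 2).aemeasurable]
  refine (lintegral_mono (g := fun _ => ENNReal.ofReal (10 * S.Cm ^ 2 * c ^ 2)) fun u => ?_).trans
    (by simp)
  refine (hS.lintegral_sampleCost_sq_le (hK u).1).trans (ENNReal.ofReal_le_ofReal ?_)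
  have h0 : 0 ≤ S.realCost (K + r • (u : Policy m n)) := ENNReal.toReal_nonneg
  have h1 := (hK u).2
  gcongr

lemma Admissible.ae_observation_ne_top (hS : S.Admissible)
    (hK : ∀ u : Direction m n, K + r • (u : Policy m n) ∈ S.dom ∧
      S.realCost (K + r • (u : Policy m n)) ≤ c) :
    ∀ᵐ d ∂S.singleDraw, S.sampleCost (queryPoint r K d) d.1 ≠ ⊤ := by
  have hm := S.measurable_observation_right r K
  filter_upwards [ae_lt_top (hm.pow_const 2)
    ((hS.lintegral_observation_sq_le hK).trans_lt ENNReal.ofReal_lt_top).ne] with d hd h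
  simp [h] at hd

lemma Admissible.memLp_observation (hS : S.Admissible)
    (hK : ∀ u : Direction m n, K + r • (u : Policy m n) ∈ S.dom ∧
      S.realCost (K + r • (u : Policy m n)) ≤ c) :
    MemLp (fun d => (S.sampleCost (queryPoint r K d) d.1).toReal) 2 S.singleDraw := by
  have hm := S.measurable_observation_right r K
  rw [memLp_two_iff_integrable_sq hm.ennreal_toReal.aestronglyMeasurable]
  simp only [← ENNReal.toReal_pow]
  exact integrable_toReal_of_lintegral_ne_top (hm.pow_const 2).aemeasurable
    ((hS.lintegral_observation_sq_le hK).trans_lt ENNReal.ofReal_lt_top).ne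

lemma Admissible.integral_observation_sq_le (hS : S.Admissible)
    (hK : ∀ u : Direction m n, K + r • (u : Policy m n) ∈ S.dom ∧
      S.realCost (K + r • (u : Policy m n)) ≤ c) :
    ∫ d, (S.sampleCost (queryPoint r K d) d.1).toReal ^ 2 ∂S.singleDraw ≤
      10 * S.Cm ^ 2 * c ^ 2 := by
  have hm := S.measurable_observation_right r K
  have h := hS.lintegral_observation_sq_le hK
  simp only [← ENNReal.toReal_pow]
  rw [integral_toReal (hm.pow_const 2).aemeasurable
    (ae_lt_top (hm.pow_const 2) (h.trans_lt ENNReal.ofReal_lt_top).ne)]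
  exact ENNReal.toReal_le_of_le_ofReal (by positivity) h

lemma Admissible.integrable_observation_mul_inner (hS : S.Admissible)
    (hK : ∀ u : Direction m n, K + r • (u : Policy m n) ∈ S.dom ∧
      S.realCost (K + r • (u : Policy m n)) ≤ c) (w : Policy m n) :
    Integrable (fun d : Draw m n => (S.sampleCost (queryPoint r K d) d.1).toReal *
      inner ℝ (d.2 : Policy m n) w) S.singleDraw := by
  have := hS.isProbabilityMeasure_singleDraw
  have h := (hS.memLp_observation hK).integrable one_le_two
  have hm : Measurable fun d : Draw m n => inner ℝ (d.2 : Policy m n) w :=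
    (measurable_subtype_coe.comp measurable_snd).inner_const
  refine h.mul_bdd hm.aestronglyMeasurable (c := ‖w‖) (.of_forall fun d => ?_)
  simpa using norm_inner_le_norm (𝕜 := ℝ) (d.2 : Policy m n) w

lemma Admissible.integral_observation_mul_inner (hS : S.Admissible)
    (hK : ∀ u : Direction m n, K + r • (u : Policy m n) ∈ S.dom ∧
      S.realCost (K + r • (u : Policy m n)) ≤ c) (w : Policy m n) :
    ∫ d, (S.sampleCost (queryPoint r K d) d.1).toReal * inner ℝ (d.2 : Policy m n) w
      ∂S.singleDraw =
      ∫ u : Direction m n, S.realCost (K + r • (u : Policy m n)) * inner ℝ (u : Policy m n) w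
        ∂unifSphere m n := by
  have := hS.isProbabilityMeasure_noiseSeq
  have hi := hS.integrable_observation_mul_inner hK w
  rw [singleDraw] at hi ⊢
  rw [integral_prod_symm _ hi]
  refine integral_congr_ae (.of_forall fun u => ?_)
  simp only [queryPoint]
  rw [integral_mul_const, integral_toReal (S.measurable_sampleCost_right _).aemeasurable
    (ae_lt_top (S.measurable_sampleCost_right _) (hK u).1)]
  rfl

end Observation

open Classical in
variable (S) in
/-- The cost gap, frozen at the threshold off the policies whose gap is below it. -/
noncomputable def stoppedGap (K₀ Kstar K : Policy m n) : ℝ :=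
  if K ∈ S.interiorSet K₀ Kstar then S.realCost K - S.realCost Kstar else 10 * S.gap K₀ Kstar

lemma stoppedGap_of_mem {K : Policy m n} (h : K ∈ S.interiorSet K₀ Kstar) :
    S.stoppedGap K₀ Kstar K = S.realCost K - S.realCost Kstar := if_pos h

lemma stoppedGap_of_notMem {K : Policy m n} (h : K ∉ S.interiorSet K₀ Kstar) :
    S.stoppedGap K₀ Kstar K = 10 * S.gap K₀ Kstar := if_neg h

lemma stoppedGap_le (K : Policy m n) : S.stoppedGap K₀ Kstar K ≤ 10 * S.gap K₀ Kstar := by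
  by_cases h : K ∈ S.interiorSet K₀ Kstar
  · rw [stoppedGap_of_mem h]; exact h.2.le
  · exact (stoppedGap_of_notMem h).le

lemma IsOptimal.gap_nonneg (hopt : S.IsOptimal Kstar) (hK₀ : K₀ ∈ S.dom) :
    0 ≤ S.gap K₀ Kstar :=
  sub_nonneg.2 (hopt.realCost_le hK₀)

lemma IsOptimal.stoppedGap_nonneg (hopt : S.IsOptimal Kstar) (hK₀ : K₀ ∈ S.dom)
    (K : Policy m n) : 0 ≤ S.stoppedGap K₀ Kstar K := by
  by_cases h : K ∈ S.interiorSet K₀ Kstar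
  · rw [stoppedGap_of_mem h]; exact sub_nonneg.2 (hopt.realCost_le h.1)
  · rw [stoppedGap_of_notMem h]; linarith [hopt.gap_nonneg hK₀]

lemma Admissible.measurable_realCost (hS : S.Admissible) : Measurable S.realCost :=
  hS.lowerSemicontinuous_cost.measurable.ennreal_toReal

lemma Admissible.measurableSet_interiorSet (hS : S.Admissible) :
    MeasurableSet (S.interiorSet K₀ Kstar) :=
  hS.isOpen_dom.measurableSet.inter
    (measurableSet_lt (hS.measurable_realCost.sub_const _) measurable_const)

lemma Admissible.measurable_stoppedGap (hS : S.Admissible) :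
    Measurable (S.stoppedGap K₀ Kstar) :=
  Measurable.ite hS.measurableSet_interiorSet (hS.measurable_realCost.sub_const _)
    measurable_const

/-- If the model is below the threshold this is the descent inequality; otherwise the frozen gap,
never above the threshold, is below the model. Hence `v` may be arbitrarily long, and even leave the
domain. -/
lemma CurvatureParams.stoppedGap_add_le (h : S.CurvatureParams K₀ Kstar φ lam ρ μ)
    (hS : S.Admissible) {K v : Policy m n} (hK : K ∈ S.interiorSet K₀ Kstar) :
    S.stoppedGap K₀ Kstar (K + v) ≤ S.realCost K - S.realCost Kstar +
      (inner ℝ (gradient S.realCost K) v + φ / 2 * ‖v‖ ^ 2) := by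
  by_cases hv : S.realCost K + (inner ℝ (gradient S.realCost K) v + φ / 2 * ‖v‖ ^ 2) -
      S.realCost Kstar < 10 * S.gap K₀ Kstar
  · obtain ⟨h1, h2⟩ := h.step hS hK hv
    rw [stoppedGap_of_mem ⟨h1, by linarith⟩]
    linarith
  · have := S.stoppedGap_le (K₀ := K₀) (Kstar := Kstar) (K + v)
    linarith

lemma norm_smul_direction (u : Direction m n) {r : ℝ} (hr : 0 ≤ r) :
    ‖r • (u : Policy m n)‖ = r := by
  rw [norm_smul, Real.norm_of_nonneg hr]; simp

lemma CurvatureParams.query_bounds (h : S.CurvatureParams K₀ Kstar φ lam ρ μ)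
    (hS : S.Admissible) (hopt : S.IsOptimal Kstar) {K : Policy m n}
    (hK : K ∈ S.interiorSet K₀ Kstar) {r : ℝ} (hr : 0 < r) (hrρ : r ≤ ρ)
    (hr2 : φ * r ^ 2 ≤ 2 * S.gap K₀ Kstar) (u : Direction m n) :
    K + r • (u : Policy m n) ∈ S.dom ∧
      S.realCost (K + r • (u : Policy m n)) ≤ 22 * S.realCost K₀ := by
  have hn := norm_smul_direction u hr.le
  exact ⟨h.add_mem_dom hS (mem_boundedSet_of_mem_interiorSet hK) (by rwa [hn]),
    h.realCost_query_le hS hopt hK (by rwa [hn]) (by rwa [hn])⟩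

variable [NeZero m] [NeZero n]

lemma CurvatureParams.integral_stoppedGap_le (h : S.CurvatureParams K₀ Kstar φ lam ρ μ)
    (hS : S.Admissible) (hopt : S.IsOptimal Kstar) (hK₀ : K₀ ∈ S.dom) {K : Policy m n}
    (hK : K ∈ S.interiorSet K₀ Kstar) {r η ε : ℝ} (hr : 0 < r) (hrρ : r ≤ ρ)
    (hr2 : φ * r ^ 2 ≤ 2 * S.gap K₀ Kstar) (hη : 0 < η)
    (hrε : φ ^ 2 * r ^ 2 ≤ ε * μ / 120) (hG : φ * η * S.G2 K₀ lam r ≤ ε * μ / 240) :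
    ∫ d, S.stoppedGap K₀ Kstar (K - η • S.gradEst r K d) ∂S.singleDraw ≤
      (1 - η * μ / 2) * (S.realCost K - S.realCost Kstar) + η * μ * ε / 100 := by
  have := hS.isProbabilityMeasure_singleDraw
  have hφ := h.φ_pos
  have hq := h.query_bounds hS hopt hK hr hrρ hr2
  set f := S.realCost with hf
  set w := gradient f K with hw
  set D : ℝ := ((m * n : ℕ) : ℝ) / r with hD
  set sc : Draw m n → ℝ := fun d => (S.sampleCost (queryPoint r K d) d.1).toReal with hsc
  have hint1 := (hS.integrable_observation_mul_inner hq w).const_mul (-(η * D))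
  have hint2 := (hS.memLp_observation hq).integrable_sq.const_mul (φ / 2 * (η ^ 2 * D ^ 2))
  have hpt : ∀ d, S.stoppedGap K₀ Kstar (K - η • S.gradEst r K d) ≤ f K - f Kstar +
      (-(η * D) * (sc d * inner ℝ (d.2 : Policy m n) w) +
        φ / 2 * (η ^ 2 * D ^ 2) * sc d ^ 2) := by
    intro d
    have h1 := h.stoppedGap_add_le hS hK (v := -(η • S.gradEst r K d))
    rw [← sub_eq_add_neg] at h1
    refine h1.trans (le_of_eq ?_)
    have h2 : S.gradEst r K d = (sc d * D) • (d.2 : Policy m n) := rfl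
    rw [h2, inner_neg_right, inner_smul_right, inner_smul_right, norm_neg, norm_smul, norm_smul,
      mul_pow, mul_pow, Real.norm_eq_abs, Real.norm_eq_abs, sq_abs, sq_abs, real_inner_comm]
    simp only [norm_eq_of_mem_sphere, ← hf, ← hw]
    ring
  have hgm : Measurable (S.gradEst r K) :=
    (S.measurable_gradEst r).of_uncurry_left (f := fun K d => S.gradEst r K d)
  have hint0 : Integrable (fun d => S.stoppedGap K₀ Kstar (K - η • S.gradEst r K d))
      S.singleDraw := by
    refine Integrable.of_bound
      (hS.measurable_stoppedGap.comp ((hgm.const_smul η).const_sub K)).aestronglyMeasurable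
      (10 * S.gap K₀ Kstar) (.of_forall fun d => ?_)
    rw [Real.norm_of_nonneg (hopt.stoppedGap_nonneg hK₀ _)]
    exact stoppedGap_le _
  have h1 := integral_mono hint0 (by exact (integrable_const _).add (hint1.add hint2)) hpt
  rw [integral_add (integrable_const _) (by exact hint1.add hint2), integral_add hint1 hint2,
    integral_const_mul, integral_const_mul, integral_const, probReal_univ, one_smul,
    hS.integral_observation_mul_inner hq w] at h1
  have h2 := hS.integral_observation_sq_le hq
  have h3 := abs_bias_le (f := f) (K := K) hr hφ.le
    (fun x hx => by
      have := h.add_mem_dom hS (mem_boundedSet_of_mem_interiorSet hK) (hx.trans hrρ)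
      rw [add_sub_cancel] at this
      exact hS.contDiffAt_realCost this)
    (fun x hx => by
      have := h.add_mem_dom hS (mem_boundedSet_of_mem_interiorSet hK) (hx.trans hrρ)
      rw [add_sub_cancel] at this
      exact (h.smooth K (mem_boundedSet_of_mem_interiorSet hK)).2 x this
        (by rw [norm_sub_rev]; exact hx.trans hrρ)) w
  rw [← hw, real_inner_self_eq_norm_sq, ← hD] at h3
  set I := ∫ u : Direction m n, f (K + r • (u : Policy m n)) * inner ℝ (u : Policy m n) w
        ∂unifSphere m n
  set J := ∫ d, sc d ^ 2 ∂S.singleDraw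
  have h4 := h.pl_le hopt hK.1
  have h5 := hS.le_G2 hK₀ lam r
  rw [← hD] at h5
  have h6 := (abs_le.1 h3).1
  -- Young's inequality lets half of `‖w‖²` absorb the bias; PL is applied to the other half.
  have h7 : 3 / 2 * φ * r * ‖w‖ ≤ ‖w‖ ^ 2 / 2 + 9 / 8 * (φ ^ 2 * r ^ 2) := by
    nlinarith [sq_nonneg (‖w‖ - 3 / 2 * (φ * r))]
  -- Here `4840 = 10 · 22²`, less than a fifth of the `32000` in `Admissible.le_G2`.
  have h8 : D ^ 2 * J ≤ 4840 * (D * (S.Cm * f K₀)) ^ 2 := by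
    calc D ^ 2 * J ≤ D ^ 2 * (10 * S.Cm ^ 2 * (22 * f K₀) ^ 2) := by gcongr
      _ = _ := by ring
  have h9 : φ * η * (D ^ 2 * J) ≤ ε * μ / 1200 := by
    have : D ^ 2 * J ≤ S.G2 K₀ lam r / 5 := by
      have : 0 ≤ (D * (S.Cm * f K₀)) ^ 2 := sq_nonneg _
      linarith
    calc φ * η * (D ^ 2 * J) ≤ φ * η * (S.G2 K₀ lam r / 5) := by gcongr
      _ ≤ _ := by linarith
  -- Error budget in units of `ε μ`: bias `(9/8)/120` and variance `1/2400`, together below `1/100`.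
  have h10 : μ * (f K - f Kstar) / 2 - ε * μ / 100 ≤ D * I - φ / 2 * η * (D ^ 2 * J) := by
    have hw2 : μ * (f K - f Kstar) ≤ ‖w‖ ^ 2 := h4
    have hεμ : 0 ≤ ε * μ := by
      have : 0 ≤ φ ^ 2 * r ^ 2 := by positivity
      linarith
    linarith
  have h11 := mul_le_mul_of_nonneg_left h10 hη.le
  linarith

end LQRSystem
end ZeroOrderLQR

namespace ZeroOrderLQR
namespace LQRSystem

/-! ### The iterates as a stochastic process -/

variable {m n : ℕ} {S : LQRSystem m n} {K₀ Kstar : Policy m n} {η r : ℝ}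

lemma iterate_update (ω : ℕ → Draw m n) {t k : ℕ} (h : t ≤ k) (d : Draw m n) :
    S.iterate η r K₀ (Function.update ω k d) t = S.iterate η r K₀ ω t := by
  induction t with
  | zero => rfl
  | succ t ih =>
    have h' : t < k := h
    simp only [iterate]
    rw [ih h'.le, Function.update_of_ne h'.ne]

variable (S η r K₀) in
lemma measurable_iterate (t : ℕ) : Measurable fun ω => S.iterate η r K₀ ω t := by
  induction t with
  | zero => exact measurable_const
  | succ t ih =>
    have h : Measurable fun ω : ℕ → Draw m n => (S.iterate η r K₀ ω t, ω t) :=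
      ih.prodMk (measurable_pi_apply t)
    have h2 := Measurable.comp (f := fun ω : ℕ → Draw m n => (S.iterate η r K₀ ω t, ω t))
      (S.measurable_gradEst r) h
    exact ih.sub (h2.const_smul η)

variable (S η r K₀ Kstar) in
/-- The event that the first iterates, up to the `t`-th, all have a gap below the threshold. -/
def aliveSet (t : ℕ) : Set (ℕ → Draw m n) :=
  {ω | ∀ i ≤ t, S.iterate η r K₀ ω i ∈ S.interiorSet K₀ Kstar}

variable (S η r K₀ Kstar) in
/-- The cost gap of the `t`-th iterate, killed when the threshold is exceeded. -/
noncomputable def aliveGap (t : ℕ) : (ℕ → Draw m n) → ℝ :=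
  (S.aliveSet K₀ Kstar η r t).indicator
    fun ω => S.realCost (S.iterate η r K₀ ω t) - S.realCost Kstar

lemma aliveSet_update (ω : ℕ → Draw m n) {t k : ℕ} (h : t ≤ k) (d : Draw m n) :
    Function.update ω k d ∈ S.aliveSet K₀ Kstar η r t ↔ ω ∈ S.aliveSet K₀ Kstar η r t :=
  forall₂_congr fun _ hi => by rw [iterate_update ω (hi.trans h)]

lemma mem_aliveSet_succ {ω : ℕ → Draw m n} {t : ℕ} :
    ω ∈ S.aliveSet K₀ Kstar η r (t + 1) ↔ ω ∈ S.aliveSet K₀ Kstar η r t ∧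
      S.iterate η r K₀ ω (t + 1) ∈ S.interiorSet K₀ Kstar := by
  constructor
  · exact fun h => ⟨fun i hi => h i (hi.trans t.le_succ), h _ le_rfl⟩
  · rintro ⟨h1, h2⟩ i hi
    rcases Nat.le_succ_iff.1 hi with h | rfl
    · exact h1 i h
    · exact h2

lemma Admissible.measurableSet_aliveSet (hS : S.Admissible) (t : ℕ) :
    MeasurableSet (S.aliveSet K₀ Kstar η r t) := by
  have : S.aliveSet K₀ Kstar η r t =
      ⋂ i ∈ Set.Iic t, (fun ω => S.iterate η r K₀ ω i) ⁻¹' S.interiorSet K₀ Kstar := by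
    ext; simp [aliveSet]
  rw [this]
  exact .biInter (Set.to_countable _) fun i _ =>
    S.measurable_iterate K₀ η r i hS.measurableSet_interiorSet

lemma Admissible.measurable_aliveGap (hS : S.Admissible) (t : ℕ) :
    Measurable (S.aliveGap K₀ Kstar η r t) :=
  ((hS.measurable_realCost.comp (S.measurable_iterate K₀ η r t)).sub_const _).indicator
    (hS.measurableSet_aliveSet t)

lemma aliveGap_of_mem {ω : ℕ → Draw m n} {t : ℕ} (h : ω ∈ S.aliveSet K₀ Kstar η r t) :
    S.aliveGap K₀ Kstar η r t ω = S.realCost (S.iterate η r K₀ ω t) - S.realCost Kstar :=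
  Set.indicator_of_mem h _

lemma IsOptimal.aliveGap_nonneg (hopt : S.IsOptimal Kstar) (t : ℕ) (ω : ℕ → Draw m n) :
    0 ≤ S.aliveGap K₀ Kstar η r t ω :=
  Set.indicator_nonneg (fun _ hω => sub_nonneg.2 (hopt.realCost_le (hω t le_rfl).1)) ω

lemma IsOptimal.aliveGap_le (hopt : S.IsOptimal Kstar) (hK₀ : K₀ ∈ S.dom) (t : ℕ)
    (ω : ℕ → Draw m n) : S.aliveGap K₀ Kstar η r t ω ≤ 10 * S.gap K₀ Kstar :=
  Set.indicator_apply_le' (fun hω => (hω t le_rfl).2.le)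
    fun _ => by linarith [hopt.gap_nonneg hK₀]

variable [NeZero m] [NeZero n]

lemma Admissible.isProbabilityMeasure_drawLaw (hS : S.Admissible) :
    IsProbabilityMeasure S.drawLaw := by
  have := hS.isProbabilityMeasure_singleDraw
  change IsProbabilityMeasure (Measure.infinitePi fun _ : ℕ => S.singleDraw)
  infer_instance

lemma Admissible.integrable_aliveGap (hS : S.Admissible) (hopt : S.IsOptimal Kstar)
    (hK₀ : K₀ ∈ S.dom) (t : ℕ) : Integrable (S.aliveGap K₀ Kstar η r t) S.drawLaw := by
  have := hS.isProbabilityMeasure_drawLaw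
  refine Integrable.of_bound (hS.measurable_aliveGap t).aestronglyMeasurable
    (10 * S.gap K₀ Kstar) (.of_forall fun ω => ?_)
  rw [Real.norm_of_nonneg (hopt.aliveGap_nonneg t ω)]
  exact hopt.aliveGap_le hK₀ t ω

/-- The left side is the expected next frozen gap on survival up to `t`: the gap itself if the next
iterate is still below the threshold, `10 Δ₀` if it is not. Draw `t` is independent of the iterate
and of the survival event, so the one-step bound integrates. -/
lemma Admissible.integral_aliveGap_succ_le (hS : S.Admissible) (hopt : S.IsOptimal Kstar)
    (hK₀ : K₀ ∈ S.dom) {q b : ℝ}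
    (hstep : ∀ K ∈ S.interiorSet K₀ Kstar,
      ∫ d, S.stoppedGap K₀ Kstar (K - η • S.gradEst r K d) ∂S.singleDraw ≤
        q * (S.realCost K - S.realCost Kstar) + b) (t : ℕ) :
    ∫ ω, S.aliveGap K₀ Kstar η r (t + 1) ω ∂S.drawLaw + 10 * S.gap K₀ Kstar *
      (S.drawLaw.real (S.aliveSet K₀ Kstar η r t) -
        S.drawLaw.real (S.aliveSet K₀ Kstar η r (t + 1))) ≤
      q * ∫ ω, S.aliveGap K₀ Kstar η r t ω ∂S.drawLaw +
        b * S.drawLaw.real (S.aliveSet K₀ Kstar η r t) := by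
  classical
  have := hS.isProbabilityMeasure_singleDraw
  have := hS.isProbabilityMeasure_drawLaw
  have hE := fun t => hS.measurableSet_aliveSet (K₀ := K₀) (Kstar := Kstar) (η := η) (r := r) t
  set E := S.aliveSet K₀ Kstar η r with hEdef
  set g := S.gap K₀ Kstar with hg
  set next : (ℕ → Draw m n) → Draw m n → ℝ := fun ω d => S.stoppedGap K₀ Kstar
    (S.iterate η r K₀ ω t - η • S.gradEst r (S.iterate η r K₀ ω t) d) with hnext
  set F : (ℕ → Draw m n) → Draw m n → ℝ := fun ω d => (E t).indicator (fun _ => (1 : ℝ)) ω *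
    next ω d with hF
  have hnextm : Measurable fun p : (ℕ → Draw m n) × Draw m n => next p.1 p.2 := by
    have h1 : Measurable fun p : (ℕ → Draw m n) × Draw m n => S.iterate η r K₀ p.1 t :=
      (S.measurable_iterate K₀ η r t).comp measurable_fst
    have h2 := Measurable.comp
      (f := fun p : (ℕ → Draw m n) × Draw m n => (S.iterate η r K₀ p.1 t, p.2))
      (S.measurable_gradEst r) (h1.prodMk measurable_snd)
    exact hS.measurable_stoppedGap.comp (h1.sub (h2.const_smul η))
  have hFm : Measurable fun p : (ℕ → Draw m n) × Draw m n => F p.1 p.2 :=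
    ((measurable_const.indicator (hE t)).comp measurable_fst).mul hnextm
  have hnext0 : ∀ ω d, 0 ≤ next ω d := fun ω d => hopt.stoppedGap_nonneg hK₀ _
  have hnextC : ∀ ω d, next ω d ≤ 10 * g := fun ω d => stoppedGap_le _
  have hFb : ∀ ω d, |F ω d| ≤ 10 * g := by
    intro ω d
    have h1 : (E t).indicator (fun _ => (1 : ℝ)) ω ≤ 1 := Set.indicator_le_self' (by simp) ω
    have h0 : 0 ≤ (E t).indicator (fun _ => (1 : ℝ)) ω := Set.indicator_nonneg (by simp) ω
    rw [abs_of_nonneg (mul_nonneg h0 (hnext0 ω d))]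
    exact (mul_le_of_le_one_left (hnext0 ω d) h1).trans (hnextC ω d)
  have hFk : ∀ ω v w, F (Function.update ω t v) w = F ω w := by
    intro ω v w
    have h1 : (E t).indicator (fun _ => (1 : ℝ)) (Function.update ω t v) =
        (E t).indicator (fun _ => (1 : ℝ)) ω := by
      simp only [Set.indicator_apply, hEdef, aliveSet_update ω le_rfl v]
    simp only [hF, hnext]
    rw [h1, iterate_update ω le_rfl]
  have key : ∫ ω, F ω (ω t) ∂S.drawLaw = ∫ ω, ∫ d, F ω d ∂S.singleDraw ∂S.drawLaw :=
    integral_eval_eq (ν := S.singleDraw) hFm hFk hFb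
  have hind : ∀ t, Integrable ((E t).indicator fun _ => (1 : ℝ)) S.drawLaw := fun t =>
    (integrable_const 1).indicator (hE t)
  have hia := fun t => hS.integrable_aliveGap (η := η) (r := r) hopt hK₀ t
  have hint1 : ∀ t, ∫ ω, (E t).indicator (fun _ => (1 : ℝ)) ω ∂S.drawLaw = S.drawLaw.real (E t) :=
    fun t => integral_indicator_one (hE t)
  have hleft : ∀ ω, F ω (ω t) = S.aliveGap K₀ Kstar η r (t + 1) ω + 10 * g *
      ((E t).indicator (fun _ => (1 : ℝ)) ω - (E (t + 1)).indicator (fun _ => (1 : ℝ)) ω) := by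
    intro ω
    have hn : next ω (ω t) = S.stoppedGap K₀ Kstar (S.iterate η r K₀ ω (t + 1)) := rfl
    simp only [hF, hn]
    by_cases h1 : ω ∈ E t
    · by_cases h2 : S.iterate η r K₀ ω (t + 1) ∈ S.interiorSet K₀ Kstar
      · have h3 : ω ∈ E (t + 1) := mem_aliveSet_succ.2 ⟨h1, h2⟩
        rw [aliveGap_of_mem h3, stoppedGap_of_mem h2]
        simp [h1, h3]
      · have h3 : ω ∉ E (t + 1) := fun h => h2 (mem_aliveSet_succ.1 h).2
        rw [aliveGap, Set.indicator_of_notMem h3, stoppedGap_of_notMem h2]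
        simp [h1, h3, hg]
    · have h3 : ω ∉ E (t + 1) := fun h => h1 (mem_aliveSet_succ.1 h).1
      rw [aliveGap, Set.indicator_of_notMem h3]
      simp [h1, h3]
  have hright : ∀ ω, ∫ d, F ω d ∂S.singleDraw ≤ q * S.aliveGap K₀ Kstar η r t ω +
      b * (E t).indicator (fun _ => (1 : ℝ)) ω := by
    intro ω
    simp only [hF]
    rw [integral_const_mul]
    by_cases h1 : ω ∈ E t
    · rw [aliveGap_of_mem h1]
      simpa [h1] using hstep _ (h1 t le_rfl)
    · have h2 : S.aliveGap K₀ Kstar η r t ω = 0 := Set.indicator_of_notMem h1 _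
      simp [h1, h2]
  have hFi : Integrable (fun p : (ℕ → Draw m n) × Draw m n => F p.1 p.2)
      (S.drawLaw.prod S.singleDraw) :=
    Integrable.of_bound hFm.aestronglyMeasurable (10 * g) (.of_forall fun p => hFb _ _)
  have hle := integral_mono hFi.integral_prod_left
    (((hia t).const_mul q).add ((hind t).const_mul b)) hright
  rw [← key] at hle
  simp only [hleft, Pi.add_apply] at hle
  rw [integral_add (hia _) (by exact ((hind t).sub (hind (t + 1))).const_mul _),
    integral_const_mul, integral_sub (hind _) (hind _), integral_add ((hia t).const_mul q) ((hind t).const_mul b),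
    integral_const_mul, integral_const_mul, hint1, hint1] at hle
  exact hle

lemma integral_aliveGap_zero_le (hS : S.Admissible) (hopt : S.IsOptimal Kstar)
    (hK₀ : K₀ ∈ S.dom) : ∫ ω, S.aliveGap K₀ Kstar η r 0 ω ∂S.drawLaw ≤ S.gap K₀ Kstar := by
  have := hS.isProbabilityMeasure_drawLaw
  refine (integral_mono (hS.integrable_aliveGap hopt hK₀ 0)
    (integrable_const (S.gap K₀ Kstar)) fun ω => ?_).trans (by simp)
  exact Set.indicator_apply_le' (fun _ => le_rfl) fun _ => hopt.gap_nonneg hK₀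

lemma real_aliveSet_zero (hS : S.Admissible) (hK₀ : K₀ ∈ S.dom) (hg : 0 < S.gap K₀ Kstar) :
    S.drawLaw.real (S.aliveSet K₀ Kstar η r 0) = 1 := by
  have := hS.isProbabilityMeasure_drawLaw
  have : S.aliveSet K₀ Kstar η r 0 = Set.univ := by
    refine Set.eq_univ_of_forall fun ω i hi => ?_
    rw [Nat.le_zero.1 hi]
    exact mem_interiorSet_start hK₀ hg
  rw [this, probReal_univ]

/-- The supermartingale bound for leaving the region where the gap is below the threshold. -/
lemma Admissible.escape_le (hS : S.Admissible) (hopt : S.IsOptimal Kstar)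
    (hK₀ : K₀ ∈ S.dom) (hg : 0 < S.gap K₀ Kstar) {q b : ℝ} (hq : q ≤ 1) (hb : 0 ≤ b)
    (hstep : ∀ K ∈ S.interiorSet K₀ Kstar,
      ∫ d, S.stoppedGap K₀ Kstar (K - η • S.gradEst r K d) ∂S.singleDraw ≤
        q * (S.realCost K - S.realCost Kstar) + b) (t : ℕ) :
    ∫ ω, S.aliveGap K₀ Kstar η r t ω ∂S.drawLaw +
      10 * S.gap K₀ Kstar * (1 - S.drawLaw.real (S.aliveSet K₀ Kstar η r t)) ≤
      S.gap K₀ Kstar + b * t := by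
  have := hS.isProbabilityMeasure_drawLaw
  induction t with
  | zero =>
    rw [real_aliveSet_zero hS hK₀ hg]
    simpa using integral_aliveGap_zero_le hS hopt hK₀
  | succ t ih =>
    have h1 := hS.integral_aliveGap_succ_le hopt hK₀ hstep t
    have h2 : 0 ≤ ∫ ω, S.aliveGap K₀ Kstar η r t ω ∂S.drawLaw :=
      integral_nonneg (hopt.aliveGap_nonneg t)
    have h3 := mul_le_of_le_one_left h2 hq
    have h4 := mul_le_of_le_one_right hb
      (measureReal_le_one (μ := S.drawLaw) (s := S.aliveSet K₀ Kstar η r t))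
    push_cast
    linarith

/-- Linear convergence, up to the noise level, of the expected gap on the event that the gap has
stayed below the threshold. -/
lemma Admissible.integral_aliveGap_le (hS : S.Admissible) (hopt : S.IsOptimal Kstar)
    (hK₀ : K₀ ∈ S.dom) {q b : ℝ} (hq0 : 0 ≤ q) (hq : q < 1) (hb : 0 ≤ b)
    (hstep : ∀ K ∈ S.interiorSet K₀ Kstar,
      ∫ d, S.stoppedGap K₀ Kstar (K - η • S.gradEst r K d) ∂S.singleDraw ≤
        q * (S.realCost K - S.realCost Kstar) + b) (t : ℕ) :
    ∫ ω, S.aliveGap K₀ Kstar η r t ω ∂S.drawLaw ≤ q ^ t * S.gap K₀ Kstar + b / (1 - q) := by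
  have := hS.isProbabilityMeasure_drawLaw
  have hq1 : 0 < 1 - q := by linarith
  induction t with
  | zero =>
    have := integral_aliveGap_zero_le (η := η) (r := r) hS hopt hK₀
    have h2 : 0 ≤ b / (1 - q) := by positivity
    linarith
  | succ t ih =>
    have h1 := hS.integral_aliveGap_succ_le hopt hK₀ hstep t
    have h3 := mul_le_mul_of_nonneg_left ih hq0
    have h4 := mul_le_of_le_one_right hb
      (measureReal_le_one (μ := S.drawLaw) (s := S.aliveSet K₀ Kstar η r t))
    have h5 : S.drawLaw.real (S.aliveSet K₀ Kstar η r (t + 1)) ≤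
        S.drawLaw.real (S.aliveSet K₀ Kstar η r t) :=
      measureReal_mono fun ω h => (mem_aliveSet_succ.1 h).1
    have h6 := mul_nonneg (mul_nonneg (by norm_num : (0 : ℝ) ≤ 10) (hopt.gap_nonneg hK₀))
      (sub_nonneg.2 h5)
    have h7 : q * (q ^ t * S.gap K₀ Kstar + b / (1 - q)) + b =
        q ^ (t + 1) * S.gap K₀ Kstar + b / (1 - q) := by
      field_simp
      ring
    linarith

/-- For a fixed alive history an infinite observation is a null event for the fresh draw;
integrating over histories keeps it null. -/
lemma Admissible.ae_observation_ne_top_of_mem_aliveSet (hS : S.Admissible)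
    (hfin : ∀ K ∈ S.interiorSet K₀ Kstar,
      ∀ᵐ d ∂S.singleDraw, S.sampleCost (queryPoint r K d) d.1 ≠ ⊤) (t : ℕ) :
    ∀ᵐ ω ∂S.drawLaw, ω ∈ S.aliveSet K₀ Kstar η r t →
      S.sampleCost (queryPoint r (S.iterate η r K₀ ω t) (ω t)) (ω t).1 ≠ ⊤ := by
  classical
  have := hS.isProbabilityMeasure_singleDraw
  have hE := hS.measurableSet_aliveSet (K₀ := K₀) (Kstar := Kstar) (η := η) (r := r) t
  set B : Set ((ℕ → Draw m n) × Draw m n) := {p | p.1 ∈ S.aliveSet K₀ Kstar η r t ∧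
    S.sampleCost (queryPoint r (S.iterate η r K₀ p.1 t) p.2) p.2.1 = ⊤} with hB
  have hBm : MeasurableSet B := by
    have h1 : Measurable fun p : (ℕ → Draw m n) × Draw m n => S.iterate η r K₀ p.1 t :=
      (S.measurable_iterate K₀ η r t).comp measurable_fst
    have h2 := Measurable.comp
      (f := fun p : (ℕ → Draw m n) × Draw m n => (S.iterate η r K₀ p.1 t, p.2))
      (S.measurable_observation r) (h1.prodMk measurable_snd)
    exact (measurable_fst hE).inter (h2 (measurableSet_singleton ⊤))
  have key := lintegral_eval_eq (ν := S.singleDraw) (k := t)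
    (F := fun ω d => B.indicator (fun _ => (1 : ℝ≥0∞)) (ω, d))
    (measurable_const.indicator hBm) (fun ω v w => by
      simp only [Set.indicator_apply, hB, Set.mem_ofPred_eq, aliveSet_update ω le_rfl v,
        iterate_update ω le_rfl v])
  have hzero : ∀ ω, ∫⁻ d, B.indicator (fun _ => (1 : ℝ≥0∞)) (ω, d) ∂S.singleDraw = 0 := by
    intro ω
    by_cases h : ω ∈ S.aliveSet K₀ Kstar η r t
    · refine lintegral_eq_zero_of_ae_eq_zero ?_
      filter_upwards [hfin _ (h t le_rfl)] with d hd
      exact Set.indicator_of_notMem (fun h' => hd h'.2) _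
    · have : ∀ d, B.indicator (fun _ => (1 : ℝ≥0∞)) (ω, d) = 0 := fun d =>
        Set.indicator_of_notMem (fun h' => h h'.1) _
      simp [this]
  simp only [hzero, lintegral_zero] at key
  have hm : Measurable fun ω : ℕ → Draw m n => B.indicator (fun _ => (1 : ℝ≥0∞)) (ω, ω t) :=
    (measurable_const.indicator hBm).comp (measurable_id.prodMk (measurable_pi_apply t))
  filter_upwards [(lintegral_eq_zero_iff hm).1 key] with ω hω h1 h2
  have h3 : (ω, ω t) ∈ B := ⟨h1, h2⟩
  simp [h3] at hω

lemma Admissible.lt_measure_successEvent (hS : S.Admissible)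
    (hfin : ∀ K ∈ S.interiorSet K₀ Kstar,
      ∀ᵐ d ∂S.singleDraw, S.sampleCost (queryPoint r K d) d.1 ≠ ⊤) {T : ℕ} {ε : ℝ}
    {G : Set (ℕ → Draw m n)} (hG : ∀ ω ∈ G, ω ∈ S.aliveSet K₀ Kstar η r T ∧
      S.realCost (S.iterate η r K₀ ω T) - S.realCost Kstar ≤ ε)
    (h : 3 / 4 < S.drawLaw.real G) :
    3 / 4 < S.drawLaw (S.successEvent η r ε K₀ Kstar T) := by
  have := hS.isProbabilityMeasure_drawLaw
  have h1 : (3 / 4 : ℝ≥0∞) < S.drawLaw G := by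
    rw [← ofReal_measureReal, ENNReal.lt_ofReal_iff_toReal_lt]
    · simpa using h
    · exact (ENNReal.div_lt_top (by simp) (by simp)).ne
  refine h1.trans_le (measure_mono_ae ?_)
  have h2 := ae_all_iff.2 fun t =>
    hS.ae_observation_ne_top_of_mem_aliveSet (η := η) (K₀ := K₀) (Kstar := Kstar) hfin t
  filter_upwards [h2] with ω hω hωG
  obtain ⟨h3, h4⟩ := hG ω hωG
  exact ⟨fun t ht => hω t fun i hi => h3 i (hi.trans ht.le), (h3 T le_rfl).1, h4⟩

end LQRSystem
end ZeroOrderLQR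

namespace ZeroOrderLQR
namespace LQRSystem

/-! ### Success probability -/

variable {m n : ℕ} [NeZero m] [NeZero n] {S : LQRSystem m n} {K₀ Kstar : Policy m n}
  {φ lam ρ μ ε η r : ℝ}

lemma Admissible.G2_pos (hS : S.Admissible) (hK₀ : K₀ ∈ S.dom) (hr : 0 < r) (lam : ℝ) :
    0 < S.G2 K₀ lam r := by
  have h1 := hS.le_G2 hK₀ lam r
  have h2 := hS.realCost_pos hK₀
  have h3 := hS.one_le_Cm
  have h4 : 0 < ((m * n : ℕ) : ℝ) :=
    Nat.cast_pos.2 (Nat.pos_of_ne_zero (mul_ne_zero (NeZero.ne m) (NeZero.ne n)))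
  have h5 : 0 < S.Cm := by linarith
  exact lt_of_lt_of_le (by positivity) h1

lemma Admissible.lt_measure_successEvent_zero (hS : S.Admissible) (hK₀ : K₀ ∈ S.dom)
    (hε : S.gap K₀ Kstar ≤ ε) :
    3 / 4 < S.drawLaw (S.successEvent η r ε K₀ Kstar 0) := by
  have := hS.isProbabilityMeasure_drawLaw
  have h : S.successEvent η r ε K₀ Kstar 0 = Set.univ :=
    Set.eq_univ_of_forall fun ω => ⟨fun t ht => absurd ht t.not_lt_zero, hK₀, hε⟩
  rw [h, measure_univ, ENNReal.div_lt_iff (by simp) (by simp)]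
  norm_num

/-- The success probability, from the one-step inequality with contraction `1 - c` and noise
level `c * ε / 50`. -/
lemma Admissible.lt_measure_successEvent_of_step (hS : S.Admissible)
    (hopt : S.IsOptimal Kstar) (hK₀ : K₀ ∈ S.dom)
    (hfin : ∀ K ∈ S.interiorSet K₀ Kstar,
      ∀ᵐ d ∂S.singleDraw, S.sampleCost (queryPoint r K d) d.1 ≠ ⊤)
    (hε : 0 < ε) (hεg : ε < 120 * S.gap K₀ Kstar)
    (hlog : ε * Real.log (120 * S.gap K₀ Kstar / ε) < 10 / 3 * S.gap K₀ Kstar)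
    {c : ℝ} (hc0 : 0 < c) (hc : c ≤ 1 / 2)
    (hstep : ∀ K ∈ S.interiorSet K₀ Kstar,
      ∫ d, S.stoppedGap K₀ Kstar (K - η • S.gradEst r K d) ∂S.singleDraw ≤
        (1 - c) * (S.realCost K - S.realCost Kstar) + c * ε / 50) {T : ℕ}
    (hT : 2 / c * Real.log (120 * S.gap K₀ Kstar / ε) ≤ T)
    (hT' : T < 2 / c * Real.log (120 * S.gap K₀ Kstar / ε) + 1) :
    3 / 4 < S.drawLaw (S.successEvent η r ε K₀ Kstar T) := by
  have := hS.isProbabilityMeasure_drawLaw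
  have hg : 0 < S.gap K₀ Kstar := by linarith
  have hb : 0 ≤ c * ε / 50 := by positivity
  have hE := hS.measurableSet_aliveSet (K₀ := K₀) (Kstar := Kstar) (η := η) (r := r) T
  have hesc := hS.escape_le hopt hK₀ hg (by linarith : 1 - c ≤ 1) hb hstep T
  have ha0 : 0 ≤ ∫ ω, S.aliveGap K₀ Kstar η r T ω ∂S.drawLaw :=
    integral_nonneg (hopt.aliveGap_nonneg T)
  set g := S.gap K₀ Kstar
  set L := Real.log (120 * g / ε) with hL
  set p := S.drawLaw.real (S.aliveSet K₀ Kstar η r T) with hp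
  set a := ∫ ω, S.aliveGap K₀ Kstar η r T ω ∂S.drawLaw
  -- The hypothesis on `ε` turns `ε L / 25` into `2/15 Δ₀`; the last term pays for rounding `T` up,
  -- using `c ≤ 1/2`.
  have hbT : c * ε / 50 * T ≤ 2 / 15 * g + ε / 100 := by
    have h1 : c * ε / 50 * T ≤ c * ε / 50 * (2 / c * L + 1) := by gcongr
    have h2 : c * ε / 50 * (2 / c * L + 1) = ε * L / 25 + c * ε / 50 := by
      field_simp
      ring
    have h3 : c * ε ≤ 1 / 2 * ε := by gcongr
    linarith
  -- If `ε ≥ 10 Δ₀`, survival already implies success, and `ε < 120 Δ₀` bounds the escape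
  -- probability by `(1 + 2/15 + 6/5) / 10 = 7/30 < 1/4`.
  rcases le_or_gt (10 * g) ε with hε10 | hε10
  · refine hS.lt_measure_successEvent hfin (G := S.aliveSet K₀ Kstar η r T)
      (fun ω hω => ⟨hω, (hω T le_rfl).2.le.trans hε10⟩) ?_
    rw [← hp]
    nlinarith
  -- With `ε < 10 Δ₀` the escape probability is at most `(1 + 2/15 + 1/10) / 10`.
  · have hp1 : 1 - p < 3 / 20 := by nlinarith
    have hL0 : 0 < L := Real.log_pos (by rw [lt_div_iff₀ hε]; linarith)
    have hpow : (1 - c) ^ T ≤ ε / (120 * g) := by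
      have h1 : 1 - c ≤ Real.exp (-c) := by linarith [Real.add_one_le_exp (-c)]
      calc (1 - c) ^ T ≤ Real.exp (-c) ^ T := pow_le_pow_left₀ (by linarith) h1 T
        _ = Real.exp (T * -c) := (Real.exp_nat_mul _ _).symm
        _ ≤ Real.exp (-L) := by
          refine Real.exp_le_exp.2 ?_
          have h2 : 2 / c * L * c ≤ T * c := by gcongr
          have h3 : 2 / c * L * c = 2 * L := by field_simp
          linarith
        _ = ε / (120 * g) := by
          rw [Real.exp_neg, hL, Real.exp_log (by positivity), inv_div]
    -- Contraction leaves `ε/120` and the noise `ε/50`, in total `17/600 < 1/35`. Markov then costs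
    -- `1/35`, and `3/20 + 1/35 < 1/4`.
    have ha : a ≤ ε / 35 := by
      have h1 := hS.integral_aliveGap_le hopt hK₀ (by linarith : 0 ≤ 1 - c) (by linarith) hb
        hstep T
      have h2 : (1 - c) ^ T * g ≤ ε / (120 * g) * g := by gcongr
      have h3 : ε / (120 * g) * g = ε / 120 := by field_simp
      have h4 : c * ε / 50 / (1 - (1 - c)) = ε / 50 := by
        rw [sub_sub_cancel]; field_simp
      linarith
    set B := {ω | ε ≤ S.aliveGap K₀ Kstar η r T ω} with hB
    have hmarkov : ε * S.drawLaw.real B ≤ a :=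
      mul_meas_ge_le_integral_of_nonneg (.of_forall (hopt.aliveGap_nonneg T))
        (hS.integrable_aliveGap hopt hK₀ T) ε
    have hB1 : S.drawLaw.real B ≤ 1 / 35 := by
      refine le_of_mul_le_mul_left (hmarkov.trans (ha.trans (le_of_eq ?_))) hε
      ring
    refine hS.lt_measure_successEvent hfin (G := S.aliveSet K₀ Kstar η r T \ B)
      (fun ω hω => ⟨hω.1, ?_⟩) ?_
    · have h1 : ¬ ε ≤ S.aliveGap K₀ Kstar η r T ω := hω.2
      rw [aliveGap_of_mem hω.1] at h1
      linarith
    · have h1 := le_measureReal_sdiff (μ := S.drawLaw) (s₁ := S.aliveSet K₀ Kstar η r T)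
        (s₂ := B)
      linarith

lemma CurvatureParams.lt_measure_successEvent (h : S.CurvatureParams K₀ Kstar φ lam ρ μ)
    (hS : S.Admissible) (hopt : S.IsOptimal Kstar) (hK₀ : K₀ ∈ S.dom)
    (hε : 0 < ε) (hη : 0 < η) (hr : 0 < r)
    (hlog : ε * Real.log (120 * S.gap K₀ Kstar / ε) < 10 / 3 * S.gap K₀ Kstar)
    (hη1 : η ≤ ε * μ / (240 * φ * S.G2 K₀ lam r)) (hη2 : η ≤ 1 / (2 * φ))
    (hr1 : r ≤ 1 / (2 * φ) * Real.sqrt (ε * μ / 30)) (hr2 : r ≤ ρ) :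
    3 / 4 < S.drawLaw (S.successEvent η r ε K₀ Kstar
      ⌈4 / (η * μ) * Real.log (120 * S.gap K₀ Kstar / ε)⌉₊) := by
  have hφ := h.φ_pos
  have hμ : 0 < μ := h.pl.1
  have hG2 := hS.G2_pos hK₀ hr lam
  have hg0 := hopt.gap_nonneg hK₀
  -- In the first case the logarithm is nonpositive, so `T = 0` and `K₀` itself succeeds.
  rcases le_or_gt (120 * S.gap K₀ Kstar) ε with hεg | hεg
  · have h1 : Real.log (120 * S.gap K₀ Kstar / ε) ≤ 0 :=
      Real.log_nonpos (by positivity) ((div_le_one hε).2 hεg)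
    rw [Nat.ceil_eq_zero.2 (mul_nonpos_of_nonneg_of_nonpos (by positivity) h1)]
    exact hS.lt_measure_successEvent_zero hK₀ (by linarith)
  have hg : 0 < S.gap K₀ Kstar := by linarith
  have hμφ := h.mu_le hS hopt hK₀ hg
  have hrε : φ ^ 2 * r ^ 2 ≤ ε * μ / 120 := by
    calc φ ^ 2 * r ^ 2 ≤ φ ^ 2 * (1 / (2 * φ) * Real.sqrt (ε * μ / 30)) ^ 2 := by gcongr
      _ = ε * μ / 120 := by
        rw [mul_pow, Real.sq_sqrt (by positivity)]
        field_simp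
        norm_num
  -- From `μ ≤ 2 φ` the bound on `r` becomes `φ r² ≤ ε / 60`, and `ε < 120 Δ₀`.
  have hrg : φ * r ^ 2 ≤ 2 * S.gap K₀ Kstar := by
    have h1 : ε * μ ≤ ε * (2 * φ) := by gcongr
    have h2 : φ * (φ * r ^ 2) ≤ φ * (ε / 60) := by linarith
    linarith [le_of_mul_le_mul_left h2 hφ]
  have hηG : φ * η * S.G2 K₀ lam r ≤ ε * μ / 240 := by
    rw [le_div_iff₀ (by positivity)] at hη1
    linarith
  have hημ : η * μ ≤ 1 := by
    rw [le_div_iff₀ (by positivity)] at hη2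
    calc η * μ ≤ η * (2 * φ) := by gcongr
      _ ≤ 1 := hη2
  have hL0 : 0 ≤ Real.log (120 * S.gap K₀ Kstar / ε) :=
    Real.log_nonneg (by rw [le_div_iff₀ hε]; linarith)
  have hTe : 2 / (η * μ / 2) * Real.log (120 * S.gap K₀ Kstar / ε) =
      4 / (η * μ) * Real.log (120 * S.gap K₀ Kstar / ε) := by
    field_simp
    ring
  -- With `c = ημ/2`, the noise `ημε/100` is `c ε / 50` and the iteration count `4/(ημ)` is `2/c`.
  refine hS.lt_measure_successEvent_of_step hopt hK₀
    (fun K hK => hS.ae_observation_ne_top (h.query_bounds hS hopt hK hr hr2 hrg)) hε hεg hlog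
    (c := η * μ / 2) (by positivity) (by linarith) (fun K hK => ?_)
    (hTe.trans_le (Nat.le_ceil _)) ?_
  · refine (h.integral_stoppedGap_le hS hopt hK₀ hK hr hr2 hrg hη hrε hηG).trans (le_of_eq ?_)
    ring
  · rw [hTe]
    exact Nat.ceil_lt_add_one (by positivity)

end LQRSystem
end ZeroOrderLQR

open ZeroOrderLQR in
theorem corollary3 {m n : ℕ} [NeZero m] [NeZero n] (S : LQRSystem m n) (hS : S.Admissible)
    (K₀ : Policy m n) (hK₀ : S.cost K₀ ≠ ⊤) :
    ∃ Kstar : Policy m n, S.IsOptimal Kstar ∧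
      (∃ φ lam ρ μ : ℝ, S.CurvatureParams K₀ Kstar φ lam ρ μ) ∧
      ∀ φ lam ρ μ : ℝ, S.CurvatureParams K₀ Kstar φ lam ρ μ →
        ∀ ε η r : ℝ, 0 < ε → 0 < η → 0 < r →
          ε * Real.log (120 * S.gap K₀ Kstar / ε) < 10 / 3 * S.gap K₀ Kstar →
          η ≤ min (ε * μ / (240 * φ * S.G2 K₀ lam r))
            (min (1 / (2 * φ)) (ρ / S.Ginf K₀ lam r)) →
          r ≤ min (min (1 / (2 * φ)) (ρ / lam) * μ / (8 * φ) * Real.sqrt (ε / 15))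
            (min (1 / (2 * φ) * Real.sqrt (ε * μ / 30)) ρ) →
          3 / 4 < S.drawLaw (S.successEvent η r ε K₀ Kstar
            ⌈4 / (η * μ) * Real.log (120 * S.gap K₀ Kstar / ε)⌉₊) := by
  obtain ⟨Kstar, hopt⟩ := hS.exists_isOptimal hK₀
  refine ⟨Kstar, hopt, hS.exists_curvatureParams hopt (hopt.mem_dom hK₀),
    fun φ lam ρ μ h ε η r hε hη hr hlog hη' hr' => ?_⟩
  simp only [le_min_iff] at hη' hr'
  exact h.lt_measure_successEvent hS hopt hK₀ hε hη hr hlog hη'.1 hη'.2.1 hr'.2.1 hr'.2.2
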